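/- **Corollary 4.6.** Let $k\ge 1$, $0<\gamma<1$, and let $P$ be a probability measure on $\mathbb R^k$. *MCD functionals.* For a measure $Q$ on $\mathbb R^k$ and a measurable $\phi:\mathbb R^k\to[0,1]$ with $\int\phi\,dQ\ge\gamma$ and $\int\|x\|^2\phi(x)\,Q(dx)<\infty$ put $$T_Q(\phi)=\frac{\int x\phi(x)\,Q(dx)}{\int\phi\,dQ},\qquad C_Q(\phi)=\frac{\int (x-T_Q(\phi))(x-T_Q(\phi))'\phi(x)\,Q(dx)}{\int\phi\,dQ},$$ $$r_Q(\phi)=\inf\{s>0: Q(E(T_Q(\phi),C_Q(\phi),s))\ge\gamma\},\qquad E(m,S,s)=\{x:(x-m)'S^{-1}(x-m)\le s^2\}.$$ If $\phi_Q$ minimizes $\det C_Q(\phi)$ over all such $\phi$, then $\mu(Q)=T_Q(\phi_Q)$, $\Sigma(Q)=C_Q(\phi_Q)$ and $\rho(Q)=r_Q(\phi_Q)$ are (values of) the MCD functionals at $Q$. For such a functional $\Theta$, let $$\mathrm{IF}(x;\Theta,P)=\lim_{\varepsilon\downarrow0}\frac{\Theta((1-\varepsilon)P+\varepsilon\delta_x)-\Theta(P)}{\varepsilon};$$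 by this we mean that values of $\Theta$ exist at $P$ and at $(1-\varepsilon)P+\varepsilon\delta_x$ for all small $\varepsilon>0$, and that the limit exists and is the same for every choice of these values. *Assumptions.* $P$ has density $f(x)=h(\|x\|^2)$ with $h:[0,\infty)\to[0,\infty)$ non-increasing. Let $r>0$ be determined by $$\frac{2\pi^{k/2}}{\Gamma(k/2)}\int_0^{r}h(s^2)s^{k-1}\,ds=\gamma ,$$ and suppose that $h$ is continuous at $r^2$ and not constant on $(0,r^2)$. *Constants.* Let $\alpha>0$ be given by $\alpha^2=\frac{2\pi^{k/2}}{\gamma k\Gamma(k/2)}\int_0^{r}h(s^2)s^{k+1}\,ds$, and put $\rho_0=r/\alpha$, $\nu_0=\frac{2\pi^{k/2}}{\Gamma(k/2)}h(r^2)r^{k-1}\alpha$, $$\beta_1=\frac1\alpha\Big(\frac{\rho_0}{k}\nu_0-\gamma\Big),\quad \beta_2=\frac{2\rho_0^3\nu_0}{\alpha k(k+2)}-\frac{2\gamma}{\alpha},\quad \beta_6=\nu_0,\quad c_\mu=-\frac1{\alpha\beta_1},$$ $$\kappa_1=-\frac{r^2}{k\gamma},\quad \kappa_2=\frac{\alpha\beta_2+2\gamma}{k\gamma\alpha\beta_2},\quad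 \kappa_3=-\frac{2}{\alpha\beta_2},\quad \kappa_4=\frac{r^2-k\alpha^2}{k},$$ $$\lambda_1=-\frac{r}{2k\gamma\alpha^3},\quad \lambda_2=\frac{r^3}{2k\gamma\alpha^3}-\frac1{\beta_6},\quad \lambda_3=\frac{\gamma}{\beta_6}+\frac{r}{2k\alpha^3}(k\alpha^2-r^2).$$ *Conclusion.* For every $x\in\mathbb R^k$ with $\|x\|\ne r$, $$\mathrm{IF}(x;\mu,P)=c_\mu\mathbf 1_{\{\|x\|\le r\}}x,$$ $$\mathrm{IF}(x;\Sigma,P)=\mathbf 1_{\{\|x\|\le r\}}\big(\kappa_1 I+\kappa_2\|x\|^2 I+\kappa_3xx'\big)+\kappa_4 I,$$ $$\mathrm{IF}(x;\rho,P)=\lambda_1\mathbf 1_{\{\|x\|\le r\}}\|x\|^2+\lambda_2\mathbf 1_{\{\|x\|\le r\}}+\lambda_3 .$$ In particular, these three influence functions are bounded, uniformly over all $x$ with $\|x\|\ne r$. -/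

import Mathlib

open MeasureTheory Filter Topology

namespace MCD

noncomputable section

/-! ### Trimmed moments, ellipsoids, and the MCD functionals -/

/-- The class of trimming functions: measurable `φ : ℝᵏ → [0,1]` with `∫ φ dP ≥ γ` and
`∫ ‖x‖² φ(x) P(dx) < ∞`. -/
structure IsTrimming {k : ℕ} (γ : ℝ) (P : Measure (EuclideanSpace ℝ (Fin k)))
    (φ : EuclideanSpace ℝ (Fin k) → ℝ) : Prop where
  measurable : Measurable φ
  nonneg : ∀ x, 0 ≤ φ x
  le_one : ∀ x, φ x ≤ 1
  mass : γ ≤ ∫ x, φ x ∂P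
  moment : Integrable (fun x => ‖x‖ ^ 2 * φ x) P

/-- Trimmed mean `T_P(φ)`. -/
def trimmedMean {k : ℕ} (P : Measure (EuclideanSpace ℝ (Fin k)))
    (φ : EuclideanSpace ℝ (Fin k) → ℝ) : EuclideanSpace ℝ (Fin k) :=
  (∫ x, φ x ∂P)⁻¹ • ∫ x, φ x • x ∂P

/-- Trimmed covariance matrix `C_P(φ)`. -/
def trimmedCov {k : ℕ} (P : Measure (EuclideanSpace ℝ (Fin k)))
    (φ : EuclideanSpace ℝ (Fin k) → ℝ) : Matrix (Fin k) (Fin k) ℝ :=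
  Matrix.of fun i j => (∫ x, φ x ∂P)⁻¹ *
    ∫ x, (x i - trimmedMean P φ i) * (x j - trimmedMean P φ j) * φ x ∂P

/-- The ellipsoid `E(m, S, ρ) = {x : (x - m)' S⁻¹ (x - m) ≤ ρ²}`; meaningful for `S` positive
definite. -/
def ellipsoid {k : ℕ} (m : EuclideanSpace ℝ (Fin k)) (S : Matrix (Fin k) (Fin k) ℝ) (ρ : ℝ) :
    Set (EuclideanSpace ℝ (Fin k)) :=
  {x | (x - m).ofLp ⬝ᵥ (S⁻¹.mulVec (x - m).ofLp) ≤ ρ ^ 2}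

/-- The radius `r_P(φ) = inf {s > 0 : P(E(T_P(φ), C_P(φ), s)) ≥ γ}`. -/
def trimmedRadius {k : ℕ} (γ : ℝ) (P : Measure (EuclideanSpace ℝ (Fin k)))
    (φ : EuclideanSpace ℝ (Fin k) → ℝ) : ℝ :=
  sInf {s : ℝ | 0 < s ∧ γ ≤ P.real (ellipsoid (trimmedMean P φ) (trimmedCov P φ) s)}

/-- `φ` minimizes the determinant of the trimmed covariance over all trimming functions. -/
def IsMinimizer {k : ℕ} (γ : ℝ) (P : Measure (EuclideanSpace ℝ (Fin k)))
    (φ : EuclideanSpace ℝ (Fin k) → ℝ) : Prop :=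
  IsTrimming γ P φ ∧ ∀ ψ, IsTrimming γ P ψ → (trimmedCov P φ).det ≤ (trimmedCov P ψ).det

/-- The set of values of the MCD location functional `μ(P) = T_P(φ_P)`, one for each minimizer
`φ_P` (minimizers need not be unique at a general measure). -/
def locationValues {k : ℕ} (γ : ℝ) (P : Measure (EuclideanSpace ℝ (Fin k))) :
    Set (EuclideanSpace ℝ (Fin k)) :=
  {m | ∃ φ, IsMinimizer γ P φ ∧ m = trimmedMean P φ}

/-- The set of values of the MCD covariance functional `Σ(P) = C_P(φ_P)`. -/
def covValues {k : ℕ} (γ : ℝ) (P : Measure (EuclideanSpace ℝ (Fin k))) :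
    Set (Matrix (Fin k) (Fin k) ℝ) :=
  {S | ∃ φ, IsMinimizer γ P φ ∧ S = trimmedCov P φ}

/-- The set of values of the MCD radius functional `ρ(P) = r_P(φ_P)`. -/
def radiusValues {k : ℕ} (γ : ℝ) (P : Measure (EuclideanSpace ℝ (Fin k))) : Set ℝ :=
  {ρ | ∃ φ, IsMinimizer γ P φ ∧ ρ = trimmedRadius γ P φ}

/-! ### Influence functions -/

/-- The contaminated measure `(1 - ε) P + ε δ_x`. -/
def contaminate {X : Type*} [MeasurableSpace X] (P : Measure X) (x : X) (ε : ℝ) : Measure X :=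
  ENNReal.ofReal (1 - ε) • P + ENNReal.ofReal ε • Measure.dirac x

/-- `L` is the influence function at `x` of the (possibly set-valued) functional `Θ` at `P`:
`Θ` has a value at `P` and at `(1 - ε) P + ε δ_x` for all small `ε > 0`, and however these values
are chosen, `(Θ((1 - ε) P + ε δ_x) - Θ(P)) / ε → L` as `ε ↓ 0`. -/
def HasInfluence {X V : Type*} [MeasurableSpace X] [AddCommGroup V] [Module ℝ V]
    [TopologicalSpace V] (Θ : Measure X → Set V) (P : Measure X) (x : X) (L : V) : Prop :=
  (Θ P).Nonempty ∧
  (∀ᶠ ε in 𝓝[>] (0 : ℝ), (Θ (contaminate P x ε)).Nonempty) ∧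
  ∀ θ₀ ∈ Θ P, ∀ θ : ℝ → V, (∀ᶠ ε in 𝓝[>] (0 : ℝ), θ ε ∈ Θ (contaminate P x ε)) →
    Tendsto (fun ε : ℝ => ε⁻¹ • (θ ε - θ₀)) (𝓝[>] 0) (𝓝 L)

/-! ### The constants -/

/-- `2 π^{k/2} / Γ(k/2)`, the area of the unit sphere in `ℝᵏ`. -/
def sphereArea (k : ℕ) : ℝ := 2 * Real.pi ^ ((k : ℝ) / 2) / Real.Gamma ((k : ℝ) / 2)

/-- Probability of the centred ball of radius `r` under the density `x ↦ h(‖x‖²)`. -/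
def radialMass (k : ℕ) (h : ℝ → ℝ) (r : ℝ) : ℝ :=
  sphereArea k * ∫ s in (0 : ℝ)..r, h (s ^ 2) * s ^ (k - 1)

/-- `α(γ)`, the nonnegative root of the displayed expression for `α(γ)²`. -/
def alpha (k : ℕ) (γ r : ℝ) (h : ℝ → ℝ) : ℝ :=
  Real.sqrt (sphereArea k / (γ * k) * ∫ s in (0 : ℝ)..r, h (s ^ 2) * s ^ (k + 1))

def rho0 (k : ℕ) (γ r : ℝ) (h : ℝ → ℝ) : ℝ := r / alpha k γ r h

def nu0 (k : ℕ) (γ r : ℝ) (h : ℝ → ℝ) : ℝ :=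
  sphereArea k * h (r ^ 2) * r ^ (k - 1) * alpha k γ r h

def beta1 (k : ℕ) (γ r : ℝ) (h : ℝ → ℝ) : ℝ :=
  1 / alpha k γ r h * (rho0 k γ r h / k * nu0 k γ r h - γ)

def beta2 (k : ℕ) (γ r : ℝ) (h : ℝ → ℝ) : ℝ :=
  2 * rho0 k γ r h ^ 3 * nu0 k γ r h / (alpha k γ r h * k * (k + 2)) - 2 * γ / alpha k γ r h

def beta6 (k : ℕ) (γ r : ℝ) (h : ℝ → ℝ) : ℝ := nu0 k γ r h

/-- The constant called `π` in the location influence function (not the circle constant). -/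
def piConst (k : ℕ) (γ r : ℝ) (h : ℝ → ℝ) : ℝ := -(alpha k γ r h * beta1 k γ r h)⁻¹

def kappa1 (k : ℕ) (γ r : ℝ) : ℝ := -(r ^ 2 / (k * γ))

def kappa2 (k : ℕ) (γ r : ℝ) (h : ℝ → ℝ) : ℝ :=
  (alpha k γ r h * beta2 k γ r h + 2 * γ) / (k * γ * alpha k γ r h * beta2 k γ r h)

def kappa3 (k : ℕ) (γ r : ℝ) (h : ℝ → ℝ) : ℝ := -(2 / (alpha k γ r h * beta2 k γ r h))

def kappa4 (k : ℕ) (γ r : ℝ) (h : ℝ → ℝ) : ℝ := (r ^ 2 - k * alpha k γ r h ^ 2) / k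

def lambda1 (k : ℕ) (γ r : ℝ) (h : ℝ → ℝ) : ℝ := -(r / (2 * k * γ * alpha k γ r h ^ 3))

def lambda2 (k : ℕ) (γ r : ℝ) (h : ℝ → ℝ) : ℝ :=
  r ^ 3 / (2 * k * γ * alpha k γ r h ^ 3) - 1 / beta6 k γ r h

def lambda3 (k : ℕ) (γ r : ℝ) (h : ℝ → ℝ) : ℝ :=
  γ / beta6 k γ r h + r / (2 * k * alpha k γ r h ^ 3) * (k * alpha k γ r h ^ 2 - r ^ 2)

/-- The indicator of `{‖x‖ ≤ r}`. -/
def inBall {k : ℕ} (r : ℝ) (x : EuclideanSpace ℝ (Fin k)) : ℝ := if ‖x‖ ≤ r then 1 else 0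

end

end MCD

/-!
The argument has three stages: shape of minimizers, consistency, and linearization.

**Shape of minimizers.** Normalize a trimmed covariance `C` by a linear map `B` of determinant
`±1` with `BᵀB` proportional to `C⁻¹` (`exists_normalizing_map`). By the arithmetic-geometric mean
inequality, minimizing `det C` is minimizing, jointly over `B` and a centre, the trimmed average of
`‖B x - c‖²`; for fixed `B` and `c` the optimal trimming function is a bathtub, i.e. `1` inside and
`0` outside an ellipsoid, with total mass exactly `γ`. Hence a minimizer `φ` at `Q` is, up to the
boundary, the indicator of its own ellipsoid (`IsMinimizer.spec`). Minimizers
exist (`exists_isMinimizer`) because the optimal trimmed average is, by bathtub duality, a lower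
semicontinuous function of `(c, B)`, and coercive as long as `Q` differs from an absolutely
continuous measure by mass less than `γ`.

**Consistency.** At the level `r²` the dual value at `P` is governed by the gain
`∫ (r² - ‖B x - c‖²)₊ dP`, which among volume preserving affine maps is maximal only for isometries
fixing the origin: monotonicity of `h` gives the inequality, nonconstancy on `(0, r²)` the equality
case (`RadialModel.gain_le_and_eq`). With compactness this yields convergence of the mean, the
covariance and the radius of *any* choice of minimizers along `(1 - ε) P + ε δ_x` as `ε → 0`
(`RadialModel.tendsto_mean_cov`, `RadialModel.tendsto_radius`), and, with `ε` constantly `0`,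
uniqueness of the values at `P`.

**Linearization.** The minimizing ellipsoid `E` differs from the ball only by a thin shell, on which
the density is nearly `h(r²)` by continuity; so integrals over `E` against `P` differ from those
over the ball by `h(r²)` times the difference of the Lebesgue integrals, up to smaller order
(`RadialModel.abs_setIntegral_sub_le`). The Lebesgue integrals over `E` are explicit
(`ellipsoid_moments`). The equations for mass, mean and covariance of `φ`, in which the contaminating
point enters with weight `ε 𝟙{‖x‖ ≤ r}`, thus become linear up to `o(deviation)`
(`RadialModel.first_order`). The linear system is nonsingular because `h(r²)` times the volume of the
ball is less than `γ` and `h(r²)` times a coordinate second moment of the ball is less than `γ α²`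
(`RadialModel.lt_mass`, `RadialModel.lt_alpha_sq`), both by nonconstancy of `h`. So the deviation is
`O(ε)` and the difference quotients converge (`RadialModel.tendsto_difference_quotients`).
-/

namespace MCD

variable {k : ℕ}

/-! ### Trimmed averages and the covariance determinant -/

/-- The Gram matrix `B'B` of a linear map `B` of Euclidean space. -/
noncomputable def gram (B : EuclideanSpace ℝ (Fin k) →L[ℝ] EuclideanSpace ℝ (Fin k)) :
    Matrix (Fin k) (Fin k) ℝ :=
  ((Matrix.toEuclideanCLM (𝕜 := ℝ) (n := Fin k)).symm B).transpose *
    (Matrix.toEuclideanCLM (𝕜 := ℝ) (n := Fin k)).symm B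

/-- The average of `g` under the measure with density `φ / ∫ φ dQ` with respect to `Q`. -/
noncomputable def trimmedAvg (Q : Measure (EuclideanSpace ℝ (Fin k)))
    (φ g : EuclideanSpace ℝ (Fin k) → ℝ) : ℝ :=
  (∫ x, φ x ∂Q)⁻¹ * ∫ x, φ x * g x ∂Q

lemma norm_sq_apply_eq_gram (B : EuclideanSpace ℝ (Fin k) →L[ℝ] EuclideanSpace ℝ (Fin k))
    (v : EuclideanSpace ℝ (Fin k)) :
    ‖B v‖ ^ 2 = v.ofLp ⬝ᵥ (gram B).mulVec v.ofLp := by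
  have h1 : (B v).ofLp = ((Matrix.toEuclideanCLM (𝕜 := ℝ) (n := Fin k)).symm B).mulVec v.ofLp := by
    rw [← Matrix.ofLp_toEuclideanCLM]; simp
  rw [EuclideanSpace.real_norm_sq_eq, gram, ← Matrix.mulVec_mulVec, Matrix.dotProduct_mulVec,
    Matrix.vecMul_transpose, ← h1]
  simp [dotProduct, sq]

lemma det_toEuclideanCLM_symm (B : EuclideanSpace ℝ (Fin k) →L[ℝ] EuclideanSpace ℝ (Fin k)) :
    ((Matrix.toEuclideanCLM (𝕜 := ℝ) (n := Fin k)).symm B).det = B.det := by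
  have h := Matrix.coe_toEuclideanCLM_eq_toEuclideanLin
    ((Matrix.toEuclideanCLM (𝕜 := ℝ) (n := Fin k)).symm B)
  rw [StarAlgEquiv.apply_symm_apply] at h
  rw [ContinuousLinearMap.det, h, Matrix.toEuclideanLin_eq_toLin_orthonormal, LinearMap.det_toLin]

lemma det_gram (B : EuclideanSpace ℝ (Fin k) →L[ℝ] EuclideanSpace ℝ (Fin k)) :
    (gram B).det = B.det ^ 2 := by
  rw [gram, Matrix.det_mul, Matrix.det_transpose, det_toEuclideanCLM_symm, sq]

namespace IsTrimming

variable {γ : ℝ} {Q : Measure (EuclideanSpace ℝ (Fin k))} {φ : EuclideanSpace ℝ (Fin k) → ℝ}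

lemma integrable [IsFiniteMeasure Q] (h : IsTrimming γ Q φ) : Integrable φ Q :=
  Integrable.mono' (integrable_const (1 : ℝ)) h.measurable.aestronglyMeasurable
    (.of_forall fun x => by rw [Real.norm_eq_abs, abs_of_nonneg (h.nonneg x)]; exact h.le_one x)

lemma mass_pos (h : IsTrimming γ Q φ) (hγ : 0 < γ) : 0 < ∫ x, φ x ∂Q := hγ.trans_le h.mass

/-- Functions of at most quadratic growth are integrable after trimming. -/
lemma integrable_mul [IsFiniteMeasure Q] (h : IsTrimming γ Q φ)
    {g : EuclideanSpace ℝ (Fin k) → ℝ} (hg : Measurable g) {a b : ℝ}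
    (hb : ∀ x, |g x| ≤ a + b * ‖x‖ ^ 2) : Integrable (fun x => φ x * g x) Q := by
  refine Integrable.mono' ((h.integrable.const_mul a).add (h.moment.const_mul b))
    (h.measurable.mul hg).aestronglyMeasurable (.of_forall fun x => ?_)
  rw [Real.norm_eq_abs, abs_mul, abs_of_nonneg (h.nonneg x)]
  calc φ x * |g x| ≤ φ x * (a + b * ‖x‖ ^ 2) := mul_le_mul_of_nonneg_left (hb x) (h.nonneg x)
    _ = _ := by simp; ring

lemma integrable_smul [IsFiniteMeasure Q] (h : IsTrimming γ Q φ) :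
    Integrable (fun x => φ x • x) Q := by
  refine Integrable.mono' (h.integrable.add h.moment)
    (h.measurable.smul measurable_id).aestronglyMeasurable (.of_forall fun x => ?_)
  rw [norm_smul, Real.norm_eq_abs, abs_of_nonneg (h.nonneg x)]
  have := h.nonneg x
  simp only [Pi.add_apply]
  nlinarith [mul_nonneg this (sq_nonneg (‖x‖ - 1)), mul_nonneg this (norm_nonneg x),
    mul_nonneg this (sq_nonneg ‖x‖)]

lemma integral_smul_sub [IsFiniteMeasure Q] (h : IsTrimming γ Q φ) (hγ : 0 < γ) :
    ∫ x, φ x • (x - trimmedMean Q φ) ∂Q = 0 := by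
  simp_rw [smul_sub]
  rw [integral_sub h.integrable_smul (h.integrable.smul_const _), integral_smul_const,
    trimmedMean, smul_smul, mul_inv_cancel₀ (h.mass_pos hγ).ne', one_smul, sub_self]

lemma integrable_cov [IsFiniteMeasure Q] (h : IsTrimming γ Q φ) (m : EuclideanSpace ℝ (Fin k))
    (i j : Fin k) : Integrable (fun x => (x i - m i) * (x j - m j) * φ x) Q := by
  have := h.integrable_mul (g := fun x => (x i - m i) * (x j - m j)) (by fun_prop)
    (a := 2 * ‖m‖ ^ 2) (b := 2) (fun x => by
      have h1 : |x i - m i| ≤ ‖x - m‖ := PiLp.norm_apply_le (x - m) i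
      have h2 : |x j - m j| ≤ ‖x - m‖ := PiLp.norm_apply_le (x - m) j
      have h3 := norm_sub_le x m
      rw [abs_mul]
      nlinarith [abs_nonneg (x i - m i), abs_nonneg (x j - m j), sq_nonneg (‖x‖ - ‖m‖),
        norm_nonneg (x - m), norm_nonneg x, norm_nonneg m])
  exact this.congr (.of_forall fun x => by simp [mul_comm])

/-- Averages of quadratic forms about the trimmed mean are linear in the trimmed covariance. -/
lemma trimmedAvg_quadForm [IsFiniteMeasure Q] (h : IsTrimming γ Q φ)
    (N : Matrix (Fin k) (Fin k) ℝ) :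
    trimmedAvg Q φ (fun x => (x - trimmedMean Q φ).ofLp ⬝ᵥ N.mulVec (x - trimmedMean Q φ).ofLp)
      = ∑ i, ∑ j, N i j * trimmedCov Q φ i j := by
  have h1 : ∀ x : EuclideanSpace ℝ (Fin k), φ x * ((x - trimmedMean Q φ).ofLp ⬝ᵥ
      N.mulVec (x - trimmedMean Q φ).ofLp) = ∑ i, ∑ j, N i j *
        ((x i - trimmedMean Q φ i) * (x j - trimmedMean Q φ j) * φ x) := by
    intro x
    simp only [dotProduct, Matrix.mulVec, PiLp.sub_apply, Finset.mul_sum]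
    refine Finset.sum_congr rfl fun i _ => Finset.sum_congr rfl fun j _ => by ring
  simp_rw [trimmedAvg, h1, trimmedCov, Matrix.of_apply]
  rw [integral_finsetSum Finset.univ (fun i _ => integrable_finsetSum Finset.univ fun j _ =>
    (h.integrable_cov (trimmedMean Q φ) i j).const_mul (N i j)), Finset.mul_sum]
  refine Finset.sum_congr rfl fun i _ => ?_
  rw [integral_finsetSum Finset.univ
    (fun j _ => (h.integrable_cov (trimmedMean Q φ) i j).const_mul (N i j)), Finset.mul_sum]
  refine Finset.sum_congr rfl fun j _ => ?_
  rw [integral_const_mul]; ring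

lemma trimmedAvg_norm_sq [IsFiniteMeasure Q] (h : IsTrimming γ Q φ)
    (B : EuclideanSpace ℝ (Fin k) →L[ℝ] EuclideanSpace ℝ (Fin k)) :
    trimmedAvg Q φ (fun x => ‖B x - B (trimmedMean Q φ)‖ ^ 2)
      = ∑ i, ∑ j, gram B i j * trimmedCov Q φ i j := by
  rw [← h.trimmedAvg_quadForm]
  simp_rw [← map_sub, norm_sq_apply_eq_gram]

lemma integrable_mul_norm_sq [IsFiniteMeasure Q] (h : IsTrimming γ Q φ)
    (B : EuclideanSpace ℝ (Fin k) →L[ℝ] EuclideanSpace ℝ (Fin k)) (a : EuclideanSpace ℝ (Fin k)) :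
    Integrable (fun x => φ x * ‖B x - a‖ ^ 2) Q := by
  refine h.integrable_mul (by fun_prop) (a := 2 * ‖a‖ ^ 2) (b := 2 * ‖B‖ ^ 2) fun x => ?_
  rw [abs_of_nonneg (by positivity)]
  have h1 : ‖B x - a‖ ≤ ‖B‖ * ‖x‖ + ‖a‖ := (norm_sub_le _ _).trans (by gcongr; exact B.le_opNorm x)
  calc ‖B x - a‖ ^ 2 ≤ (‖B‖ * ‖x‖ + ‖a‖) ^ 2 := by gcongr
    _ ≤ _ := by nlinarith [sq_nonneg (‖B‖ * ‖x‖ - ‖a‖)]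

/-- Among all centres, the image of the trimmed mean minimizes the trimmed mean square. -/
lemma trimmedAvg_norm_sq_le [IsFiniteMeasure Q] (h : IsTrimming γ Q φ) (hγ : 0 < γ)
    (B : EuclideanSpace ℝ (Fin k) →L[ℝ] EuclideanSpace ℝ (Fin k)) (a : EuclideanSpace ℝ (Fin k)) :
    trimmedAvg Q φ (fun x => ‖B x - B (trimmedMean Q φ)‖ ^ 2)
      ≤ trimmedAvg Q φ (fun x => ‖B x - a‖ ^ 2) := by
  set T := trimmedMean Q φ with hT
  refine mul_le_mul_of_nonneg_left ?_ (inv_nonneg.2 (h.mass_pos hγ).le)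
  let ℓ : EuclideanSpace ℝ (Fin k) →L[ℝ] ℝ := (innerSL ℝ (B T - a)).comp B
  have h0 : ∫ x, φ x * ℓ (x - T) ∂Q = 0 := by
    have := ℓ.integral_comp_comm (φ := fun x => φ x • (x - T)) (μ := Q) (by
      simp_rw [smul_sub]
      exact h.integrable_smul.sub (h.integrable.smul_const _))
    rw [h.integral_smul_sub hγ, map_zero] at this
    rw [← this]
    simp
  have hint : Integrable (fun x => φ x * ℓ (x - T)) Q := by
    have := ℓ.integrable_comp (φ := fun x => φ x • (x - T)) (μ := Q) (by
      simp_rw [smul_sub]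
      exact h.integrable_smul.sub (h.integrable.smul_const _))
    simpa using this
  have h1 : ∫ x, φ x * ‖B x - B T‖ ^ 2 + 2 * (φ x * ℓ (x - T)) ∂Q
      = ∫ x, φ x * ‖B x - B T‖ ^ 2 ∂Q := by
    rw [integral_add (h.integrable_mul_norm_sq B _) (hint.const_mul 2), integral_const_mul, h0]
    simp
  rw [← h1]
  refine integral_mono ((h.integrable_mul_norm_sq B _).add (hint.const_mul 2))
    (h.integrable_mul_norm_sq B a) fun x => ?_
  have h2 : ‖B x - a‖ ^ 2 = ‖B x - B T‖ ^ 2 + 2 * ℓ (x - T) + ‖B T - a‖ ^ 2 := by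
    have : B x - a = (B x - B T) + (B T - a) := by abel
    rw [this, norm_add_sq_real]
    rw [← map_sub B x T, real_inner_comm]
    simp only [ℓ, ContinuousLinearMap.comp_apply, innerSL_apply_apply]
  simp only
  rw [h2]
  nlinarith [mul_nonneg (h.nonneg x) (sq_nonneg ‖B T - a‖)]

lemma trimmedCov_posSemidef [IsFiniteMeasure Q] (h : IsTrimming γ Q φ) (hγ : 0 < γ) :
    (trimmedCov Q φ).PosSemidef := by
  refine Matrix.PosSemidef.of_dotProduct_mulVec_nonneg ?_ fun v => ?_
  · ext i j
    simp only [Matrix.conjTranspose_apply, trimmedCov, Matrix.of_apply, star_trivial]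
    congr 2; ext x; ring
  · have := h.trimmedAvg_quadForm (Matrix.vecMulVec v v)
    have h2 : star v ⬝ᵥ (trimmedCov Q φ).mulVec v
        = ∑ i, ∑ j, Matrix.vecMulVec v v i j * trimmedCov Q φ i j := by
      simp only [star_trivial, dotProduct, Matrix.mulVec, Finset.mul_sum, Matrix.vecMulVec_apply]
      refine Finset.sum_congr rfl fun i _ => Finset.sum_congr rfl fun j _ => by ring
    rw [h2, ← this]
    refine mul_nonneg (inv_nonneg.2 (h.mass_pos hγ).le) (integral_nonneg fun x => ?_)
    refine mul_nonneg (h.nonneg x) ?_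
    simp only [Matrix.vecMulVec_mulVec]
    simp only [dotProduct_smul, MulOpposite.smul_eq_mul_unop, MulOpposite.unop_op]
    rw [dotProduct_comm]
    exact mul_self_nonneg _

end IsTrimming

/-- The determinant form of the arithmetic–geometric mean inequality. -/
lemma det_le_trace_pow [NeZero k] {N : Matrix (Fin k) (Fin k) ℝ} (hN : N.PosSemidef) :
    N.det ≤ (N.trace / k) ^ k := by
  have hk : (0 : ℝ) < k := by exact_mod_cast Nat.pos_of_ne_zero (NeZero.ne k)
  have h1 := Real.geom_mean_le_arith_mean Finset.univ (fun _ : Fin k => (1 : ℝ))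
    hN.1.eigenvalues (by simp) (by simpa using hk) (fun i _ => hN.eigenvalues_nonneg i)
  have hd : N.det = ∏ i, hN.1.eigenvalues i := by simpa using hN.1.det_eq_prod_eigenvalues
  have ht : N.trace = ∑ i, hN.1.eigenvalues i := by simpa using hN.1.trace_eq_sum_eigenvalues
  simp only [Real.rpow_one, one_mul, Finset.sum_const, Finset.card_univ, Fintype.card_fin,
    nsmul_eq_mul, mul_one] at h1
  rw [← hd, ← ht] at h1
  calc N.det = (N.det ^ ((k : ℝ)⁻¹)) ^ k := by
        rw [← Real.rpow_natCast, ← Real.rpow_mul hN.det_nonneg, inv_mul_cancel₀ hk.ne',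
          Real.rpow_one]
    _ ≤ _ := by
        gcongr
        exact Real.rpow_nonneg hN.det_nonneg _

/-- The variational bound for the determinant: for `|det B| = 1` the geometric mean of the
eigenvalues of the trimmed covariance is at most the trimmed mean of `‖B x - a‖² / k`. -/
lemma IsTrimming.det_trimmedCov_le [NeZero k] {γ : ℝ} {Q : Measure (EuclideanSpace ℝ (Fin k))}
    {φ : EuclideanSpace ℝ (Fin k) → ℝ} [IsFiniteMeasure Q] (h : IsTrimming γ Q φ) (hγ : 0 < γ)
    {B : EuclideanSpace ℝ (Fin k) →L[ℝ] EuclideanSpace ℝ (Fin k)} (hB : B.det ^ 2 = 1)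
    (a : EuclideanSpace ℝ (Fin k)) :
    (trimmedCov Q φ).det ≤ (trimmedAvg Q φ (fun x => ‖B x - a‖ ^ 2) / k) ^ k := by
  set M := (Matrix.toEuclideanCLM (𝕜 := ℝ) (n := Fin k)).symm B with hM
  have hC := h.trimmedCov_posSemidef hγ
  have hN := hC.mul_mul_conjTranspose_same M
  have htr : (M * trimmedCov Q φ * M.conjTranspose).trace
      = trimmedAvg Q φ (fun x => ‖B x - B (trimmedMean Q φ)‖ ^ 2) := by
    rw [h.trimmedAvg_norm_sq, Matrix.trace_mul_comm, ← Matrix.mul_assoc]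
    simp only [Matrix.conjTranspose_eq_transpose_of_trivial, gram, ← hM, Matrix.trace,
      Matrix.diag_apply]
    refine Finset.sum_congr rfl fun i _ => ?_
    rw [Matrix.mul_apply]
    refine Finset.sum_congr rfl fun j _ => ?_
    rw [← hC.1.apply i j]
    simp
  have hdet : (M * trimmedCov Q φ * M.conjTranspose).det = (trimmedCov Q φ).det := by
    rw [Matrix.det_mul, Matrix.det_mul, Matrix.det_conjTranspose, star_trivial, hM,
      det_toEuclideanCLM_symm, mul_comm, ← mul_assoc, ← sq, hB, one_mul]
  rw [← hdet]
  refine (det_le_trace_pow hN).trans ?_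
  have h0 : 0 ≤ (M * trimmedCov Q φ * M.conjTranspose).trace := hN.trace_nonneg
  have := htr ▸ h.trimmedAvg_norm_sq_le hγ B a
  gcongr

/-- If no Lebesgue-null set carries mass `γ`, trimmed covariances are nondegenerate. -/
lemma IsTrimming.trimmedCov_posDef {γ : ℝ} {Q : Measure (EuclideanSpace ℝ (Fin k))}
    {φ : EuclideanSpace ℝ (Fin k) → ℝ} [IsFiniteMeasure Q] (h : IsTrimming γ Q φ) (hγ : 0 < γ)
    (hQ : ∀ N : Set (EuclideanSpace ℝ (Fin k)), MeasurableSet N → volume N = 0 → Q.real N < γ) :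
    (trimmedCov Q φ).PosDef := by
  have hC := h.trimmedCov_posSemidef hγ
  refine Matrix.PosDef.of_dotProduct_mulVec_pos hC.1 fun v hv => ?_
  refine lt_of_le_of_ne (hC.dotProduct_mulVec_nonneg v) fun h0 => ?_
  set T := trimmedMean Q φ with hT
  have h1 : ∫ x, φ x * (v ⬝ᵥ (x - T).ofLp) ^ 2 ∂Q = 0 := by
    have := h.trimmedAvg_quadForm (Matrix.vecMulVec v v)
    have h2 : star v ⬝ᵥ (trimmedCov Q φ).mulVec v
        = ∑ i, ∑ j, Matrix.vecMulVec v v i j * trimmedCov Q φ i j := by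
      simp only [star_trivial, dotProduct, Matrix.mulVec, Finset.mul_sum, Matrix.vecMulVec_apply]
      refine Finset.sum_congr rfl fun i _ => Finset.sum_congr rfl fun j _ => by ring
    rw [← h2, ← h0, trimmedAvg, mul_eq_zero, or_iff_right (inv_ne_zero (h.mass_pos hγ).ne')] at this
    rw [← this]
    congr 1; ext x
    simp only [Matrix.vecMulVec_mulVec]
    simp only [dotProduct_smul, MulOpposite.smul_eq_mul_unop, MulOpposite.unop_op]
    rw [dotProduct_comm v, sq]
  set H : Set (EuclideanSpace ℝ (Fin k)) := {x | v ⬝ᵥ (x - T).ofLp = 0} with hH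
  have hHm : MeasurableSet H := by
    refine measurableSet_eq_fun ?_ measurable_const
    simp only [dotProduct]
    fun_prop
  have hHn : volume H = 0 := by
    let ℓ : EuclideanSpace ℝ (Fin k) →ₗ[ℝ] ℝ :=
      { toFun := fun x => v ⬝ᵥ x.ofLp
        map_add' := fun x y => by simp [dotProduct_add]
        map_smul' := fun c x => by simp [dotProduct_smul] }
    have hH' : H = (fun x => x - T) ⁻¹' (LinearMap.ker ℓ : Set (EuclideanSpace ℝ (Fin k))) := by
      ext x; simp [hH, ℓ]
    have hne : LinearMap.ker ℓ ≠ ⊤ := by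
      intro htop
      have : WithLp.toLp 2 v ∈ LinearMap.ker ℓ := by rw [htop]; trivial
      rw [LinearMap.mem_ker] at this
      exact hv (dotProduct_self_eq_zero.1 this)
    rw [hH', (measurePreserving_sub_right volume T).measure_preimage]
    · exact Measure.addHaar_submodule _ _ hne
    · exact (Submodule.closed_of_finiteDimensional _).measurableSet.nullMeasurableSet
  have hint : Integrable (fun x => φ x * (v ⬝ᵥ (x - T).ofLp) ^ 2) Q := by
    have hin : ∀ x : EuclideanSpace ℝ (Fin k), v ⬝ᵥ (x - T).ofLp = inner ℝ (x - T) (WithLp.toLp 2 v) := by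
      intro x; simp [EuclideanSpace.inner_eq_star_dotProduct]
    simp_rw [hin]
    refine h.integrable_mul (by fun_prop) (a := 2 * ‖WithLp.toLp 2 v‖ ^ 2 * ‖T‖ ^ 2)
      (b := 2 * ‖WithLp.toLp 2 v‖ ^ 2) fun x => ?_
    rw [abs_of_nonneg (by positivity), ← sq_abs]
    calc |inner ℝ (x - T) (WithLp.toLp 2 v)| ^ 2
        ≤ ((‖x‖ + ‖T‖) * ‖WithLp.toLp 2 v‖) ^ 2 := by
          gcongr
          refine (abs_real_inner_le_norm _ _).trans ?_
          gcongr
          exact norm_sub_le _ _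
      _ ≤ _ := by
          nlinarith [mul_nonneg (sq_nonneg ‖WithLp.toLp 2 v‖) (sq_nonneg (‖x‖ - ‖T‖))]
  rw [integral_eq_zero_iff_of_nonneg (fun x => mul_nonneg (h.nonneg x) (sq_nonneg _)) hint] at h1
  have h2 : ∫ x, φ x ∂Q ≤ ∫ x, H.indicator 1 x ∂Q := by
    refine integral_mono_ae h.integrable ((integrable_const 1).indicator hHm) ?_
    filter_upwards [h1] with x hx
    by_cases hxH : x ∈ H
    · simpa [hxH] using h.le_one x
    · have : v ⬝ᵥ (x - T).ofLp ≠ 0 := hxH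
      have : φ x = 0 := (mul_eq_zero.1 hx).resolve_right (pow_ne_zero 2 this)
      simp [hxH, this]
  rw [integral_indicator_one hHm] at h2
  exact absurd (h.mass.trans h2) (not_le.2 (hQ H hHm hHn))

/-- The variational bound is attained: some `B` with `|det B| = 1` turns the trimmed covariance
into a multiple of the identity. -/
lemma exists_normalizing_map [NeZero k] {C : Matrix (Fin k) (Fin k) ℝ} (hC : C.PosDef) :
    ∃ B : EuclideanSpace ℝ (Fin k) →L[ℝ] EuclideanSpace ℝ (Fin k), ∃ d : ℝ, 0 < d ∧
      d ^ k = C.det ∧ B.det ^ 2 = 1 ∧ gram B = d • C⁻¹ := by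
  have hk : (0 : ℝ) < k := by exact_mod_cast Nat.pos_of_ne_zero (NeZero.ne k)
  have hdet := hC.det_pos
  obtain ⟨L, hL⟩ : ∃ L : Matrix (Fin k) (Fin k) ℝ, L.transpose * L = C⁻¹ := by
    open scoped MatrixOrder in
    obtain ⟨L, hL⟩ := CStarAlgebra.nonneg_iff_eq_star_mul_self.1 hC.inv.posSemidef.nonneg
    exact ⟨L, by rw [hL]; rfl⟩
  refine ⟨Matrix.toEuclideanCLM (𝕜 := ℝ) (n := Fin k) (Real.sqrt (C.det ^ (k : ℝ)⁻¹) • L),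
    C.det ^ (k : ℝ)⁻¹, Real.rpow_pos_of_pos hdet _, ?_, ?_, ?_⟩
  · rw [← Real.rpow_natCast, ← Real.rpow_mul hdet.le, inv_mul_cancel₀ hk.ne', Real.rpow_one]
  · rw [← det_toEuclideanCLM_symm, StarAlgEquiv.symm_apply_apply, Matrix.det_smul,
      Fintype.card_fin, mul_pow, ← pow_mul, mul_comm k, pow_mul, Real.sq_sqrt (by positivity),
      ← Real.rpow_natCast (C.det ^ (k : ℝ)⁻¹), ← Real.rpow_mul hdet.le, inv_mul_cancel₀ hk.ne',
      Real.rpow_one]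
    have : L.det ^ 2 = C.det⁻¹ := by
      rw [sq]; nth_rw 1 [← Matrix.det_transpose]
      rw [← Matrix.det_mul, hL, Matrix.det_nonsing_inv, Ring.inverse_eq_inv']
    rw [this, mul_inv_cancel₀ hdet.ne']
  · rw [gram, StarAlgEquiv.symm_apply_apply, Matrix.transpose_smul, Matrix.smul_mul,
      Matrix.mul_smul, smul_smul, hL, Real.mul_self_sqrt (by positivity)]

/-- With the normalizing map, the trimmed mean square about the trimmed mean equals `k d`. -/
lemma IsTrimming.trimmedAvg_norm_sq_of_gram {γ : ℝ} {Q : Measure (EuclideanSpace ℝ (Fin k))}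
    {φ : EuclideanSpace ℝ (Fin k) → ℝ} [IsFiniteMeasure Q] (h : IsTrimming γ Q φ)
    (hC : (trimmedCov Q φ).PosDef)
    {B : EuclideanSpace ℝ (Fin k) →L[ℝ] EuclideanSpace ℝ (Fin k)} {d : ℝ}
    (hB : gram B = d • (trimmedCov Q φ)⁻¹) :
    trimmedAvg Q φ (fun x => ‖B x - B (trimmedMean Q φ)‖ ^ 2) = k * d := by
  rw [h.trimmedAvg_norm_sq, hB]
  have h1 : ((trimmedCov Q φ)⁻¹ * trimmedCov Q φ).trace = k := by
    rw [Matrix.nonsing_inv_mul _ (isUnit_iff_ne_zero.2 hC.det_pos.ne')]; simp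
  rw [← h1, Matrix.trace, Finset.sum_mul]
  refine Finset.sum_congr rfl fun i _ => ?_
  rw [Matrix.diag_apply, Matrix.mul_apply, Finset.sum_mul]
  refine Finset.sum_congr rfl fun j _ => ?_
  rw [← hC.1.apply i j]
  simp only [star_trivial, Matrix.smul_apply, smul_eq_mul]
  ring

/-! ### Quantiles and optimal trimming -/

/-- The defining properties of the radius functional: the infimum is a `γ`-quantile of `d`. -/
lemma quantile_spec {X : Type*} [MeasurableSpace X] (Q : Measure X) [IsProbabilityMeasure Q]
    {γ : ℝ} (hγ1 : γ < 1) {d : X → ℝ} (hd : Measurable d) (hd0 : ∀ x, 0 ≤ d x) {s : ℝ}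
    (hs : s = sInf {s : ℝ | 0 < s ∧ γ ≤ Q.real {x | d x ≤ s}}) :
    0 ≤ s ∧ γ ≤ Q.real {x | d x ≤ s} ∧ (0 < γ → Q.real {x | d x < s} ≤ γ) := by
  set S := {s : ℝ | 0 < s ∧ γ ≤ Q.real {x | d x ≤ s}} with hS
  have hbdd : BddBelow S := ⟨0, fun s hs => hs.1.le⟩
  have hmeas : ∀ t, MeasurableSet {x | d x ≤ t} := fun t => measurableSet_le hd measurable_const
  have hmono : ∀ {t u : ℝ}, t ≤ u → Q.real {x | d x ≤ t} ≤ Q.real {x | d x ≤ u} := fun htu =>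
    measureReal_mono fun x hx => le_trans hx htu
  have hne : S.Nonempty := by
    have h1 : Tendsto (fun n : ℕ => Q.real {x | d x ≤ n}) atTop (𝓝 (Q.real Set.univ)) := by
      have := tendsto_measure_iUnion_atTop (μ := Q) (s := fun n : ℕ => {x | d x ≤ n})
        (fun m n hmn x hx => by
          have h1 : d x ≤ m := hx
          exact h1.trans (Nat.cast_le.2 hmn))
      rw [show (⋃ n : ℕ, {x | d x ≤ n}) = Set.univ from
        Set.eq_univ_of_forall fun x => Set.mem_iUnion.2 (exists_nat_ge (d x))] at this
      exact (ENNReal.tendsto_toReal (measure_ne_top _ _)).comp this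
    rw [probReal_univ] at h1
    obtain ⟨n, hn, hn'⟩ := ((h1.eventually_const_lt hγ1).and (eventually_gt_atTop 0)).exists
    exact ⟨n, by exact_mod_cast hn', hn.le⟩
  have hs0 : 0 ≤ s := hs ▸ le_csInf hne fun t ht => ht.1.le
  have habove : ∀ t, s < t → γ ≤ Q.real {x | d x ≤ t} := by
    intro t ht
    obtain ⟨u, hu, hut⟩ := exists_lt_of_csInf_lt hne (hs ▸ ht)
    exact hu.2.trans (hmono hut.le)
  refine ⟨hs0, ?_, fun hγ0 => ?_⟩
  · have h1 : Tendsto (fun n : ℕ => Q.real {x | d x ≤ s + 1 / ((n : ℝ) + 1)}) atTop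
        (𝓝 (Q.real {x | d x ≤ s})) := by
      have := tendsto_measure_iInter_atTop (μ := Q)
        (s := fun n : ℕ => {x | d x ≤ s + 1 / ((n : ℝ) + 1)})
        (fun n => (hmeas _).nullMeasurableSet)
        (fun m n hmn x hx => by
          have h1 : d x ≤ s + 1 / ((n : ℝ) + 1) := hx
          exact h1.trans (add_le_add_right (Nat.one_div_le_one_div hmn) s))
        ⟨0, measure_ne_top _ _⟩
      rw [show (⋂ n : ℕ, {x | d x ≤ s + 1 / ((n : ℝ) + 1)}) = {x | d x ≤ s} from ?_] at this
      · exact (ENNReal.tendsto_toReal (measure_ne_top _ _)).comp this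
      · ext x
        simp only [Set.mem_iInter, Set.mem_ofPred_eq]
        refine ⟨fun h => ?_, fun h n => h.trans (by have : (0 : ℝ) < 1 / ((n : ℝ) + 1) := by positivity
                                                    linarith)⟩
        have := tendsto_one_div_add_atTop_nhds_zero_nat (𝕜 := ℝ)
        exact ge_of_tendsto' (by simpa using this.const_add s) h
    exact ge_of_tendsto' h1 fun n => habove _ (by
      have : (0 : ℝ) < 1 / ((n : ℝ) + 1) := by positivity
      linarith)
  · have hbelow : ∀ t, t < s → Q.real {x | d x ≤ t} ≤ γ := by
      intro t ht
      by_contra! hlt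
      by_cases ht0 : 0 < t
      · exact absurd (hs ▸ csInf_le hbdd ⟨ht0, hlt.le⟩) (not_le.2 ht)
      · -- the constraint `0 < s` is harmless: nonpositive levels can be raised slightly
        have : s / 2 ∈ S := ⟨by
            rcases eq_or_lt_of_le hs0 with h | h
            · exfalso
              rw [← h] at ht
              have : {x | d x ≤ t} = ∅ := by
                ext x; simpa using ht.trans_le (hd0 x)
              rw [this] at hlt; simp at hlt; linarith
            · linarith, hlt.le.trans (hmono (by linarith))⟩
        have h2 := csInf_le hbdd this
        rw [← hs] at h2
        have hs00 : s = 0 := by linarith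
        rw [hs00] at this
        simpa using this.1
    have h1 : Tendsto (fun n : ℕ => Q.real {x | d x ≤ s - 1 / ((n : ℝ) + 1)}) atTop
        (𝓝 (Q.real {x | d x < s})) := by
      have := tendsto_measure_iUnion_atTop (μ := Q)
        (s := fun n : ℕ => {x | d x ≤ s - 1 / ((n : ℝ) + 1)})
        (fun m n hmn x hx => by
          have h1 : d x ≤ s - 1 / ((m : ℝ) + 1) := hx
          exact h1.trans (sub_le_sub_left (Nat.one_div_le_one_div hmn) s))
      rw [show (⋃ n : ℕ, {x | d x ≤ s - 1 / ((n : ℝ) + 1)}) = {x | d x < s} from ?_] at this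
      · exact (ENNReal.tendsto_toReal (measure_ne_top _ _)).comp this
      · ext x
        simp only [Set.mem_iUnion, Set.mem_ofPred_eq]
        refine ⟨fun ⟨n, h⟩ => h.trans_lt (by
          have : (0 : ℝ) < 1 / ((n : ℝ) + 1) := by positivity
          linarith), fun h => ?_⟩
        obtain ⟨n, hn⟩ := exists_nat_one_div_lt (sub_pos.2 h)
        exact ⟨n, by linarith⟩
    exact le_of_tendsto' h1 fun n => hbelow _ (by
      have : (0 : ℝ) < 1 / ((n : ℝ) + 1) := by positivity
      linarith)

/-- A trimming function of mass exactly `γ` that fills up the sublevel sets of `q`. -/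
lemma exists_bathtub {X : Type*} [MeasurableSpace X] (Q : Measure X) [IsFiniteMeasure Q]
    {γ : ℝ} {q : X → ℝ} (hq : Measurable q) {t : ℝ} (h1 : γ ≤ Q.real {x | q x ≤ t})
    (h2 : Q.real {x | q x < t} ≤ γ) :
    ∃ ψ : X → ℝ, Measurable ψ ∧ (∀ x, 0 ≤ ψ x) ∧ (∀ x, ψ x ≤ 1) ∧ ∫ x, ψ x ∂Q = γ ∧
      (∀ x, q x < t → ψ x = 1) ∧ ∀ x, t < q x → ψ x = 0 := by
  set A := {x | q x < t} with hA
  set D := {x | q x = t} with hD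
  have hAm : MeasurableSet A := measurableSet_lt hq measurable_const
  have hDm : MeasurableSet D := measurableSet_eq_fun hq measurable_const
  have hAD : Q.real {x | q x ≤ t} = Q.real A + Q.real D := by
    rw [← measureReal_union _ hDm]
    · congr 1; ext x; simp [hA, hD, le_iff_lt_or_eq]
    · exact Set.disjoint_left.2 fun x hx hx' => (ne_of_lt hx) hx'
  set c := (γ - Q.real A) / Q.real D with hc
  have hc0 : 0 ≤ c := div_nonneg (by linarith) measureReal_nonneg
  have hc1 : c ≤ 1 := div_le_one_of_le₀ (by linarith) measureReal_nonneg
  have hcD : c * Q.real D = γ - Q.real A := by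
    by_cases h : Q.real D = 0
    · rw [h, mul_zero]; linarith
    · rw [hc, div_mul_cancel₀ _ h]
  refine ⟨fun x => A.indicator 1 x + c * D.indicator 1 x, ?_, fun x => ?_, fun x => ?_, ?_,
    fun x hx => ?_, fun x hx => ?_⟩
  · exact (measurable_one.indicator hAm).add ((measurable_one.indicator hDm).const_mul c)
  · exact add_nonneg (Set.indicator_nonneg (fun _ _ => zero_le_one) x)
      (mul_nonneg hc0 (Set.indicator_nonneg (fun _ _ => zero_le_one) x))
  · by_cases hxA : x ∈ A
    · have : x ∉ D := fun hx' => (ne_of_lt hxA) hx'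
      simp [hxA, this]
    · by_cases hxD : x ∈ D <;> simp [hxA, hxD, hc1]
  · rw [integral_add, integral_const_mul, integral_indicator_one hAm, integral_indicator_one hDm,
      hcD]
    · ring
    · exact (integrable_const (1 : ℝ)).indicator hAm
    · exact ((integrable_const (1 : ℝ)).indicator hDm).const_mul c
  · have h1 : x ∈ A := hx
    have h2 : x ∉ D := fun hx' => (ne_of_lt hx) hx'
    simp [h1, h2]
  · have h1 : x ∉ A := fun h => lt_asymm hx h
    have h2 : x ∉ D := fun hx' => (ne_of_gt hx) hx'
    simp [h1, h2]

lemma integrable_posPart {X : Type*} [MeasurableSpace X] (Q : Measure X) [IsFiniteMeasure Q]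
    {q : X → ℝ} (hq : Measurable q) (hq0 : ∀ x, 0 ≤ q x) (t : ℝ) :
    Integrable (fun x => max (t - q x) 0) Q :=
  Integrable.mono' (integrable_const (max t 0))
    (by fun_prop : Measurable fun x => max (t - q x) 0).aestronglyMeasurable
    (.of_forall fun x => by
      rw [Real.norm_eq_abs, abs_of_nonneg (le_max_right _ _)]
      exact max_le_max (by linarith [hq0 x]) le_rfl)

/-- Weak duality for optimal trimming: every level `t` bounds the trimmed average of `q`. -/
lemma dual_le_trimmedAvg {Q : Measure (EuclideanSpace ℝ (Fin k))} [IsFiniteMeasure Q]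
    {γ : ℝ} (hγ : 0 < γ) {φ : EuclideanSpace ℝ (Fin k) → ℝ} (hφ : IsTrimming γ Q φ)
    {q : EuclideanSpace ℝ (Fin k) → ℝ} (hq : Measurable q) (hq0 : ∀ x, 0 ≤ q x)
    (hφq : Integrable (fun x => φ x * q x) Q) (t : ℝ) :
    t - (∫ x, φ x ∂Q)⁻¹ * ∫ x, max (t - q x) 0 ∂Q ≤ trimmedAvg Q φ q ∧
    t - γ⁻¹ * ∫ x, max (t - q x) 0 ∂Q ≤ trimmedAvg Q φ q := by
  have hM := hφ.mass_pos hγ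
  have h1 : ∫ x, t * φ x - φ x * q x ∂Q ≤ ∫ x, max (t - q x) 0 ∂Q := by
    refine integral_mono ((hφ.integrable.const_mul t).sub hφq) (integrable_posPart Q hq hq0 t)
      fun x => ?_
    have h0 := hφ.nonneg x
    have h1 := hφ.le_one x
    have h2 := le_max_left (t - q x) 0
    have h3 := le_max_right (t - q x) 0
    simp only
    nlinarith
  rw [integral_sub (hφ.integrable.const_mul t) hφq, integral_const_mul] at h1
  have h2 : t - (∫ x, φ x ∂Q)⁻¹ * ∫ x, max (t - q x) 0 ∂Q ≤ trimmedAvg Q φ q := by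
    rw [trimmedAvg]
    calc t - (∫ x, φ x ∂Q)⁻¹ * ∫ x, max (t - q x) 0 ∂Q
        ≤ t - (∫ x, φ x ∂Q)⁻¹ * (t * ∫ x, φ x ∂Q - ∫ x, φ x * q x ∂Q) := by gcongr
      _ = _ := by field_simp; ring
  refine ⟨h2, le_trans ?_ h2⟩
  have h3 : 0 ≤ ∫ x, max (t - q x) 0 ∂Q := integral_nonneg fun x => le_max_right _ _
  have := hφ.mass
  gcongr

/-- Strong duality: filling up the sublevel sets attains the dual bound. -/
lemma trimmedAvg_of_bathtub {Q : Measure (EuclideanSpace ℝ (Fin k))} [IsFiniteMeasure Q]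
    {γ : ℝ} (hγ : 0 < γ) {φ : EuclideanSpace ℝ (Fin k) → ℝ} (hφ : IsTrimming γ Q φ)
    {q : EuclideanSpace ℝ (Fin k) → ℝ}
    (hφq : Integrable (fun x => φ x * q x) Q) {t : ℝ} (hmass : ∫ x, φ x ∂Q = γ)
    (h1 : ∀ x, q x < t → φ x = 1) (h0 : ∀ x, t < q x → φ x = 0) :
    trimmedAvg Q φ q = t - γ⁻¹ * ∫ x, max (t - q x) 0 ∂Q := by
  have h2 : ∫ x, max (t - q x) 0 ∂Q = ∫ x, t * φ x - φ x * q x ∂Q := by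
    congr 1; ext x
    rcases lt_trichotomy (q x) t with h | h | h
    · rw [h1 x h, max_eq_left (by linarith)]; ring
    · rw [h]; simp [mul_comm]
    · rw [h0 x h, max_eq_right (by linarith)]; ring
  rw [h2, integral_sub (hφ.integrable.const_mul t) hφq, integral_const_mul, hmass, trimmedAvg,
    hmass]
  field_simp; ring

/-- The equality case of weak duality. -/
lemma eq_bathtub_of_trimmedAvg_le {Q : Measure (EuclideanSpace ℝ (Fin k))} [IsFiniteMeasure Q]
    {γ : ℝ} (hγ : 0 < γ) {φ : EuclideanSpace ℝ (Fin k) → ℝ} (hφ : IsTrimming γ Q φ)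
    {q : EuclideanSpace ℝ (Fin k) → ℝ} (hq : Measurable q) (hq0 : ∀ x, 0 ≤ q x)
    (hφq : Integrable (fun x => φ x * q x) Q) {t : ℝ}
    (hI : 0 < ∫ x, max (t - q x) 0 ∂Q)
    (hle : trimmedAvg Q φ q ≤ t - γ⁻¹ * ∫ x, max (t - q x) 0 ∂Q) :
    ∫ x, φ x ∂Q = γ ∧ (∀ᵐ x ∂Q, q x < t → φ x = 1) ∧ ∀ᵐ x ∂Q, t < q x → φ x = 0 := by
  have hM := hφ.mass_pos hγ
  have hmass : ∫ x, φ x ∂Q = γ := by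
    refine le_antisymm ?_ hφ.mass
    have h1 := (dual_le_trimmedAvg hγ hφ hq hq0 hφq t).1.trans hle
    have h2 : γ⁻¹ * ∫ x, max (t - q x) 0 ∂Q ≤ (∫ x, φ x ∂Q)⁻¹ * ∫ x, max (t - q x) 0 ∂Q := by
      linarith
    exact (inv_le_inv₀ hγ hM).1 (le_of_mul_le_mul_right h2 hI)
  have hpt : ∀ x, 0 ≤ max (t - q x) 0 - (t * φ x - φ x * q x) := by
    intro x
    have h0 := hφ.nonneg x
    have h1 := hφ.le_one x
    have h2 := le_max_left (t - q x) 0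
    have h3 := le_max_right (t - q x) 0
    nlinarith
  have hint : Integrable (fun x => t * φ x - φ x * q x) Q :=
    (hφ.integrable.const_mul t).sub hφq
  have hzero : ∫ x, max (t - q x) 0 - (t * φ x - φ x * q x) ∂Q = 0 := by
    refine le_antisymm ?_ (integral_nonneg hpt)
    rw [integral_sub (integrable_posPart Q hq hq0 t) hint,
      integral_sub (hφ.integrable.const_mul t) hφq, integral_const_mul, hmass]
    rw [trimmedAvg, hmass] at hle
    have := mul_le_mul_of_nonneg_left hle hγ.le
    rw [mul_sub, mul_inv_cancel_left₀ hγ.ne', mul_inv_cancel_left₀ hγ.ne'] at this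
    linarith
  rw [integral_eq_zero_iff_of_nonneg hpt ((integrable_posPart Q hq hq0 t).sub hint)] at hzero
  refine ⟨hmass, ?_, ?_⟩
  · filter_upwards [hzero] with x hx hlt
    simp only [Pi.zero_apply, max_eq_left (sub_pos.2 hlt).le] at hx
    have : (t - q x) * (1 - φ x) = 0 := by linarith
    linarith [(mul_eq_zero.1 this).resolve_left (sub_pos.2 hlt).ne']
  · filter_upwards [hzero] with x hx hlt
    simp only [Pi.zero_apply, max_eq_right (sub_neg.2 hlt).le] at hx
    have : (q x - t) * φ x = 0 := by linarith
    exact (mul_eq_zero.1 this).resolve_left (sub_pos.2 hlt).ne'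

/-! ### Characterization and existence of minimizers -/

/-- The squared Mahalanobis distance `(x - m)' S⁻¹ (x - m)`. -/
noncomputable def mahalanobisSq (m : EuclideanSpace ℝ (Fin k)) (S : Matrix (Fin k) (Fin k) ℝ)
    (x : EuclideanSpace ℝ (Fin k)) : ℝ :=
  (x - m).ofLp ⬝ᵥ (S⁻¹.mulVec (x - m).ofLp)

lemma ellipsoid_eq (m : EuclideanSpace ℝ (Fin k)) (S : Matrix (Fin k) (Fin k) ℝ) (s : ℝ) :
    ellipsoid m S s = {x | mahalanobisSq m S x ≤ s ^ 2} := rfl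

@[fun_prop]
lemma continuous_mahalanobisSq (m : EuclideanSpace ℝ (Fin k)) (S : Matrix (Fin k) (Fin k) ℝ) :
    Continuous (mahalanobisSq m S) := by
  unfold mahalanobisSq
  simp only [dotProduct, Matrix.mulVec]
  fun_prop

lemma norm_sq_eq_mahalanobisSq {B : EuclideanSpace ℝ (Fin k) →L[ℝ] EuclideanSpace ℝ (Fin k)}
    {d : ℝ} {S : Matrix (Fin k) (Fin k) ℝ} (hB : gram B = d • S⁻¹)
    (m x : EuclideanSpace ℝ (Fin k)) :
    ‖B x - B m‖ ^ 2 = d * mahalanobisSq m S x := by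
  rw [← map_sub, norm_sq_apply_eq_gram, hB, Matrix.smul_mulVec, dotProduct_smul, smul_eq_mul,
    mahalanobisSq]

lemma exists_norm_le_of_det_ne_zero
    {B : EuclideanSpace ℝ (Fin k) →L[ℝ] EuclideanSpace ℝ (Fin k)} (hB : B.det ≠ 0) :
    ∃ K : ℝ, 0 ≤ K ∧ ∀ x, ‖x‖ ≤ K * ‖B x‖ := by
  let e := B.toContinuousLinearEquivOfDetNeZero hB
  refine ⟨‖(e.symm : EuclideanSpace ℝ (Fin k) →L[ℝ] EuclideanSpace ℝ (Fin k))‖, norm_nonneg _,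
    fun x => ?_⟩
  have h := (e.symm : EuclideanSpace ℝ (Fin k) →L[ℝ] EuclideanSpace ℝ (Fin k)).le_opNorm (B x)
  have h2 : e.symm (B x) = x := e.symm_apply_apply x
  simpa [h2] using h

lemma volume_setOf_norm_sq_eq [NeZero k]
    {B : EuclideanSpace ℝ (Fin k) →L[ℝ] EuclideanSpace ℝ (Fin k)} (hB : B.det ≠ 0)
    (a : EuclideanSpace ℝ (Fin k)) (t : ℝ) :
    volume {x | ‖B x - a‖ ^ 2 = t} = 0 := by
  refine measure_mono_null (t := B ⁻¹' Metric.sphere a (Real.sqrt t)) (fun x hx => ?_) ?_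
  · have hx' : ‖B x - a‖ ^ 2 = t := hx
    simp [← hx', Real.sqrt_sq]
  · rw [Measure.addHaar_preimage_continuousLinearMap _ hB, Measure.addHaar_sphere, mul_zero]

lemma isTrimming_of_bounded {γ : ℝ} {Q : Measure (EuclideanSpace ℝ (Fin k))} [IsFiniteMeasure Q]
    {φ : EuclideanSpace ℝ (Fin k) → ℝ} (hm : Measurable φ) (h0 : ∀ x, 0 ≤ φ x)
    (h1 : ∀ x, φ x ≤ 1) (hmass : γ ≤ ∫ x, φ x ∂Q) {R : ℝ} (hR : ∀ x, R < ‖x‖ → φ x = 0) :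
    IsTrimming γ Q φ := by
  refine ⟨hm, h0, h1, hmass, Integrable.mono' (integrable_const (R ^ 2))
    (by fun_prop : Measurable fun x => ‖x‖ ^ 2 * φ x).aestronglyMeasurable
    (.of_forall fun x => ?_)⟩
  rw [Real.norm_eq_abs, abs_of_nonneg (mul_nonneg (sq_nonneg _) (h0 x))]
  by_cases hx : R < ‖x‖
  · rw [hR x hx, mul_zero]; positivity
  · push Not at hx
    have := h1 x
    have := h0 x
    have : ‖x‖ ^ 2 ≤ R ^ 2 := by gcongr
    nlinarith [sq_nonneg ‖x‖]

/-- Trimming functions of mass `γ` filling up the sublevel sets of `‖B x - a‖²`. -/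
lemma exists_isTrimming_bathtub {γ : ℝ} {Q : Measure (EuclideanSpace ℝ (Fin k))}
    [IsFiniteMeasure Q] (hγ : 0 < γ)
    {B : EuclideanSpace ℝ (Fin k) →L[ℝ] EuclideanSpace ℝ (Fin k)} (hB : B.det ≠ 0)
    (a : EuclideanSpace ℝ (Fin k)) {t : ℝ} (h1 : γ ≤ Q.real {x | ‖B x - a‖ ^ 2 ≤ t})
    (h2 : Q.real {x | ‖B x - a‖ ^ 2 < t} ≤ γ) :
    ∃ ψ, IsTrimming γ Q ψ ∧ trimmedAvg Q ψ (fun x => ‖B x - a‖ ^ 2)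
      = t - γ⁻¹ * ∫ x, max (t - ‖B x - a‖ ^ 2) 0 ∂Q := by
  obtain ⟨ψ, hm, h0, hle, hmass, hin, hout⟩ := exists_bathtub Q (γ := γ)
    (q := fun x => ‖B x - a‖ ^ 2) (by fun_prop) h1 h2
  obtain ⟨K, hK0, hK⟩ := exists_norm_le_of_det_ne_zero hB
  have htr : IsTrimming γ Q ψ := by
    refine isTrimming_of_bounded hm h0 hle hmass.ge (R := K * (Real.sqrt t + ‖a‖))
      fun x hx => hout x ?_
    by_contra! hle
    have h3 : ‖B x - a‖ ≤ Real.sqrt t := Real.le_sqrt_of_sq_le hle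
    have h4 : ‖B x‖ ≤ ‖B x - a‖ + ‖a‖ := by
      simpa using norm_add_le (B x - a) a
    have := (hK x).trans (mul_le_mul_of_nonneg_left (h4.trans (add_le_add_left h3 _)) hK0)
    linarith
  exact ⟨ψ, htr, trimmedAvg_of_bathtub hγ htr (htr.integrable_mul_norm_sq B a) hmass hin hout⟩

/-- A minimizer is, up to null sets and the boundary, the indicator of the ellipsoid given by its
own trimmed mean, trimmed covariance and radius; its mass is exactly `γ`. -/
lemma IsMinimizer.spec [NeZero k] {γ : ℝ} (hγ0 : 0 < γ) (hγ1 : γ < 1)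
    {Q : Measure (EuclideanSpace ℝ (Fin k))} [IsProbabilityMeasure Q]
    (hQ : ∀ N : Set (EuclideanSpace ℝ (Fin k)), MeasurableSet N → volume N = 0 → Q.real N < γ)
    {φ : EuclideanSpace ℝ (Fin k) → ℝ} (hφ : IsMinimizer γ Q φ) :
    (trimmedCov Q φ).PosDef ∧ 0 ≤ trimmedRadius γ Q φ ∧ ∫ x, φ x ∂Q = γ ∧
      γ ≤ Q.real {x | mahalanobisSq (trimmedMean Q φ) (trimmedCov Q φ) x
        ≤ trimmedRadius γ Q φ ^ 2} ∧
      Q.real {x | mahalanobisSq (trimmedMean Q φ) (trimmedCov Q φ) x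
        < trimmedRadius γ Q φ ^ 2} ≤ γ ∧
      (∀ᵐ x ∂Q, mahalanobisSq (trimmedMean Q φ) (trimmedCov Q φ) x < trimmedRadius γ Q φ ^ 2 →
        φ x = 1) ∧
      ∀ᵐ x ∂Q, trimmedRadius γ Q φ ^ 2 < mahalanobisSq (trimmedMean Q φ) (trimmedCov Q φ) x →
        φ x = 0 := by
  have hk : (0 : ℝ) < k := by exact_mod_cast Nat.pos_of_ne_zero (NeZero.ne k)
  have htr := hφ.1
  have hC := htr.trimmedCov_posDef hγ0 hQ
  obtain ⟨B, d, hd, hdk, hB, hgram⟩ := exists_normalizing_map hC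
  have hB0 : B.det ≠ 0 := fun h => by simp [h] at hB
  set T := trimmedMean Q φ
  set C := trimmedCov Q φ
  set s := trimmedRadius γ Q φ with hs
  have hq : ∀ x, ‖B x - B T‖ ^ 2 = d * mahalanobisSq T C x := norm_sq_eq_mahalanobisSq hgram T
  have hpos : ∀ x, 0 ≤ mahalanobisSq T C x := fun x => by
    by_contra! h
    have := mul_neg_of_pos_of_neg hd h
    rw [← hq x] at this
    exact absurd this (not_lt.2 (sq_nonneg _))
  obtain ⟨hs0, hle, hlt⟩ := quantile_spec Q hγ1 (d := fun x => Real.sqrt (mahalanobisSq T C x))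
    (by fun_prop) (fun x => Real.sqrt_nonneg _) (s := s) (by
      rw [hs, trimmedRadius]
      congr 1
      ext u
      refine and_congr_right fun hu => ?_
      rw [ellipsoid_eq]
      simp_rw [Real.sqrt_le_left hu.le]
      rfl)
  replace hlt := hlt hγ0
  simp_rw [Real.sqrt_le_left hs0] at hle
  simp_rw [fun x => lt_iff_lt_of_le_iff_le (Real.le_sqrt hs0 (hpos x))] at hlt
  refine ⟨hC, hs0, ?_⟩
  have hsub : ∀ x, ‖B x - B T‖ ^ 2 ≤ d * s ^ 2 ↔ mahalanobisSq T C x ≤ s ^ 2 := fun x => by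
    rw [hq, mul_le_mul_iff_right₀ hd]
  have hsub' : ∀ x, ‖B x - B T‖ ^ 2 < d * s ^ 2 ↔ mahalanobisSq T C x < s ^ 2 := fun x => by
    rw [hq, mul_lt_mul_iff_right₀ hd]
  have hsub'' : ∀ x, d * s ^ 2 < ‖B x - B T‖ ^ 2 ↔ s ^ 2 < mahalanobisSq T C x := fun x => by
    rw [hq, mul_lt_mul_iff_right₀ hd]
  -- Compare with the optimal trimming for the distance given by the minimizer itself.
  obtain ⟨ψ, hψ, hψavg⟩ := exists_isTrimming_bathtub hγ0 hB0 (B T) (t := d * s ^ 2)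
    (by simp_rw [hsub]; exact hle) (by simp_rw [hsub']; exact hlt)
  have havg := htr.trimmedAvg_norm_sq_of_gram hC hgram
  have hψ0 : 0 ≤ trimmedAvg Q ψ (fun x => ‖B x - B T‖ ^ 2) :=
    mul_nonneg (inv_nonneg.2 (hψ.mass_pos hγ0).le)
      (integral_nonneg fun x => mul_nonneg (hψ.nonneg x) (sq_nonneg _))
  have hcomp : (k : ℝ) * d ≤ trimmedAvg Q ψ (fun x => ‖B x - B T‖ ^ 2) := by
    have h1 := (hφ.2 ψ hψ).trans (hψ.det_trimmedCov_le hγ0 hB (B T))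
    rw [← hdk] at h1
    have h2 := le_of_pow_le_pow_left₀ (NeZero.ne k) (by positivity) h1
    rwa [le_div_iff₀ hk, mul_comm] at h2
  have hI : 0 < ∫ x, max (d * s ^ 2 - ‖B x - B T‖ ^ 2) 0 ∂Q := by
    refine lt_of_le_of_ne (integral_nonneg fun x => le_max_right _ _) fun h0 => ?_
    have hint := integrable_posPart Q (q := fun x => ‖B x - B T‖ ^ 2) (by fun_prop)
      (fun x => sq_nonneg _) (d * s ^ 2)
    have h1 := (integral_eq_zero_iff_of_nonneg (fun x => le_max_right _ _) hint).1 h0.symm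
    have h2 : Q {x | mahalanobisSq T C x < s ^ 2} = 0 := by
      refine measure_mono_null (fun x hx => ?_) (ae_iff.1 h1)
      have hx' : mahalanobisSq T C x < s ^ 2 := hx
      have h4 : 0 < d * s ^ 2 - ‖B x - B T‖ ^ 2 := sub_pos.2 ((hsub' x).2 hx')
      show ¬ max (d * s ^ 2 - ‖B x - B T‖ ^ 2) 0 = 0
      rw [max_eq_left h4.le]
      exact h4.ne'
    have h3 : γ ≤ Q.real {x | ‖B x - B T‖ ^ 2 = d * s ^ 2} := by
      refine hle.trans ?_
      calc Q.real {x | mahalanobisSq T C x ≤ s ^ 2}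
          ≤ Q.real ({x | mahalanobisSq T C x < s ^ 2} ∪ {x | ‖B x - B T‖ ^ 2 = d * s ^ 2}) := by
            refine measureReal_mono fun x hx => ?_
            have hx' : mahalanobisSq T C x ≤ s ^ 2 := hx
            rcases lt_or_eq_of_le hx' with h | h
            · exact Or.inl h
            · exact Or.inr (by show _ = _; rw [hq, h])
        _ ≤ _ := measureReal_union_le _ _
        _ = _ := by rw [measureReal_def, h2]; simp
    exact absurd h3 (not_le.2 (hQ _ (measurableSet_eq_fun (by fun_prop) measurable_const)
      (volume_setOf_norm_sq_eq hB0 _ _)))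
  obtain ⟨hmass, hin, hout⟩ := eq_bathtub_of_trimmedAvg_le hγ0 htr
    (q := fun x => ‖B x - B T‖ ^ 2) (by fun_prop) (fun x => sq_nonneg _)
    (htr.integrable_mul_norm_sq B (B T)) hI (by rw [havg, ← hψavg]; exact hcomp)
  refine ⟨hmass, hle, hlt, ?_, ?_⟩
  · filter_upwards [hin] with x hx hlt using hx ((hsub' x).2 hlt)
  · filter_upwards [hout] with x hx hlt using hx ((hsub'' x).2 hlt)

/-- Parameters `(a, B)` of affine maps `x ↦ B x - a` of Euclidean space. -/
abbrev AffineParam (k : ℕ) : Type :=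
  EuclideanSpace ℝ (Fin k) × (EuclideanSpace ℝ (Fin k) →L[ℝ] EuclideanSpace ℝ (Fin k))

/-- The dual objective of optimal trimming at level `t` for the distance `‖B x - a‖`,
with parameter `θ = (a, B)`. -/
noncomputable def dualValue (γ : ℝ) (Q : Measure (EuclideanSpace ℝ (Fin k))) (t : ℝ)
    (θ : AffineParam k) : ℝ :=
  t - γ⁻¹ * ∫ x, max (t - ‖θ.2 x - θ.1‖ ^ 2) 0 ∂Q

lemma continuous_integral_posPart (Q : Measure (EuclideanSpace ℝ (Fin k))) [IsFiniteMeasure Q]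
    (t : ℝ) : Continuous fun θ : AffineParam k =>
        ∫ x, max (t - ‖θ.2 x - θ.1‖ ^ 2) 0 ∂Q := by
  refine continuous_of_dominated (bound := fun _ => max t 0)
    (fun θ => (by fun_prop : Measurable fun x => max (t - ‖θ.2 x - θ.1‖ ^ 2) 0).aestronglyMeasurable)
    (fun θ => .of_forall fun x => ?_) (integrable_const _) (.of_forall fun x => by fun_prop)
  rw [Real.norm_eq_abs, abs_of_nonneg (le_max_right _ _)]
  exact max_le_max (by nlinarith [sq_nonneg ‖θ.2 x - θ.1‖]) le_rfl

/-- For parameters `(a, B)` going to infinity the sets `{‖B x - a‖² < t}` lose all their mass: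
after normalizing `(a, B)`, they shrink to an affine subspace. -/
lemma exists_measure_lt_of_norm_gt (P : Measure (EuclideanSpace ℝ (Fin k))) [IsFiniteMeasure P]
    (hP : P ≪ volume) (t : ℝ) {η : ℝ} (hη : 0 < η) :
    ∃ R : ℝ, ∀ θ : AffineParam k, R < ‖θ‖ →
        P.real {x | ‖θ.2 x - θ.1‖ ^ 2 < t} < η := by
  by_contra! hcon
  choose θ hθ hθη using fun n : ℕ => hcon n
  have hpos : ∀ n, 0 < ‖θ n‖ := fun n => (Nat.cast_nonneg n).trans_lt (hθ n)
  have hmem : ∀ n, ‖θ n‖⁻¹ • θ n ∈ Metric.sphere (0 : AffineParam k) 1 := fun n => by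
    rw [mem_sphere_zero_iff_norm, norm_smul, norm_inv, norm_norm, inv_mul_cancel₀ (hpos n).ne']
  have : ProperSpace (AffineParam k) :=
    FiniteDimensional.proper ℝ _
  obtain ⟨u, hu, g, hg, hlim⟩ := (isCompact_sphere (0 : AffineParam k) 1).tendsto_subseq hmem
  rw [mem_sphere_zero_iff_norm] at hu
  have hnull : volume {x | u.2 x = u.1} = 0 := by
    rcases Set.eq_empty_or_nonempty {x | u.2 x = u.1} with h | ⟨x₀, hx₀⟩
    · rw [h, measure_empty]
    · have hx₀' : u.2 x₀ = u.1 := hx₀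
      have hne : LinearMap.ker (u.2 : EuclideanSpace ℝ (Fin k) →ₗ[ℝ] EuclideanSpace ℝ (Fin k)) ≠ ⊤ := by
        intro htop
        have h2 : u.2 = 0 := by
          ext1 x
          have : x ∈ LinearMap.ker (u.2 : EuclideanSpace ℝ (Fin k) →ₗ[ℝ] EuclideanSpace ℝ (Fin k)) := by
            rw [htop]; trivial
          simpa using this
        have h1 : u.1 = 0 := by rw [← hx₀', h2]; rfl
        have : u = 0 := Prod.ext h1 h2
        rw [this, norm_zero] at hu
        exact zero_ne_one hu
      have hset : {x | u.2 x = u.1} = (fun x => x - x₀) ⁻¹'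
          (LinearMap.ker (u.2 : EuclideanSpace ℝ (Fin k) →ₗ[ℝ] EuclideanSpace ℝ (Fin k)) :
            Set (EuclideanSpace ℝ (Fin k))) := by
        ext x; simp [← hx₀', sub_eq_zero]
      rw [hset, (measurePreserving_sub_right volume x₀).measure_preimage]
      · exact Measure.addHaar_submodule _ _ hne
      · exact (Submodule.closed_of_finiteDimensional _).measurableSet.nullMeasurableSet
  have hlimit : Tendsto (fun n => P.real {x | ‖(θ (g n)).2 x - (θ (g n)).1‖ ^ 2 < t}) atTop
      (𝓝 0) := by
    have hm : ∀ n, MeasurableSet {x | ‖(θ (g n)).2 x - (θ (g n)).1‖ ^ 2 < t} := fun n =>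
      measurableSet_lt (by fun_prop) measurable_const
    have := tendsto_integral_of_dominated_convergence (μ := P) (fun _ => (1 : ℝ))
      (F := fun n => ({x | ‖(θ (g n)).2 x - (θ (g n)).1‖ ^ 2 < t}).indicator 1) (f := fun _ => (0 : ℝ))
      (fun n => (measurable_one.indicator (hm n)).aestronglyMeasurable) (integrable_const _)
      (fun n => .of_forall fun x => ?_) ?_
    · simpa [integral_indicator_one (hm _)] using this
    · by_cases hx : x ∈ {x | ‖(θ (g n)).2 x - (θ (g n)).1‖ ^ 2 < t} <;> simp [hx]
    · have hae : ∀ᵐ x ∂P, u.2 x ≠ u.1 := by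
        rw [ae_iff]; simpa using hP hnull
      filter_upwards [hae] with x hx
      refine tendsto_const_nhds.congr' ?_
      have hc : Tendsto (fun n => ‖(‖θ (g n)‖⁻¹ • θ (g n)).2 x - (‖θ (g n)‖⁻¹ • θ (g n)).1‖) atTop
          (𝓝 ‖u.2 x - u.1‖) := by
        have hcont : Continuous fun v : AffineParam k => ‖v.2 x - v.1‖ := by fun_prop
        exact (hcont.tendsto u).comp hlim
      have hu0 : 0 < ‖u.2 x - u.1‖ := norm_pos_iff.2 (sub_ne_zero.2 hx)
      have hinf : Tendsto (fun n => ‖θ (g n)‖) atTop atTop :=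
        tendsto_atTop_mono (fun n => (hθ (g n)).le)
          (tendsto_natCast_atTop_atTop.comp hg.tendsto_atTop)
      have hprod : Tendsto (fun n => ‖(θ (g n)).2 x - (θ (g n)).1‖) atTop atTop := by
        refine (Tendsto.pos_mul_atTop hu0 hc hinf).congr fun n => ?_
        rw [Prod.smul_fst, Prod.smul_snd, smul_apply, ← smul_sub, norm_smul,
          norm_inv, norm_norm, mul_comm, mul_inv_cancel_left₀ (hpos _).ne']
      filter_upwards [((tendsto_pow_atTop two_ne_zero).comp hprod).eventually_ge_atTop t] with n hn
      rw [Set.indicator_of_notMem]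
      exact not_lt.2 hn
  exact absurd (ge_of_tendsto' hlimit fun n => hθη (g n)) (not_le.2 hη)

/-- Existence of minimizers for a probability measure that differs from an absolutely continuous
one by mass less than `γ`. -/
lemma exists_isMinimizer [NeZero k] {γ : ℝ} (hγ0 : 0 < γ) (hγ1 : γ < 1)
    {P Q : Measure (EuclideanSpace ℝ (Fin k))} [IsProbabilityMeasure P] [IsProbabilityMeasure Q]
    (hP : P ≪ volume) {ε : ℝ} (hε : ε < γ)
    (hPQ : ∀ S : Set (EuclideanSpace ℝ (Fin k)), MeasurableSet S → Q.real S ≤ P.real S + ε) :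
    ∃ φ, IsMinimizer γ Q φ := by
  have hk : (0 : ℝ) < k := by exact_mod_cast Nat.pos_of_ne_zero (NeZero.ne k)
  have hQ : ∀ N : Set (EuclideanSpace ℝ (Fin k)), MeasurableSet N → volume N = 0 →
      Q.real N < γ := fun N hN hN0 => by
    have := hPQ N hN
    rw [measureReal_def P, hP hN0] at this
    simp at this; linarith
  let K : Set (AffineParam k) := {θ | θ.2.det ^ 2 = 1}
  have hcont : ∀ t, Continuous (dualValue γ Q t) := fun t =>
    continuous_const.sub (continuous_const.mul (continuous_integral_posPart Q t))
  have hex : ∀ θ : AffineParam k, ∃ ψ : EuclideanSpace ℝ (Fin k) → ℝ, ∃ t : ℝ, θ ∈ K → IsTrimming γ Q ψ ∧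
      trimmedAvg Q ψ (fun x => ‖θ.2 x - θ.1‖ ^ 2) = dualValue γ Q t θ := by
    intro θ
    by_cases hθ : θ ∈ K
    · have hB0 : θ.2.det ≠ 0 := fun h => by
        have : θ.2.det ^ 2 = 1 := hθ
        simp [h] at this
      obtain ⟨hs0, h1, h2⟩ := quantile_spec Q hγ1 (d := fun x => ‖θ.2 x - θ.1‖)
        (by fun_prop) (fun x => norm_nonneg _) rfl
      set s := sInf {s : ℝ | 0 < s ∧ γ ≤ Q.real {x | ‖θ.2 x - θ.1‖ ≤ s}}
      obtain ⟨ψ, hψ, hψ'⟩ := exists_isTrimming_bathtub (Q := Q) hγ0 hB0 θ.1 (t := s ^ 2)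
        (by simpa only [sq_le_sq₀ (norm_nonneg _) hs0] using h1)
        (by simpa only [sq_lt_sq₀ (norm_nonneg _) hs0] using h2 hγ0)
      exact ⟨ψ, s ^ 2, fun _ => ⟨hψ, hψ'⟩⟩
    · exact ⟨0, 0, fun h => absurd h hθ⟩
  choose ψ τ hψτ using hex
  -- `J θ` is the optimal trimmed mean of `‖B x - a‖²`, a supremum of continuous dual values attained
  -- at the level `τ θ`; hence it is lower semicontinuous.
  set J : AffineParam k → ℝ := fun θ => trimmedAvg Q (ψ θ) (fun x => ‖θ.2 x - θ.1‖ ^ 2) with hJ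
  have hweak : ∀ (θ : AffineParam k) (φ : EuclideanSpace ℝ (Fin k) → ℝ) (t : ℝ), IsTrimming γ Q φ →
      dualValue γ Q t θ ≤ trimmedAvg Q φ (fun x => ‖θ.2 x - θ.1‖ ^ 2) := fun θ φ t hφ =>
    (dual_le_trimmedAvg hγ0 hφ (by fun_prop) (fun x => sq_nonneg _)
      (hφ.integrable_mul_norm_sq θ.2 θ.1) t).2
  have hlsc : LowerSemicontinuousOn J K := by
    intro θ hθ y hy
    have hy' : y < J θ := hy
    rw [hJ] at hy'
    simp only [(hψτ θ hθ).2] at hy'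
    have := ((hcont (τ θ)).continuousWithinAt (s := K) (x := θ)).eventually_const_lt hy'
    filter_upwards [this, self_mem_nhdsWithin] with θ' h1 h2
    exact h1.trans_le (hweak θ' _ _ (hψτ θ' h2).1)
  -- Coercivity: a parameter far out captures `Q`-mass less than `γ` at any fixed level `t`, so the
  -- dual value at `t`, a lower bound for `J`, exceeds `J θ₀`.
  set θ₀ : AffineParam k := (0, ContinuousLinearMap.id ℝ _) with hθ₀
  have hθ₀K : θ₀ ∈ K := by
    show (ContinuousLinearMap.id ℝ (EuclideanSpace ℝ (Fin k))).det ^ 2 = 1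
    rw [ContinuousLinearMap.det, ContinuousLinearMap.coe_id, LinearMap.det_id, one_pow]
  have hJ0 : ∀ θ ∈ K, 0 ≤ J θ := fun θ hθ =>
    mul_nonneg (inv_nonneg.2 ((hψτ θ hθ).1.mass_pos hγ0).le)
      (integral_nonneg fun x => mul_nonneg ((hψτ θ hθ).1.nonneg x) (sq_nonneg _))
  obtain ⟨R, hR⟩ : ∃ R : ℝ, ∀ θ ∈ K, R < ‖θ‖ → J θ₀ < J θ := by
    set c := (γ - ε) / (2 * γ) with hc
    have hc0 : 0 < c := div_pos (by linarith) (by linarith)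
    set t := (J θ₀ + 1) / c with ht
    have ht0 : 0 < t := div_pos (by linarith [hJ0 θ₀ hθ₀K]) hc0
    obtain ⟨R, hR⟩ := exists_measure_lt_of_norm_gt P hP t (η := (γ - ε) / 2) (by linarith)
    refine ⟨R, fun θ hθ hθR => ?_⟩
    have h1 := hweak θ _ t (hψτ θ hθ).1
    have hm : MeasurableSet {x | ‖θ.2 x - θ.1‖ ^ 2 < t} :=
      measurableSet_lt (by fun_prop) measurable_const
    have h2 : ∫ x, max (t - ‖θ.2 x - θ.1‖ ^ 2) 0 ∂Q ≤ t * ((γ + ε) / 2) := by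
      calc ∫ x, max (t - ‖θ.2 x - θ.1‖ ^ 2) 0 ∂Q
          ≤ ∫ x, t * ({x | ‖θ.2 x - θ.1‖ ^ 2 < t}).indicator 1 x ∂Q := by
            refine integral_mono (integrable_posPart Q (by fun_prop) (fun x => sq_nonneg _) t)
              (((integrable_const (1 : ℝ)).indicator hm).const_mul t) fun x => ?_
            by_cases hx : ‖θ.2 x - θ.1‖ ^ 2 < t
            · simp only [Set.indicator_of_mem (show x ∈ {x | ‖θ.2 x - θ.1‖ ^ 2 < t} from hx)]
              simp only [Pi.one_apply, mul_one]
              exact max_le (by linarith [sq_nonneg ‖θ.2 x - θ.1‖]) ht0.le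
            · simp only [Set.indicator_of_notMem (show x ∉ {x | ‖θ.2 x - θ.1‖ ^ 2 < t} from hx)]
              rw [max_eq_right (by linarith), mul_zero]
        _ = t * Q.real {x | ‖θ.2 x - θ.1‖ ^ 2 < t} := by
            rw [integral_const_mul, integral_indicator_one hm]
        _ ≤ _ := by
            gcongr
            linarith [hPQ _ hm, hR θ hθR]
    have h3 : J θ₀ + 1 ≤ dualValue γ Q t θ := by
      rw [dualValue]
      calc J θ₀ + 1 = t - γ⁻¹ * (t * ((γ + ε) / 2)) := by
            have : J θ₀ + 1 = t * c := by rw [ht, div_mul_cancel₀ _ hc0.ne']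
            rw [this, hc]; field_simp; ring
        _ ≤ _ := by gcongr
    linarith
  have : ProperSpace (AffineParam k) := FiniteDimensional.proper ℝ _
  have hKc : IsClosed K := by
    refine isClosed_eq ?_ continuous_const
    exact (ContinuousLinearMap.continuous_det.comp continuous_snd).pow 2
  have hK'c : IsCompact (Metric.closedBall (0 : AffineParam k) (max R ‖θ₀‖) ∩ K) :=
    (isCompact_closedBall _ _).inter_right hKc
  obtain ⟨θ, hθ, hmin⟩ := LowerSemicontinuousOn.exists_isMinOn
    (s := Metric.closedBall (0 : AffineParam k) (max R ‖θ₀‖) ∩ K)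
    ⟨θ₀, by simp, hθ₀K⟩ hK'c (hlsc.mono Set.inter_subset_right)
  have hminK : ∀ θ' ∈ K, J θ ≤ J θ' := by
    intro θ' hθ'
    by_cases h : ‖θ'‖ ≤ max R ‖θ₀‖
    · exact hmin ⟨by simpa using h, hθ'⟩
    · exact (hmin ⟨by simp, hθ₀K⟩ : J θ ≤ J θ₀).trans
        (hR θ' hθ' ((le_max_left _ _).trans_lt (not_le.1 h))).le
  refine ⟨ψ θ, (hψτ θ hθ.2).1, fun φ hφ => ?_⟩
  have hC := hφ.trimmedCov_posDef hγ0 hQ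
  -- The normalizing map of a competitor `φ` turns `det C(φ)` into the value of `J`.
  obtain ⟨B, d, hd, hdk, hB, hgram⟩ := exists_normalizing_map hC
  have h1 : J θ ≤ k * d := by
    rw [← hφ.trimmedAvg_norm_sq_of_gram hC hgram]
    have hK1 : ((B (trimmedMean Q φ), B) : AffineParam k) ∈ K := hB
    refine (hminK _ hK1).trans ?_
    simp only [hJ, (hψτ _ hK1).2]
    exact hweak (B (trimmedMean Q φ), B) φ _ hφ
  calc (trimmedCov Q (ψ θ)).det ≤ (J θ / k) ^ k := (hψτ θ hθ.2).1.det_trimmedCov_le hγ0 hθ.2 _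
    _ ≤ d ^ k := by
        have := hJ0 θ hθ.2
        gcongr
        rw [div_le_iff₀ hk]; linarith
    _ = _ := hdk

/-! ### Radial integrals and the radial model -/

lemma sphereArea_eq [NeZero k] :
    sphereArea k = k * (volume : Measure (EuclideanSpace ℝ (Fin k))).real (Metric.ball 0 1) := by
  have hk : (0 : ℝ) < k := by exact_mod_cast Nat.pos_of_ne_zero (NeZero.ne k)
  have hG : 0 < Real.Gamma ((k : ℝ) / 2) := Real.Gamma_pos_of_pos (by positivity)
  rw [measureReal_def, EuclideanSpace.volume_ball, Fintype.card_fin, ENNReal.ofReal_one, one_pow,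
    one_mul, ENNReal.toReal_ofReal (by positivity), sphereArea, Real.Gamma_add_one (by positivity),
    Real.sqrt_eq_rpow, ← Real.rpow_natCast, ← Real.rpow_mul Real.pi_pos.le,
    show (1 / 2 : ℝ) * k = k / 2 by ring]
  field_simp

lemma sphereArea_pos [NeZero k] : 0 < sphereArea k := by
  have hk : (0 : ℝ) < k := by exact_mod_cast Nat.pos_of_ne_zero (NeZero.ne k)
  have hG : 0 < Real.Gamma ((k : ℝ) / 2) := Real.Gamma_pos_of_pos (by positivity)
  unfold sphereArea
  positivity

/-- Integration of radial functions over a centred ball in polar coordinates. -/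
lemma setIntegral_closedBall_radial [NeZero k] (f : ℝ → ℝ) {ρ : ℝ} (hρ : 0 ≤ ρ) :
    ∫ x in Metric.closedBall (0 : EuclideanSpace ℝ (Fin k)) ρ, f ‖x‖
      = sphereArea k * ∫ s in (0 : ℝ)..ρ, f s * s ^ (k - 1) := by
  have h1 : ∀ x : EuclideanSpace ℝ (Fin k),
      (Metric.closedBall (0 : EuclideanSpace ℝ (Fin k)) ρ).indicator (fun x => f ‖x‖) x
        = (Set.Iic ρ).indicator f ‖x‖ := fun x => by
    by_cases hx : ‖x‖ ≤ ρ <;> simp [hx]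
  rw [← integral_indicator Metric.isClosed_closedBall.measurableSet]
  simp_rw [h1]
  rw [integral_fun_norm_addHaar, sphereArea_eq, finrank_euclideanSpace_fin, nsmul_eq_mul,
    smul_eq_mul, mul_assoc]
  congr 2
  rw [intervalIntegral.integral_of_le hρ, ← integral_indicator measurableSet_Ioi,
    ← integral_indicator measurableSet_Ioc]
  congr 1
  ext s
  by_cases h0 : 0 < s <;> by_cases h1 : s ≤ ρ <;> simp [h0, h1, mul_comm]

lemma measurableEmbedding_of_det_ne_zero
    {B : EuclideanSpace ℝ (Fin k) →L[ℝ] EuclideanSpace ℝ (Fin k)} (hB : B.det ≠ 0) :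
    MeasurableEmbedding B :=
  (B.toContinuousLinearEquivOfDetNeZero hB).toHomeomorph.measurableEmbedding

lemma map_volume_of_det_ne_zero
    {B : EuclideanSpace ℝ (Fin k) →L[ℝ] EuclideanSpace ℝ (Fin k)} (hB : B.det ≠ 0) :
    Measure.map B volume = ENNReal.ofReal |B.det⁻¹| •
      (volume : Measure (EuclideanSpace ℝ (Fin k))) := by
  have hB' : LinearMap.det (B : EuclideanSpace ℝ (Fin k) →ₗ[ℝ] EuclideanSpace ℝ (Fin k)) ≠ 0 := hB
  exact Measure.map_linearMap_addHaar_eq_smul_addHaar volume hB'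

/-- Change of variables under an invertible affine map. -/
lemma integral_comp_affine {B : EuclideanSpace ℝ (Fin k) →L[ℝ] EuclideanSpace ℝ (Fin k)}
    (hB : B.det ≠ 0) (a : EuclideanSpace ℝ (Fin k)) (g : EuclideanSpace ℝ (Fin k) → ℝ) :
    ∫ x, g (B x - a) = |B.det|⁻¹ * ∫ y, g y := by
  have h1 := (measurableEmbedding_of_det_ne_zero hB).integral_map (μ := volume)
    (fun y => g (y - a))
  rw [← h1, map_volume_of_det_ne_zero hB, integral_smul_measure,
    ENNReal.toReal_ofReal (abs_nonneg _),
    integral_sub_right_eq_self (fun y => g y), abs_inv, smul_eq_mul]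

lemma integrable_comp_affine {B : EuclideanSpace ℝ (Fin k) →L[ℝ] EuclideanSpace ℝ (Fin k)}
    (hB : B.det ≠ 0) (a : EuclideanSpace ℝ (Fin k)) {g : EuclideanSpace ℝ (Fin k) → ℝ}
    (hg : Integrable g) : Integrable fun x => g (B x - a) := by
  refine ((measurableEmbedding_of_det_ne_zero hB).integrable_map_iff (μ := volume)
    (g := fun y => g (y - a))).1 ?_
  rw [map_volume_of_det_ne_zero hB]
  exact (hg.comp_sub_right a).smul_measure ENNReal.ofReal_ne_top

/-- Second moments of a rotation invariant weight are a multiple of the identity. -/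
lemma setIntegral_closedBall_coord_mul [NeZero k] {w : ℝ → ℝ} {ρ : ℝ}
    (hw : IntegrableOn (fun x : EuclideanSpace ℝ (Fin k) => w ‖x‖ * ‖x‖ ^ 2)
      (Metric.closedBall 0 ρ))
    (hm : Measurable fun x : EuclideanSpace ℝ (Fin k) => w ‖x‖) (i j : Fin k) :
    ∫ x in Metric.closedBall (0 : EuclideanSpace ℝ (Fin k)) ρ, w ‖x‖ * (x i * x j)
      = (if i = j then 1 else 0) * ((k : ℝ)⁻¹ *
        ∫ x in Metric.closedBall (0 : EuclideanSpace ℝ (Fin k)) ρ, w ‖x‖ * ‖x‖ ^ 2) := by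
  have hk : (k : ℝ) ≠ 0 := by exact_mod_cast NeZero.ne k
  have hball : ∀ U : EuclideanSpace ℝ (Fin k) ≃ₗᵢ[ℝ] EuclideanSpace ℝ (Fin k),
      U ⁻¹' Metric.closedBall (0 : EuclideanSpace ℝ (Fin k)) ρ = Metric.closedBall 0 ρ := fun U => by
    ext x; simp
  have hinv : ∀ (U : EuclideanSpace ℝ (Fin k) ≃ₗᵢ[ℝ] EuclideanSpace ℝ (Fin k))
      (g : EuclideanSpace ℝ (Fin k) → ℝ), ∫ x in Metric.closedBall 0 ρ, g (U x)
        = ∫ x in Metric.closedBall 0 ρ, g x := fun U g => by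
    have := U.measurePreserving.setIntegral_preimage_emb U.toHomeomorph.measurableEmbedding g
      (Metric.closedBall 0 ρ)
    rwa [hball U] at this
  have hint : ∀ i j, IntegrableOn (fun x : EuclideanSpace ℝ (Fin k) => w ‖x‖ * (x i * x j))
      (Metric.closedBall 0 ρ) := fun i j => by
    refine Integrable.mono hw (hm.mul (by fun_prop)).aestronglyMeasurable (.of_forall fun x => ?_)
    rw [norm_mul, norm_mul, norm_mul, norm_pow, norm_norm, sq]
    gcongr <;> exact PiLp.norm_apply_le x _
  by_cases hij : i = j
  · subst hij
    rw [if_pos rfl, one_mul, eq_inv_mul_iff_mul_eq₀ hk]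
    have hsame : ∀ l, ∫ x in Metric.closedBall (0 : EuclideanSpace ℝ (Fin k)) ρ, w ‖x‖ * (x l * x l)
        = ∫ x in Metric.closedBall (0 : EuclideanSpace ℝ (Fin k)) ρ, w ‖x‖ * (x i * x i) := fun l => by
      have := hinv (LinearIsometryEquiv.piLpCongrLeft 2 ℝ ℝ (Equiv.swap i l))
        (fun x => w ‖x‖ * (x i * x i))
      rw [← this]
      simp
    have h2 : ∀ x : EuclideanSpace ℝ (Fin k), w ‖x‖ * ‖x‖ ^ 2 = ∑ l, w ‖x‖ * (x l * x l) := fun x => by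
      rw [EuclideanSpace.real_norm_sq_eq, Finset.mul_sum]
      simp [sq]
    simp_rw [h2]
    rw [integral_finsetSum _ fun l _ => hint l l]
    simp [hsame]
  · rw [if_neg hij, zero_mul]
    -- reflect the `i`-th coordinate
    let U : EuclideanSpace ℝ (Fin k) ≃ₗᵢ[ℝ] EuclideanSpace ℝ (Fin k) :=
      LinearIsometryEquiv.piLpCongrRight 2 fun l =>
        if l = i then LinearIsometryEquiv.neg ℝ else LinearIsometryEquiv.refl ℝ ℝ
    have := hinv U (fun x => w ‖x‖ * (x i * x j))
    have h1 : ∀ x, U x i = - x i := fun x => by simp [U]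
    have h2 : ∀ x, U x j = x j := fun x => by simp [U, Ne.symm hij]
    simp only [LinearIsometryEquiv.norm_map, h1, h2] at this
    simp only [neg_mul, mul_neg, integral_neg] at this
    linarith

lemma volume_real_closedBall [NeZero k] {ρ : ℝ} (hρ : 0 ≤ ρ) :
    (volume : Measure (EuclideanSpace ℝ (Fin k))).real (Metric.closedBall 0 ρ)
      = sphereArea k * ρ ^ k / k := by
  have hk : (k : ℝ) ≠ 0 := by exact_mod_cast NeZero.ne k
  have := setIntegral_closedBall_radial (k := k) (fun _ => 1) hρ
  have h1 : k - 1 + 1 = k := Nat.sub_add_cancel (Nat.one_le_iff_ne_zero.2 (NeZero.ne k))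
  have h2 : ((k - 1 : ℕ) : ℝ) + 1 = k := by exact_mod_cast h1
  simp only [integral_const, one_mul, integral_pow, h1, h2, smul_eq_mul, mul_one,
    measureReal_restrict_apply_univ] at this
  rw [this, zero_pow (NeZero.ne k)]; ring

lemma setIntegral_closedBall_coord_mul_one [NeZero k] {ρ : ℝ} (hρ : 0 ≤ ρ) (i j : Fin k) :
    ∫ x in Metric.closedBall (0 : EuclideanSpace ℝ (Fin k)) ρ, x i * x j
      = (if i = j then 1 else 0) * (sphereArea k * ρ ^ (k + 2) / (k * (k + 2))) := by
  have hk : (k : ℝ) ≠ 0 := by exact_mod_cast NeZero.ne k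
  have h := setIntegral_closedBall_coord_mul (k := k) (w := fun _ => 1) (ρ := ρ)
    ((by fun_prop : Continuous fun x : EuclideanSpace ℝ (Fin k) => (1 : ℝ) * ‖x‖ ^ 2).continuousOn.integrableOn_compact
      (isCompact_closedBall _ _)) measurable_const i j
  have h1 := setIntegral_closedBall_radial (k := k) (fun s => s ^ 2) hρ
  have h2 : 2 + (k - 1) = k + 1 := by have := Nat.one_le_iff_ne_zero.2 (NeZero.ne k); omega
  simp only [← pow_add, h2, integral_pow] at h1
  simp only [one_mul] at h
  rw [h, h1]
  congr 1
  push_cast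
  rw [zero_pow (by omega)]
  field_simp
  ring

/-- The standing assumptions: `P` has the density `h(‖x‖²)`, where `h` is nonincreasing,
continuous at `r²` and not constant below `r²`, and the centred ball of radius `r` has mass
`γ`. -/
structure RadialModel (k : ℕ) (γ : ℝ) (h : ℝ → ℝ) (P : Measure (EuclideanSpace ℝ (Fin k)))
    (r : ℝ) : Prop where
  γ_pos : 0 < γ
  γ_lt_one : γ < 1
  h_nonneg : ∀ t, 0 ≤ t → 0 ≤ h t
  h_anti : AntitoneOn h (Set.Ici 0)
  hP : P = (volume : Measure (EuclideanSpace ℝ (Fin k))).withDensity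
    (fun x => ENNReal.ofReal (h (‖x‖ ^ 2)))
  r_pos : 0 < r
  mass : radialMass k h r = γ
  h_cont : ContinuousAt h (r ^ 2)
  h_nonconst : ∃ s ∈ Set.Ioo 0 (r ^ 2), ∃ t ∈ Set.Ioo 0 (r ^ 2), h s ≠ h t

namespace RadialModel

variable {γ r : ℝ} {h : ℝ → ℝ} {P : Measure (EuclideanSpace ℝ (Fin k))}

lemma h_le (hm : RadialModel k γ h P r) {a b : ℝ} (ha : 0 ≤ a) (hab : a ≤ b) : h b ≤ h a :=
  hm.h_anti ha (ha.trans hab) hab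

lemma measurable_density (hm : RadialModel k γ h P r) :
    Measurable fun x : EuclideanSpace ℝ (Fin k) => h (‖x‖ ^ 2) := by
  have h1 : Antitone fun t : ℝ => h (max t 0) := fun a b hab =>
    hm.h_le (le_max_right _ _) (max_le_max hab le_rfl)
  have h2 := h1.measurable.comp (by fun_prop : Measurable fun x : EuclideanSpace ℝ (Fin k) => ‖x‖ ^ 2)
  convert h2 using 2 with x
  simp only [Function.comp_apply]
  rw [max_eq_left (sq_nonneg _)]

lemma density_nonneg (hm : RadialModel k γ h P r) (x : EuclideanSpace ℝ (Fin k)) :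
    0 ≤ h (‖x‖ ^ 2) := hm.h_nonneg _ (sq_nonneg _)

lemma density_le (hm : RadialModel k γ h P r) (x : EuclideanSpace ℝ (Fin k)) :
    h (‖x‖ ^ 2) ≤ h 0 := hm.h_le le_rfl (sq_nonneg _)

lemma absolutelyContinuous (hm : RadialModel k γ h P r) : P ≪ volume := by
  rw [hm.hP]; exact withDensity_absolutelyContinuous _ _

lemma integral_eq (hm : RadialModel k γ h P r) (g : EuclideanSpace ℝ (Fin k) → ℝ) :
    ∫ x, g x ∂P = ∫ x, h (‖x‖ ^ 2) * g x := by
  rw [hm.hP, integral_withDensity_eq_integral_toReal_smul hm.measurable_density.ennreal_ofReal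
    (by simp)]
  simp_rw [ENNReal.toReal_ofReal (hm.density_nonneg _), smul_eq_mul]

lemma setIntegral_eq (hm : RadialModel k γ h P r) {S : Set (EuclideanSpace ℝ (Fin k))}
    (hS : MeasurableSet S) (g : EuclideanSpace ℝ (Fin k) → ℝ) :
    ∫ x in S, g x ∂P = ∫ x in S, h (‖x‖ ^ 2) * g x := by
  rw [hm.hP, setIntegral_withDensity_eq_setIntegral_toReal_smul
    hm.measurable_density.ennreal_ofReal (by simp) _ hS]
  simp_rw [ENNReal.toReal_ofReal (hm.density_nonneg _), smul_eq_mul]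

lemma measureReal_eq (hm : RadialModel k γ h P r) {S : Set (EuclideanSpace ℝ (Fin k))}
    (hS : MeasurableSet S) : P.real S = ∫ x in S, h (‖x‖ ^ 2) := by
  have := hm.setIntegral_eq hS (fun _ => 1)
  simpa using this

lemma measureReal_closedBall [NeZero k] (hm : RadialModel k γ h P r) {ρ : ℝ} (hρ : 0 ≤ ρ) :
    P.real (Metric.closedBall 0 ρ) = radialMass k h ρ := by
  rw [hm.measureReal_eq Metric.isClosed_closedBall.measurableSet,
    setIntegral_closedBall_radial (fun s => h (s ^ 2)) hρ, radialMass]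

lemma measureReal_closedBall_r [NeZero k] (hm : RadialModel k γ h P r) :
    P.real (Metric.closedBall 0 r) = γ := by
  rw [hm.measureReal_closedBall hm.r_pos.le, hm.mass]

lemma intervalIntegrable (hm : RadialModel k γ h P r) (p : ℕ) {a b : ℝ} (ha : 0 ≤ a)
    (hb : 0 ≤ b) : IntervalIntegrable (fun s => h (s ^ 2) * s ^ p) volume a b := by
  refine IntervalIntegrable.mul_continuousOn (AntitoneOn.intervalIntegrable fun s hs t ht hst => ?_)
    (by fun_prop)
  have hs0 : 0 ≤ s := (le_min ha hb).trans hs.1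
  exact hm.h_le (sq_nonneg _) (by gcongr)

/-- The density at the boundary of the ball of mass `γ < 1` is positive. -/
lemma h_r_pos [NeZero k] [IsProbabilityMeasure P] (hm : RadialModel k γ h P r) :
    0 < h (r ^ 2) := by
  refine lt_of_le_of_ne (hm.h_nonneg _ (sq_nonneg _)) fun h0 => ?_
  have h1 : P.real (Metric.closedBall (0 : EuclideanSpace ℝ (Fin k)) r)ᶜ = 0 := by
    rw [hm.measureReal_eq Metric.isClosed_closedBall.measurableSet.compl]
    refine setIntegral_eq_zero_of_forall_eq_zero fun x hx => ?_
    have hx' : r < ‖x‖ := by simpa using hx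
    have := hm.r_pos
    refine le_antisymm ?_ (hm.density_nonneg x)
    rw [h0]
    exact hm.h_le (sq_nonneg _) (by gcongr)
  rw [probReal_compl_eq_one_sub Metric.isClosed_closedBall.measurableSet,
    hm.measureReal_closedBall_r] at h1
  linarith [hm.γ_lt_one]

lemma radialMass_lt [NeZero k] (hm : RadialModel k γ h P r) {a b : ℝ} (ha : 0 ≤ a) (hab : a < b)
    (hb : 0 < h (b ^ 2)) : radialMass k h a < radialMass k h b := by
  have h1 := intervalIntegral.integral_add_adjacent_intervals
    (hm.intervalIntegrable (k - 1) le_rfl ha) (hm.intervalIntegrable (k - 1) ha (ha.trans hab.le))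
  have h2 : 0 < ∫ s in a..b, h (s ^ 2) * s ^ (k - 1) := by
    refine intervalIntegral.intervalIntegral_pos_of_pos_on
      (hm.intervalIntegrable (k - 1) ha (ha.trans hab.le)) (fun s hs => ?_) hab
    have hs0 : 0 < s := ha.trans_lt hs.1
    refine mul_pos (hb.trans_le ?_) (by positivity)
    exact hm.h_le (sq_nonneg _) (by have := hs.2.le; gcongr)
  unfold radialMass
  rw [← h1]
  exact mul_lt_mul_of_pos_left (by linarith) sphereArea_pos

lemma measureReal_closedBall_lt [NeZero k] [IsProbabilityMeasure P] (hm : RadialModel k γ h P r)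
    {ρ : ℝ} (hρ0 : 0 ≤ ρ) (hρ : ρ < r) : P.real (Metric.closedBall 0 ρ) < γ := by
  rw [hm.measureReal_closedBall hρ0, ← hm.mass]
  exact hm.radialMass_lt hρ0 hρ hm.h_r_pos

lemma lt_measureReal_closedBall [NeZero k] [IsProbabilityMeasure P] (hm : RadialModel k γ h P r)
    {ρ : ℝ} (hρ : r < ρ) : γ < P.real (Metric.closedBall 0 ρ) := by
  have hc : Tendsto (fun s : ℝ => h (s ^ 2)) (𝓝[>] r) (𝓝 (h (r ^ 2))) :=
    (hm.h_cont.tendsto.comp ((continuous_pow 2).tendsto r)).mono_left nhdsWithin_le_nhds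
  obtain ⟨s, hs, hs'⟩ := ((hc.eventually_const_lt hm.h_r_pos).and
    (Ioo_mem_nhdsGT hρ)).exists
  refine lt_of_lt_of_le ?_ (measureReal_mono (Metric.closedBall_subset_closedBall hs'.2.le))
  rw [hm.measureReal_closedBall (hm.r_pos.le.trans hs'.1.le)]
  nth_rw 1 [← hm.mass]
  exact hm.radialMass_lt hm.r_pos.le hs'.1 hs

/-- A threshold `v ∈ (0, r²)` at which `h` actually decreases. -/
lemma exists_threshold (hm : RadialModel k γ h P r) :
    ∃ v y : ℝ, 0 < v ∧ v < r ^ 2 ∧ (∀ s, 0 ≤ s → s < v → y ≤ h s) ∧ ∀ q, v < q → h q < y := by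
  obtain ⟨s₁, hs₁, s₂, hs₂, hlt, hh⟩ : ∃ s₁ ∈ Set.Ioo 0 (r ^ 2), ∃ s₂ ∈ Set.Ioo 0 (r ^ 2),
      s₁ < s₂ ∧ h s₂ < h s₁ := by
    obtain ⟨s, hs, t, ht, hst⟩ := hm.h_nonconst
    rcases lt_trichotomy s t with hlt | heq | hlt
    · exact ⟨s, hs, t, ht, hlt, lt_of_le_of_ne (hm.h_le hs.1.le hlt.le) (Ne.symm hst)⟩
    · exact absurd (congrArg h heq) hst
    · exact ⟨t, ht, s, hs, hlt, lt_of_le_of_ne (hm.h_le ht.1.le hlt.le) hst⟩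
  set S := {s ∈ Set.Icc s₁ s₂ | h s₁ ≤ h s} with hS
  have hne : S.Nonempty := ⟨s₁, ⟨le_rfl, hlt.le⟩, le_rfl⟩
  have hbdd : BddAbove S := ⟨s₂, fun s hs => hs.1.2⟩
  have h1 : s₁ ≤ sSup S := le_csSup hbdd ⟨⟨le_rfl, hlt.le⟩, le_rfl⟩
  have h2 : sSup S ≤ s₂ := csSup_le hne fun s hs => hs.1.2
  refine ⟨sSup S, h s₁, hs₁.1.trans_le h1, h2.trans_lt hs₂.2, fun s hs0 hs => ?_, fun q hq => ?_⟩
  · obtain ⟨u, hu, hsu⟩ := exists_lt_of_lt_csSup hne hs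
    exact hu.2.trans (hm.h_le hs0 hsu.le)
  · by_contra! hcon
    by_cases hq2 : q ≤ s₂
    · exact absurd (le_csSup hbdd ⟨⟨h1.trans hq.le, hq2⟩, hcon⟩) (not_le.2 hq)
    · push Not at hq2
      have := hm.h_le hs₂.1.le hq2.le
      linarith

/-- The moments of `h` on `[0, r]` strictly exceed those of the constant `h(r²)`. -/
lemma lt_integral_mul_pow (hm : RadialModel k γ h P r) (p : ℕ) :
    h (r ^ 2) * r ^ (p + 1) / (p + 1) < ∫ s in (0 : ℝ)..r, h (s ^ 2) * s ^ p := by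
  obtain ⟨v, y, hv0, hvr, hy1, hy2⟩ := hm.exists_threshold
  have hr := hm.r_pos
  have hc : ∫ s in (0 : ℝ)..r, h (r ^ 2) * s ^ p = h (r ^ 2) * r ^ (p + 1) / (p + 1) := by
    rw [intervalIntegral.integral_const_mul, integral_pow]
    simp; ring
  set c := Real.sqrt v with hcv
  have hc0 : 0 < c := Real.sqrt_pos.2 hv0
  have hcr : c < r := by rw [hcv, Real.sqrt_lt' hr]; exact hvr
  have hint : ∀ a b : ℝ, IntervalIntegrable (fun s : ℝ => h (r ^ 2) * s ^ p) volume a b :=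
    fun a b => Continuous.intervalIntegrable (by fun_prop) _ _
  rw [← hc, ← sub_pos, ← intervalIntegral.integral_sub (hm.intervalIntegrable p le_rfl hr.le)
    (hint _ _)]
  have hint' : ∀ a b : ℝ, 0 ≤ a → 0 ≤ b → IntervalIntegrable
      (fun s : ℝ => h (s ^ 2) * s ^ p - h (r ^ 2) * s ^ p) volume a b := fun a b ha hb =>
    (hm.intervalIntegrable p ha hb).sub (hint _ _)
  rw [← intervalIntegral.integral_add_adjacent_intervals (hint' 0 c le_rfl hc0.le)
    (hint' c r hc0.le hr.le)]
  refine add_pos_of_pos_of_nonneg ?_ ?_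
  · refine intervalIntegral.intervalIntegral_pos_of_pos_on (hint' 0 c le_rfl hc0.le)
      (fun s hs => ?_) hc0
    have hs0 : 0 < s := hs.1
    have h1 : s ^ 2 < v := by
      have := hs.2
      rwa [hcv, Real.lt_sqrt hs0.le] at this
    have h2 := hy1 (s ^ 2) (sq_nonneg _) h1
    have h3 := hy2 (r ^ 2) hvr
    have : 0 < s ^ p := by positivity
    nlinarith
  · refine intervalIntegral.integral_nonneg hcr.le fun s hs => ?_
    have hs0 : 0 ≤ s := hc0.le.trans hs.1
    have h1 : h (r ^ 2) ≤ h (s ^ 2) :=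
      hm.h_le (sq_nonneg _) (by have := hs.2; gcongr)
    have : 0 ≤ s ^ p := by positivity
    nlinarith

/-- Nonsingularity of the linearized location equation. -/
lemma lt_mass [NeZero k] (hm : RadialModel k γ h P r) :
    h (r ^ 2) * (sphereArea k * r ^ k / k) < γ := by
  have h1 : k - 1 + 1 = k := Nat.sub_add_cancel (Nat.one_le_iff_ne_zero.2 (NeZero.ne k))
  have h2 : ((k - 1 : ℕ) : ℝ) + 1 = k := by exact_mod_cast h1
  have h3 := hm.lt_integral_mul_pow (k - 1)
  rw [h1, h2] at h3
  rw [← hm.mass, radialMass]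
  calc h (r ^ 2) * (sphereArea k * r ^ k / k) = sphereArea k * (h (r ^ 2) * r ^ k / k) := by ring
    _ < _ := mul_lt_mul_of_pos_left h3 sphereArea_pos

lemma moment_pos [NeZero k] [IsProbabilityMeasure P] (hm : RadialModel k γ h P r) :
    0 < ∫ s in (0 : ℝ)..r, h (s ^ 2) * s ^ (k + 1) := by
  refine lt_of_le_of_lt ?_ (hm.lt_integral_mul_pow (k + 1))
  have := hm.h_r_pos
  have := hm.r_pos
  positivity

lemma alpha_pos [NeZero k] [IsProbabilityMeasure P] (hm : RadialModel k γ h P r) :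
    0 < alpha k γ r h := by
  have hk : (0 : ℝ) < k := by exact_mod_cast Nat.pos_of_ne_zero (NeZero.ne k)
  have := hm.γ_pos
  have := sphereArea_pos (k := k)
  exact Real.sqrt_pos.2 (mul_pos (by positivity) hm.moment_pos)

lemma alpha_sq [NeZero k] [IsProbabilityMeasure P] (hm : RadialModel k γ h P r) :
    γ * k * alpha k γ r h ^ 2 = sphereArea k * ∫ s in (0 : ℝ)..r, h (s ^ 2) * s ^ (k + 1) := by
  have hk : (0 : ℝ) < k := by exact_mod_cast Nat.pos_of_ne_zero (NeZero.ne k)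
  have := hm.γ_pos
  have := sphereArea_pos (k := k)
  rw [alpha, Real.sq_sqrt (mul_pos (by positivity) hm.moment_pos).le]
  field_simp

/-- Nonsingularity of the linearized covariance equation. -/
lemma lt_alpha_sq [NeZero k] [IsProbabilityMeasure P] (hm : RadialModel k γ h P r) :
    h (r ^ 2) * (sphereArea k * r ^ (k + 2) / (k * (k + 2))) < γ * alpha k γ r h ^ 2 := by
  have hk : (0 : ℝ) < k := by exact_mod_cast Nat.pos_of_ne_zero (NeZero.ne k)
  have h3 := hm.lt_integral_mul_pow (k + 1)
  have h4 := mul_lt_mul_of_pos_left h3 (sphereArea_pos (k := k))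
  rw [← hm.alpha_sq] at h4
  push_cast at h4
  refine lt_of_mul_lt_mul_left (a := (k : ℝ)) ?_ hk.le
  refine lt_of_eq_of_lt ?_ (h4.trans_eq (by ring))
  field_simp
  ring

lemma setIntegral_norm_sq [NeZero k] [IsProbabilityMeasure P] (hm : RadialModel k γ h P r) :
    ∫ x in Metric.closedBall 0 r, ‖x‖ ^ 2 ∂P = γ * k * alpha k γ r h ^ 2 := by
  rw [hm.setIntegral_eq Metric.isClosed_closedBall.measurableSet,
    setIntegral_closedBall_radial (fun s => h (s ^ 2) * s ^ 2) hm.r_pos.le, hm.alpha_sq]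
  congr 2; ext s
  have h1 : k + 1 = 2 + (k - 1) := by
    have := Nat.one_le_iff_ne_zero.2 (NeZero.ne k); omega
  rw [h1, pow_add]; ring

lemma setIntegral_coord_mul [NeZero k] [IsProbabilityMeasure P] (hm : RadialModel k γ h P r)
    (i j : Fin k) : ∫ x in Metric.closedBall 0 r, x i * x j ∂P
      = (if i = j then 1 else 0) * (γ * alpha k γ r h ^ 2) := by
  have hk : (k : ℝ) ≠ 0 := by exact_mod_cast NeZero.ne k
  rw [hm.setIntegral_eq Metric.isClosed_closedBall.measurableSet,
    setIntegral_closedBall_coord_mul (w := fun s => h (s ^ 2)) _ hm.measurable_density,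
    ← hm.setIntegral_eq Metric.isClosed_closedBall.measurableSet, hm.setIntegral_norm_sq]
  · field_simp
  · have h1 : IntegrableOn (fun x : EuclideanSpace ℝ (Fin k) => h 0 * ‖x‖ ^ 2)
        (Metric.closedBall 0 r) := (by fun_prop : Continuous fun x : EuclideanSpace ℝ (Fin k) =>
          h 0 * ‖x‖ ^ 2).continuousOn.integrableOn_compact (isCompact_closedBall _ _)
    refine Integrable.mono' h1 (hm.measurable_density.mul (by fun_prop)).aestronglyMeasurable
      (.of_forall fun x => ?_)
    rw [Real.norm_eq_abs, abs_of_nonneg (mul_nonneg (hm.density_nonneg x) (sq_nonneg _))]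
    exact mul_le_mul_of_nonneg_right (hm.density_le x) (sq_nonneg _)

lemma setIntegral_coord [NeZero k] (hm : RadialModel k γ h P r) (i : Fin k) :
    ∫ x in Metric.closedBall 0 r, x i ∂P = 0 := by
  rw [hm.setIntegral_eq Metric.isClosed_closedBall.measurableSet]
  have := (LinearIsometryEquiv.neg ℝ (E := EuclideanSpace ℝ (Fin k))).measurePreserving.setIntegral_preimage_emb
    (LinearIsometryEquiv.neg ℝ (E := EuclideanSpace ℝ (Fin k))).toHomeomorph.measurableEmbedding
    (fun x => h (‖x‖ ^ 2) * x i) (Metric.closedBall 0 r)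
  have hb : (LinearIsometryEquiv.neg ℝ (E := EuclideanSpace ℝ (Fin k))) ⁻¹' Metric.closedBall 0 r
      = Metric.closedBall 0 r := by ext x; simp
  rw [hb] at this
  simp only [LinearIsometryEquiv.coe_neg, norm_neg, PiLp.neg_apply, mul_neg,
    integral_neg] at this
  linarith

end RadialModel

/-! ### Optimality of centred balls -/

lemma isHermitian_gram (B : EuclideanSpace ℝ (Fin k) →L[ℝ] EuclideanSpace ℝ (Fin k)) :
    (gram B).IsHermitian := by
  rw [gram, ← Matrix.conjTranspose_eq_transpose_of_trivial]
  exact Matrix.isHermitian_conjTranspose_mul_self _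

/-- A volume preserving expansive linear map is an isometry. -/
lemma gram_eq_one_of_norm_le {B : EuclideanSpace ℝ (Fin k) →L[ℝ] EuclideanSpace ℝ (Fin k)}
    (hdet : B.det ^ 2 = 1) (hB : ∀ x, ‖x‖ ≤ ‖B x‖) : gram B = 1 := by
  have hN := isHermitian_gram B
  have h1 : ∀ i, 1 ≤ hN.eigenvalues i := fun i => by
    have h2 := hN.eigenvalues_eq i
    have h3 := hB (hN.eigenvectorBasis i)
    rw [hN.eigenvectorBasis.norm_eq_one] at h3
    have h4 := norm_sq_apply_eq_gram B (hN.eigenvectorBasis i)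
    simp only [star_trivial, RCLike.re_to_real] at h2
    rw [h2, ← h4]
    exact one_le_pow₀ h3
  have h2 : ∏ i, hN.eigenvalues i = 1 := by
    have := hN.det_eq_prod_eigenvalues
    rw [det_gram, hdet] at this
    simpa using this.symm
  have h3 : ∀ i, hN.eigenvalues i = 1 := by
    intro i
    refine le_antisymm ?_ (h1 i)
    have h5 : 1 ≤ ∏ j ∈ Finset.univ.erase i, hN.eigenvalues j := by
      simpa using Finset.prod_le_prod (s := Finset.univ.erase i) (f := fun _ => (1 : ℝ))
        (fun _ _ => zero_le_one) fun j _ => h1 j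
    rw [← h2, ← Finset.mul_prod_erase Finset.univ _ (Finset.mem_univ i)]
    exact le_mul_of_one_le_right (zero_le_one.trans (h1 i)) h5
  have h4 := hN.spectral_theorem
  rw [show hN.eigenvalues = fun _ => 1 from funext h3] at h4
  rw [h4]
  simp

namespace RadialModel

variable {γ r : ℝ} {h : ℝ → ℝ} {P : Measure (EuclideanSpace ℝ (Fin k))}

/-- The primitive `Ψ(b) = ∫_{r² - b}^{r²} h`, a convex function of `b ∈ [0, r²]`. -/
noncomputable def primitive (h : ℝ → ℝ) (r b : ℝ) : ℝ := ∫ τ in (0 : ℝ)..b, h (r ^ 2 - τ)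

lemma intervalIntegrable_comp_sub (hm : RadialModel k γ h P r) {b c : ℝ} (hb : b ≤ r ^ 2)
    (hc : c ≤ r ^ 2) : IntervalIntegrable (fun τ => h (r ^ 2 - τ)) volume b c := by
  refine MonotoneOn.intervalIntegrable fun s hs t ht hst => ?_
  have ht' : t ≤ r ^ 2 := ht.2.trans (max_le hb hc)
  exact hm.h_le (by linarith) (by linarith)

lemma primitive_sub (hm : RadialModel k γ h P r) {b c : ℝ} (hb : b ≤ r ^ 2) (hc : c ≤ r ^ 2) :
    primitive h r b - primitive h r c = ∫ τ in c..b, h (r ^ 2 - τ) :=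
  intervalIntegral.integral_interval_sub_left
    (hm.intervalIntegrable_comp_sub (sq_nonneg _) hb)
    (hm.intervalIntegrable_comp_sub (sq_nonneg _) hc)

/-- The subgradient inequality for the convex function `Ψ`. -/
lemma mul_le_primitive_sub (hm : RadialModel k γ h P r) {b q : ℝ} (hb0 : 0 ≤ b)
    (hb : b ≤ r ^ 2) (hq : 0 ≤ q) :
    (b - max (r ^ 2 - q) 0) * h q
      ≤ primitive h r b - primitive h r (max (r ^ 2 - q) 0) := by
  set c := max (r ^ 2 - q) 0 with hc
  have hcr : c ≤ r ^ 2 := max_le (by linarith) (sq_nonneg _)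
  rw [hm.primitive_sub hb hcr]
  rcases le_total c b with hcb | hcb
  · have h1 : ∫ _ in c..b, h q = (b - c) * h q := by simp
    rw [← h1]
    refine intervalIntegral.integral_mono_on hcb (by simp)
      (hm.intervalIntegrable_comp_sub hcr hb) fun τ hτ => ?_
    have h2 : r ^ 2 - q ≤ c := le_max_left _ _
    exact hm.h_le (by linarith [hτ.2]) (by linarith [hτ.1])
  · rcases eq_or_lt_of_le hcb with heq | hlt
    · rw [heq]; simp
    · have hceq : c = r ^ 2 - q := by
        rcases max_choice (r ^ 2 - q) 0 with h1 | h1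
        · exact hc.trans h1
        · rw [← hc] at h1; linarith
      rw [intervalIntegral.integral_symm]
      have h1 : ∫ _ in b..c, h q = (c - b) * h q := by simp
      have h2 : ∫ τ in b..c, h (r ^ 2 - τ) ≤ ∫ _ in b..c, h q := by
        refine intervalIntegral.integral_mono_on hcb (hm.intervalIntegrable_comp_sub hb hcr)
          (by simp) fun τ hτ => ?_
        exact hm.h_le hq (by linarith [hτ.2])
      linarith

/-- Strictness of the subgradient inequality across the threshold of `h`. -/
lemma mul_lt_primitive_sub (hm : RadialModel k γ h P r) {v y p q : ℝ} (hvr : v < r ^ 2)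
    (hy1 : ∀ s, 0 ≤ s → s < v → y ≤ h s) (hy2 : ∀ q, v < q → h q < y)
    (hp0 : 0 ≤ p) (hpv : p < v) (hvq : v < q) :
    (r ^ 2 - p - max (r ^ 2 - q) 0) * h q
      < primitive h r (r ^ 2 - p) - primitive h r (max (r ^ 2 - q) 0) := by
  set c := max (r ^ 2 - q) 0 with hc
  set m := r ^ 2 - (p + v) / 2 with hmdef
  have hcr : c ≤ r ^ 2 := max_le (by linarith) (sq_nonneg _)
  have hcm : c < m := max_lt (by linarith) (by linarith)
  have hmr : m ≤ r ^ 2 := by linarith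
  have hbr : r ^ 2 - p ≤ r ^ 2 := by linarith
  rw [hm.primitive_sub hbr hcr, ← intervalIntegral.integral_add_adjacent_intervals
    (hm.intervalIntegrable_comp_sub hcr hmr) (hm.intervalIntegrable_comp_sub hmr hbr)]
  have h1 : (m - c) * h q ≤ ∫ τ in c..m, h (r ^ 2 - τ) := by
    have h1 : ∫ _ in c..m, h q = (m - c) * h q := by simp
    rw [← h1]
    refine intervalIntegral.integral_mono_on hcm.le (by simp)
      (hm.intervalIntegrable_comp_sub hcr hmr) fun τ hτ => ?_
    have h2 : r ^ 2 - q ≤ c := le_max_left _ _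
    exact hm.h_le (by linarith [hτ.2]) (by linarith [hτ.1])
  have h2 : (r ^ 2 - p - m) * y ≤ ∫ τ in m..(r ^ 2 - p), h (r ^ 2 - τ) := by
    have h1 : ∫ _ in m..(r ^ 2 - p), y = (r ^ 2 - p - m) * y := by simp
    rw [← h1]
    refine intervalIntegral.integral_mono_on (by linarith) (by simp)
      (hm.intervalIntegrable_comp_sub hmr hbr) fun τ hτ => ?_
    exact hy1 _ (by linarith [hτ.2]) (by linarith [hτ.1])
  nlinarith [hy2 q hvq]

lemma integrable_density [IsProbabilityMeasure P] (hm : RadialModel k γ h P r) :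
    Integrable fun x : EuclideanSpace ℝ (Fin k) => h (‖x‖ ^ 2) := by
  refine ⟨hm.measurable_density.aestronglyMeasurable, ?_⟩
  rw [hasFiniteIntegral_iff_ofReal (.of_forall hm.density_nonneg)]
  have h1 : P Set.univ = 1 := measure_univ
  rw [hm.hP, withDensity_apply _ MeasurableSet.univ, Measure.restrict_univ] at h1
  rw [h1]
  exact ENNReal.one_lt_top

lemma primitive_mono (hm : RadialModel k γ h P r) {b c : ℝ} (hbc : b ≤ c)
    (hc : c ≤ r ^ 2) : primitive h r b ≤ primitive h r c := by
  have := hm.primitive_sub hc (hbc.trans hc)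
  have h2 : 0 ≤ ∫ τ in b..c, h (r ^ 2 - τ) :=
    intervalIntegral.integral_nonneg hbc fun τ hτ => hm.h_nonneg _ (by linarith [hτ.2])
  linarith

lemma integrable_primitive (hm : RadialModel k γ h P r) :
    Integrable fun y : EuclideanSpace ℝ (Fin k) => primitive h r (max (r ^ 2 - ‖y‖ ^ 2) 0) := by
  have hle : ∀ y : EuclideanSpace ℝ (Fin k), max (r ^ 2 - ‖y‖ ^ 2) 0 ≤ r ^ 2 := fun y =>
    max_le (by linarith [sq_nonneg ‖y‖]) (sq_nonneg _)
  have hmono : Monotone fun b : ℝ => primitive h r (min b (r ^ 2)) := fun b c hbc =>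
    hm.primitive_mono (min_le_min_right _ hbc) (min_le_right _ _)
  have hmeas : Measurable fun y : EuclideanSpace ℝ (Fin k) =>
      primitive h r (max (r ^ 2 - ‖y‖ ^ 2) 0) := by
    have := hmono.measurable.comp (by fun_prop : Measurable fun y : EuclideanSpace ℝ (Fin k) =>
      max (r ^ 2 - ‖y‖ ^ 2) 0)
    convert this using 2 with y
    simp only [Function.comp_apply]
    rw [min_eq_left (hle y)]
  have h0 : primitive h r 0 = 0 := by simp [primitive]
  refine Integrable.mono' (g := (Metric.closedBall (0 : EuclideanSpace ℝ (Fin k)) r).indicator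
    fun _ => primitive h r (r ^ 2)) ?_ hmeas.aestronglyMeasurable (.of_forall fun y => ?_)
  · exact (integrable_indicator_iff Metric.isClosed_closedBall.measurableSet).2
      (integrableOn_const (measure_closedBall_lt_top.ne))
  · by_cases hy : ‖y‖ ≤ r
    · rw [Set.indicator_of_mem (by simpa using hy), Real.norm_eq_abs, abs_of_nonneg]
      · exact hm.primitive_mono (hle y) le_rfl
      · exact h0.ge.trans (hm.primitive_mono (le_max_right _ _) (hle y))
    · have h1 : max (r ^ 2 - ‖y‖ ^ 2) 0 = 0 := max_eq_right (by
        have := hm.r_pos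
        push Not at hy
        nlinarith)
      rw [Set.indicator_of_notMem (by simpa using hy), h1, h0, norm_zero]

/-- The gain `∫ (r² - ‖B x - a‖²)₊ dP`, the varying part of the dual value at the level `r²`. -/
noncomputable def gain (P : Measure (EuclideanSpace ℝ (Fin k))) (r : ℝ) (θ : AffineParam k) : ℝ :=
  ∫ x, max (r ^ 2 - ‖θ.2 x - θ.1‖ ^ 2) 0 ∂P

/-- Among volume preserving affine maps only isometries fixing the origin maximize the gain:
a rearrangement inequality with its equality case. -/
lemma gain_le_and_eq [NeZero k] [IsProbabilityMeasure P] (hm : RadialModel k γ h P r)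
    (θ : AffineParam k) (hdet : θ.2.det ^ 2 = 1) :
    gain P r θ ≤ gain P r (0, ContinuousLinearMap.id ℝ _) ∧
      (gain P r (0, ContinuousLinearMap.id ℝ _) ≤ gain P r θ → θ.1 = 0 ∧ gram θ.2 = 1) := by
  obtain ⟨a, B⟩ := θ
  simp only at hdet
  have hB0 : B.det ≠ 0 := fun h => by simp [h] at hdet
  have habs : |B.det| = 1 := by
    have := sq_eq_sq_iff_abs_eq_abs B.det 1
    simpa using this.1 (by simpa using hdet)
  set Ψ : EuclideanSpace ℝ (Fin k) → ℝ := fun y => primitive h r (max (r ^ 2 - ‖y‖ ^ 2) 0) with hΨ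
  set u : EuclideanSpace ℝ (Fin k) → ℝ := fun y => max (r ^ 2 - ‖y‖ ^ 2) 0 with hu
  have hu0 : ∀ y, 0 ≤ u y := fun y => le_max_right _ _
  have hur : ∀ y, u y ≤ r ^ 2 := fun y =>
    max_le (by linarith [sq_nonneg ‖y‖]) (sq_nonneg _)
  have hum : Measurable u := by fun_prop
  have hgain : ∀ θ : AffineParam k, gain P r θ = ∫ x, h (‖x‖ ^ 2) * u (θ.2 x - θ.1) := fun θ => by
    rw [gain, hm.integral_eq]
  have hint : ∀ θ : AffineParam k, Integrable fun x => h (‖x‖ ^ 2) * u (θ.2 x - θ.1) := fun θ => by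
    refine hm.integrable_density.mul_bdd (c := r ^ 2)
      (hum.comp (by fun_prop)).aestronglyMeasurable (.of_forall fun x => ?_)
    rw [Real.norm_eq_abs, abs_of_nonneg (hu0 _)]
    exact hur _
  have hΨint : Integrable Ψ := hm.integrable_primitive
  have hΨ1 : ∫ x, Ψ (B x - a) = ∫ x, Ψ x := by
    rw [integral_comp_affine hB0, habs, inv_one, one_mul]
  have hΨint' : Integrable fun x => Ψ (B x - a) :=
    integrable_comp_affine hB0 a hΨint
  set D : EuclideanSpace ℝ (Fin k) → ℝ := fun x =>
    Ψ (B x - a) - Ψ x - (h (‖x‖ ^ 2) * u (B x - a) - h (‖x‖ ^ 2) * u x) with hD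
  have hD0 : ∀ x, 0 ≤ D x := fun x => by
    have := hm.mul_le_primitive_sub (hu0 (B x - a)) (hur _) (sq_nonneg ‖x‖)
    simp only [hD, hΨ, hu] at this ⊢
    linarith
  have hDint : Integrable D :=
    (hΨint'.sub hΨint).sub ((hint (a, B)).sub (by simpa using hint (0, ContinuousLinearMap.id ℝ _)))
  have hDI : ∫ x, D x = gain P r (0, ContinuousLinearMap.id ℝ _) - gain P r (a, B) := by
    have hint0 := hint (0, ContinuousLinearMap.id ℝ _)
    have h1 := hgain (0, ContinuousLinearMap.id ℝ _)
    simp only [ContinuousLinearMap.id_apply, sub_zero] at hint0 h1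
    have hintB : Integrable fun x => h (‖x‖ ^ 2) * u (B x - a) := hint (a, B)
    have e1 : ∫ x, D x = (∫ x, Ψ (B x - a) - Ψ x) -
        ∫ x, (h (‖x‖ ^ 2) * u (B x - a) - h (‖x‖ ^ 2) * u x) :=
      integral_sub (hΨint'.sub hΨint) (hintB.sub hint0)
    rw [h1, hgain, e1, integral_sub hintB hint0, integral_sub hΨint' hΨint, hΨ1]
    ring
  refine ⟨by linarith [integral_nonneg (μ := volume) (f := D) fun x => hD0 x], fun hge => ?_⟩
  have hDzero : D =ᵐ[volume] 0 := by
    rw [← integral_eq_zero_iff_of_nonneg (fun x => hD0 x) hDint]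
    exact le_antisymm (by linarith) (integral_nonneg fun x => hD0 x)
  obtain ⟨v, y, hv0, hvr, hy1, hy2⟩ := hm.exists_threshold
  have hempty : {x | ‖B x - a‖ ^ 2 < v} ∩ {x | v < ‖x‖ ^ 2} = ∅ := by
    have hopen : IsOpen ({x | ‖B x - a‖ ^ 2 < v} ∩ {x | v < ‖x‖ ^ 2}) :=
      (isOpen_lt (by fun_prop) continuous_const).inter (isOpen_lt continuous_const (by fun_prop))
    rw [← hopen.measure_eq_zero_iff volume]
    refine measure_mono_null (fun x hx => ?_) (ae_iff.1 hDzero)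
    have h1 : ‖B x - a‖ ^ 2 < v := hx.1
    have h2 : v < ‖x‖ ^ 2 := hx.2
    have h3 := hm.mul_lt_primitive_sub hvr hy1 hy2 (sq_nonneg ‖B x - a‖) h1 h2
    have h4 : max (r ^ 2 - ‖B x - a‖ ^ 2) 0 = r ^ 2 - ‖B x - a‖ ^ 2 :=
      max_eq_left (by linarith)
    refine ne_of_gt ?_
    simp only [hD, hΨ, hu, h4, Pi.zero_apply]
    linarith
  have himp : ∀ x, ‖B x - a‖ ^ 2 < v → ‖x‖ ^ 2 ≤ v := fun x hx => by
    by_contra! hlt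
    exact Set.notMem_empty x (hempty ▸ ⟨hx, hlt⟩)
  -- So the ellipsoid `‖B x - a‖² < v` is contained in the centred ball of the same volume.
  set σ := Real.sqrt v with hσ
  have hσ0 : 0 < σ := Real.sqrt_pos.2 hv0
  have himp' : ∀ x, ‖B x - a‖ < σ → ‖x‖ ≤ σ := fun x hx =>
    Real.le_sqrt_of_sq_le (himp x ((Real.lt_sqrt (norm_nonneg _)).1 hx))
  let e := B.toContinuousLinearEquivOfDetNeZero hB0
  have he : ∀ z, B (e.symm z) = z := fun z => e.apply_symm_apply z
  have hball : ∀ z, ‖B z‖ < σ → ‖z‖ ≤ σ := fun z hz => by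
    have h1 := himp' (e.symm a + z) (by rw [map_add, he]; simpa using hz)
    have h2 := himp' (e.symm a - z) (by rw [map_sub, he]; simpa using hz)
    have h3 : (2 : ℝ) • z = (e.symm a + z) - (e.symm a - z) := by rw [two_smul]; abel
    have h4 := norm_sub_le (e.symm a + z) (e.symm a - z)
    rw [← h3, norm_smul] at h4
    norm_num at h4
    linarith
  have hexp : ∀ z, ‖z‖ ≤ ‖B z‖ := fun z => by
    by_contra! hlt
    have hz0 : 0 < ‖z‖ := (norm_nonneg _).trans_lt hlt
    set c := (‖B z‖ + ‖z‖) / 2 with hc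
    have hc0 : 0 < c := by have := norm_nonneg (B z); positivity
    have h1 := hball ((σ / c) • z) (by
      rw [map_smul, norm_smul, Real.norm_eq_abs, abs_of_pos (by positivity), div_mul_eq_mul_div,
        div_lt_iff₀ hc0]
      exact mul_lt_mul_of_pos_left (by linarith) hσ0)
    rw [norm_smul, Real.norm_eq_abs, abs_of_pos (by positivity), div_mul_eq_mul_div,
      div_le_iff₀ hc0] at h1
    have := le_of_mul_le_mul_left h1 hσ0
    linarith
  have hgram := gram_eq_one_of_norm_le hdet hexp
  refine ⟨?_, hgram⟩
  have hiso : ∀ z, ‖B z‖ = ‖z‖ := fun z => by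
    have := norm_sq_apply_eq_gram B z
    rw [hgram, Matrix.one_mulVec] at this
    have h2 : z.ofLp ⬝ᵥ z.ofLp = ‖z‖ ^ 2 := by
      rw [EuclideanSpace.real_norm_sq_eq]; simp [dotProduct, sq]
    rw [h2] at this
    exact (pow_left_inj₀ (norm_nonneg _) (norm_nonneg _) two_ne_zero).1 this
  by_contra ha
  simp only at ha
  have ha0 : 0 < ‖a‖ := norm_pos_iff.2 ha
  -- push the centre outwards by almost `σ`
  obtain ⟨t, ht1, ht2⟩ := exists_between (show max 0 (σ - ‖a‖) < σ from
    max_lt hσ0 (by linarith))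
  have ht0 : 0 < t := (le_max_left _ _).trans_lt ht1
  have h1 := himp' (e.symm (a + (t / ‖a‖) • a)) (by
    rw [he, add_sub_cancel_left, norm_smul, norm_div, norm_norm, div_mul_cancel₀ _ ha0.ne',
      Real.norm_eq_abs, abs_of_pos ht0]
    exact ht2)
  rw [← hiso, he] at h1
  have h2 : a + (t / ‖a‖) • a = (1 + t / ‖a‖) • a := by rw [add_smul, one_smul]
  rw [h2, norm_smul, Real.norm_eq_abs, abs_of_pos (by positivity), add_mul,
    div_mul_cancel₀ _ ha0.ne'] at h1
  linarith [le_max_right 0 (σ - ‖a‖)]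

end RadialModel

/-! ### Contaminated measures -/

section Contaminate

variable {P : Measure (EuclideanSpace ℝ (Fin k))} {x : EuclideanSpace ℝ (Fin k)} {ε : ℝ}

lemma contaminate_zero : contaminate P x 0 = P := by simp [contaminate]

lemma integral_contaminate (h0 : 0 ≤ ε) (h1 : ε ≤ 1) {g : EuclideanSpace ℝ (Fin k) → ℝ}
    (hg : Integrable g P) :
    ∫ y, g y ∂(contaminate P x ε) = (1 - ε) * ∫ y, g y ∂P + ε * g x := by
  rw [contaminate, integral_add_measure (hg.smul_measure ENNReal.ofReal_ne_top)
    ((integrable_dirac (by simp)).smul_measure ENNReal.ofReal_ne_top), integral_smul_measure,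
    integral_smul_measure, integral_dirac, ENNReal.toReal_ofReal (by linarith),
    ENNReal.toReal_ofReal h0, smul_eq_mul, smul_eq_mul]

lemma ae_of_ae_contaminate (h1 : ε < 1) {p : EuclideanSpace ℝ (Fin k) → Prop}
    (hp : ∀ᵐ y ∂(contaminate P x ε), p y) : (∀ᵐ y ∂P, p y) ∧ (0 < ε → p x) := by
  rw [contaminate, ae_add_measure_iff] at hp
  simp only [ae_iff, Measure.smul_apply, smul_eq_mul, mul_eq_zero] at hp
  refine ⟨ae_iff.2 (hp.1.resolve_left (by simpa using h1)), fun h0 => ?_⟩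
  have : ∀ᵐ y ∂(Measure.dirac x), p y := ae_iff.2 (hp.2.resolve_left (by simpa using h0))
  rwa [ae_dirac_eq] at this

variable [IsProbabilityMeasure P]

lemma isProbabilityMeasure_contaminate (h0 : 0 ≤ ε) (h1 : ε ≤ 1) :
    IsProbabilityMeasure (contaminate P x ε) := by
  refine ⟨?_⟩
  simp only [contaminate, Measure.coe_add, Measure.coe_smul, Pi.add_apply, Pi.smul_apply,
    measure_univ, smul_eq_mul, mul_one]
  rw [← ENNReal.ofReal_add (by linarith) h0]
  simp

lemma measureReal_contaminate (h0 : 0 ≤ ε) (h1 : ε ≤ 1) {S : Set (EuclideanSpace ℝ (Fin k))}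
    (hS : MeasurableSet S) :
    (contaminate P x ε).real S = (1 - ε) * P.real S + ε * S.indicator 1 x := by
  have := integral_contaminate (P := P) (x := x) h0 h1
    (((integrable_const (1 : ℝ)).indicator hS : Integrable (S.indicator fun _ => (1 : ℝ)) P))
  have := isProbabilityMeasure_contaminate (P := P) (x := x) h0 h1
  rw [← integral_indicator_one hS, ← integral_indicator_one hS]
  assumption

lemma measureReal_contaminate_le (h0 : 0 ≤ ε) (h1 : ε ≤ 1)
    {S : Set (EuclideanSpace ℝ (Fin k))} (hS : MeasurableSet S) :
    (contaminate P x ε).real S ≤ P.real S + ε := by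
  rw [measureReal_contaminate h0 h1 hS]
  have h2 : S.indicator (1 : EuclideanSpace ℝ (Fin k) → ℝ) x ≤ 1 :=
    Set.indicator_le_self' (fun _ _ => zero_le_one) x
  have h3 : 0 ≤ P.real S := measureReal_nonneg
  nlinarith

lemma measureReal_contaminate_lt {γ : ℝ} (hP : P ≪ volume) (h0 : 0 ≤ ε) (h1 : ε ≤ 1)
    (hε : ε < γ) (N : Set (EuclideanSpace ℝ (Fin k))) (hN : MeasurableSet N)
    (hN0 : volume N = 0) : (contaminate P x ε).real N < γ := by
  have := measureReal_contaminate_le (P := P) (x := x) h0 h1 hN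
  rw [measureReal_def P, hP hN0] at this
  simp at this
  linarith

end Contaminate

/-! ### Consistency -/

lemma continuous_toEuclideanCLM_symm :
    Continuous fun B : EuclideanSpace ℝ (Fin k) →L[ℝ] EuclideanSpace ℝ (Fin k) =>
      (Matrix.toEuclideanCLM (𝕜 := ℝ) (n := Fin k)).symm B :=
  LinearMap.continuous_of_finiteDimensional
    ((Matrix.toEuclideanCLM (𝕜 := ℝ) (n := Fin k)).symm.toAlgEquiv.toLinearMap)

lemma continuous_gram : Continuous (gram (k := k)) :=
  (continuous_toEuclideanCLM_symm.matrix_transpose).matrix_mul continuous_toEuclideanCLM_symm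

namespace RadialModel

variable {γ r : ℝ} {h : ℝ → ℝ} {P : Measure (EuclideanSpace ℝ (Fin k))}

lemma continuous_gain [IsProbabilityMeasure P] : Continuous (gain P r) :=
  continuous_integral_posPart P (r ^ 2)

lemma gain_id [NeZero k] [IsProbabilityMeasure P] (hm : RadialModel k γ h P r) :
    gain P r (0, ContinuousLinearMap.id ℝ _) = γ * (r ^ 2 - k * alpha k γ r h ^ 2) := by
  have hr := hm.r_pos
  have hb : MeasurableSet (Metric.closedBall (0 : EuclideanSpace ℝ (Fin k)) r) :=
    Metric.isClosed_closedBall.measurableSet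
  have h1 : ∀ x : EuclideanSpace ℝ (Fin k), max (r ^ 2 - ‖x‖ ^ 2) 0
      = (Metric.closedBall (0 : EuclideanSpace ℝ (Fin k)) r).indicator
        (fun x => r ^ 2 - ‖x‖ ^ 2) x := fun x => by
    by_cases hx : ‖x‖ ≤ r
    · rw [Set.indicator_of_mem (by simpa using hx), max_eq_left]
      have := norm_nonneg x
      nlinarith
    · rw [Set.indicator_of_notMem (by simpa using hx), max_eq_right]
      push Not at hx
      nlinarith
  simp only [gain, ContinuousLinearMap.id_apply, sub_zero, h1]
  have hint : IntegrableOn (fun x : EuclideanSpace ℝ (Fin k) => ‖x‖ ^ 2)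
      (Metric.closedBall 0 r) P :=
    (by fun_prop : Continuous fun x : EuclideanSpace ℝ (Fin k) => ‖x‖ ^ 2).continuousOn.integrableOn_compact
      (isCompact_closedBall _ _)
  rw [integral_indicator hb, integral_sub (integrable_const _) hint, hm.setIntegral_norm_sq]
  simp only [integral_const, measureReal_restrict_apply_univ, hm.measureReal_closedBall_r,
    smul_eq_mul]
  ring

lemma gain_id_pos [NeZero k] [IsProbabilityMeasure P] (hm : RadialModel k γ h P r) :
    0 < gain P r (0, ContinuousLinearMap.id ℝ _) := by
  have hr := hm.r_pos
  simp only [gain, ContinuousLinearMap.id_apply, sub_zero]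
  rw [integral_pos_iff_support_of_nonneg (f := fun x => max (r ^ 2 - ‖x‖ ^ 2) 0)
    (fun x => le_max_right _ _) (integrable_posPart P (q := fun x => ‖x‖ ^ 2) (by fun_prop) (fun x => sq_nonneg _) _)]
  have h1 : 0 < P.real (Metric.closedBall (0 : EuclideanSpace ℝ (Fin k)) (r / 2)) := by
    rw [hm.measureReal_closedBall (by linarith)]
    have := hm.radialMass_lt (a := 0) (b := r / 2) le_rfl (by linarith)
      (hm.h_r_pos.trans_le (hm.h_le (sq_nonneg _) (by nlinarith)))
    refine lt_of_eq_of_lt ?_ this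
    simp [radialMass]
  have h2 : 0 < P (Metric.closedBall (0 : EuclideanSpace ℝ (Fin k)) (r / 2)) :=
    (ENNReal.toReal_pos_iff.1 h1).1
  refine h2.trans_le (measure_mono fun x hx => ?_)
  have hx' : ‖x‖ ≤ r / 2 := by simpa using hx
  have h3 : 0 < r ^ 2 - ‖x‖ ^ 2 := by nlinarith [norm_nonneg x]
  rw [Function.mem_support]
  exact ((le_max_left _ _).trans_lt' h3).ne'

/-- Upper bound for the optimal trimmed mean square at the contaminated measure: the loss of mass of
the ball of radius `r` is compensated by a small multiple of the indicator of a larger ball. -/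
lemma exists_upper_bound [NeZero k] [IsProbabilityMeasure P] (hm : RadialModel k γ h P r)
    (x : EuclideanSpace ℝ (Fin k)) :
    ∃ U : ℝ → ℝ, Tendsto U (𝓝 0) (𝓝 (k * alpha k γ r h ^ 2)) ∧ ∀ᶠ ε in 𝓝 (0 : ℝ), 0 ≤ ε →
      ∃ ψ, IsTrimming γ (contaminate P x ε) ψ ∧
        trimmedAvg (contaminate P x ε) ψ (fun y => ‖y‖ ^ 2) ≤ U ε := by
  have hγ := hm.γ_pos
  set R := r + 1 with hR
  set Δ := P.real (Metric.closedBall (0 : EuclideanSpace ℝ (Fin k)) R) - γ with hΔ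
  have hΔ0 : 0 < Δ := sub_pos.2 (hm.lt_measureReal_closedBall (by linarith))
  set m := ∫ y in Metric.closedBall (0 : EuclideanSpace ℝ (Fin k)) R, ‖y‖ ^ 2 ∂P with hmdef
  -- this weight restores the mass `ε γ` lost by contamination
  set c : ℝ → ℝ := fun ε => ε * γ / ((1 - ε) * Δ) with hc
  have hcc : ContinuousAt c 0 := by
    refine ContinuousAt.div (by fun_prop) (by fun_prop) ?_
    simpa using hΔ0.ne'
  have hb : ∀ ρ : ℝ, MeasurableSet (Metric.closedBall (0 : EuclideanSpace ℝ (Fin k)) ρ) := fun ρ =>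
    Metric.isClosed_closedBall.measurableSet
  refine ⟨fun ε => γ⁻¹ * ((1 - ε) * ((1 - c ε) * (γ * k * alpha k γ r h ^ 2) + c ε * m)
    + ε * ‖x‖ ^ 2), ?_, ?_⟩
  · have : ContinuousAt (fun ε => γ⁻¹ * ((1 - ε) * ((1 - c ε) * (γ * k * alpha k γ r h ^ 2)
        + c ε * m) + ε * ‖x‖ ^ 2)) 0 := by fun_prop
    have h2 := this.tendsto
    have h3 : c 0 = 0 := by simp [hc]
    simp only [h3, sub_zero, one_mul, zero_mul, add_zero] at h2
    refine h2.trans_eq ?_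
    congr 1
    field_simp
  · have hc1 : ∀ᶠ ε in 𝓝 (0 : ℝ), c ε < 1 := hcc.tendsto.eventually_lt_const (by simp [hc])
    filter_upwards [hc1, eventually_lt_nhds (show (0 : ℝ) < 1 by norm_num)] with ε hc1 hε1 hε0
    have hcε0 : 0 ≤ c ε := by
      have : 0 < 1 - ε := by linarith
      simp only [hc]; positivity
    have := isProbabilityMeasure_contaminate (P := P) (x := x) hε0 hε1.le
    set i1 : EuclideanSpace ℝ (Fin k) → ℝ := (Metric.closedBall 0 r).indicator 1 with hi1
    set i2 : EuclideanSpace ℝ (Fin k) → ℝ := (Metric.closedBall 0 R).indicator 1 with hi2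
    have hi1m : Measurable i1 := measurable_one.indicator (hb r)
    have hi2m : Measurable i2 := measurable_one.indicator (hb R)
    have hi1b : ∀ y, 0 ≤ i1 y ∧ i1 y ≤ 1 := fun y =>
      ⟨Set.indicator_nonneg (fun _ _ => zero_le_one) y,
        Set.indicator_le_self' (fun _ _ => zero_le_one) y⟩
    have hi2b : ∀ y, 0 ≤ i2 y ∧ i2 y ≤ 1 := fun y =>
      ⟨Set.indicator_nonneg (fun _ _ => zero_le_one) y,
        Set.indicator_le_self' (fun _ _ => zero_le_one) y⟩
    set ψ : EuclideanSpace ℝ (Fin k) → ℝ := fun y => (1 - c ε) * i1 y + c ε * i2 y with hψ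
    have hψm : Measurable ψ := (hi1m.const_mul _).add (hi2m.const_mul _)
    have hψ0 : ∀ y, 0 ≤ ψ y := fun y =>
      add_nonneg (mul_nonneg (by linarith) (hi1b y).1) (mul_nonneg hcε0 (hi2b y).1)
    have hψ1 : ∀ y, ψ y ≤ 1 := fun y => by
      have := (hi1b y).2; have := (hi2b y).2
      simp only [hψ]; nlinarith
    have hI1 : Integrable i1 P := (integrable_const (1 : ℝ)).indicator (hb r)
    have hI2 : Integrable i2 P := (integrable_const (1 : ℝ)).indicator (hb R)
    have hψI : Integrable ψ P := (hI1.const_mul _).add (hI2.const_mul _)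
    have hmassP : ∫ y, ψ y ∂P = γ + c ε * Δ := by
      simp only [hψ]
      rw [integral_add (hI1.const_mul _) (hI2.const_mul _), integral_const_mul,
        integral_const_mul, hi1, hi2, integral_indicator_one (hb r),
        integral_indicator_one (hb R), hm.measureReal_closedBall_r, hΔ]
      ring
    have hmass : γ ≤ ∫ y, ψ y ∂(contaminate P x ε) := by
      rw [integral_contaminate hε0 hε1.le hψI, hmassP]
      have h1 : (1 - ε) * (γ + c ε * Δ) = γ := by
        have : 1 - ε ≠ 0 := by linarith
        simp only [hc]; field_simp; ring
      rw [h1]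
      linarith [mul_nonneg hε0 (hψ0 x)]
    have htr : IsTrimming γ (contaminate P x ε) ψ := by
      refine isTrimming_of_bounded hψm hψ0 hψ1 hmass (R := R) fun y hy => ?_
      have h1 : y ∉ Metric.closedBall (0 : EuclideanSpace ℝ (Fin k)) r := by
        simp; linarith
      have h2 : y ∉ Metric.closedBall (0 : EuclideanSpace ℝ (Fin k)) R := by
        simp; linarith
      simp [hψ, hi1, hi2, h1, h2]
    refine ⟨ψ, htr, ?_⟩
    have hintB : ∀ ρ : ℝ, IntegrableOn (fun y : EuclideanSpace ℝ (Fin k) => ‖y‖ ^ 2)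
        (Metric.closedBall 0 ρ) P := fun ρ =>
      (by fun_prop : Continuous fun y : EuclideanSpace ℝ (Fin k) => ‖y‖ ^ 2).continuousOn.integrableOn_compact
        (isCompact_closedBall _ _)
    have hψsq : ∀ y, ψ y * ‖y‖ ^ 2 = (1 - c ε) * (Metric.closedBall 0 r).indicator
        (fun y : EuclideanSpace ℝ (Fin k) => ‖y‖ ^ 2) y + c ε * (Metric.closedBall 0 R).indicator
        (fun y : EuclideanSpace ℝ (Fin k) => ‖y‖ ^ 2) y := fun y => by
      simp only [hψ, hi1, hi2]
      by_cases h1 : y ∈ Metric.closedBall (0 : EuclideanSpace ℝ (Fin k)) r <;>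
      by_cases h2 : y ∈ Metric.closedBall (0 : EuclideanSpace ℝ (Fin k)) R <;>
      simp only [h1, h2, Set.indicator_of_mem, Set.indicator_of_notMem, not_false_eq_true,
        Pi.one_apply] <;> ring
    have hI1' := (hintB r).integrable_indicator (hb r)
    have hI2' := (hintB R).integrable_indicator (hb R)
    have hsqP : ∫ y, ψ y * ‖y‖ ^ 2 ∂P
        = (1 - c ε) * (γ * k * alpha k γ r h ^ 2) + c ε * m := by
      simp_rw [hψsq]
      rw [integral_add (hI1'.const_mul _) (hI2'.const_mul _), integral_const_mul,
        integral_const_mul, integral_indicator (hb r), integral_indicator (hb R),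
        hm.setIntegral_norm_sq]
    have hsqI : Integrable (fun y => ψ y * ‖y‖ ^ 2) P := by
      simp_rw [hψsq]; exact (hI1'.const_mul _).add (hI2'.const_mul _)
    rw [trimmedAvg, integral_contaminate hε0 hε1.le hsqI, hsqP]
    have hm0 : 0 ≤ m := integral_nonneg fun y => sq_nonneg _
    have h1 : (1 - ε) * ((1 - c ε) * (γ * k * alpha k γ r h ^ 2) + c ε * m)
        + ε * (ψ x * ‖x‖ ^ 2)
        ≤ (1 - ε) * ((1 - c ε) * (γ * k * alpha k γ r h ^ 2) + c ε * m) + ε * ‖x‖ ^ 2 := by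
      have := mul_le_of_le_one_left (sq_nonneg ‖x‖) (hψ1 x)
      gcongr
    refine mul_le_mul ((inv_le_inv₀ (hγ.trans_le hmass) hγ).2 hmass) h1 ?_ (inv_nonneg.2 hγ.le)
    have h2 : 0 ≤ 1 - ε := by linarith
    have h3 : 0 ≤ 1 - c ε := by linarith
    have := hψ0 x
    positivity

/-- Any family of minimizers at vanishing contamination has trimmed means tending to `0` and
trimmed covariances tending to `α² I`. -/
lemma tendsto_mean_cov [NeZero k] [IsProbabilityMeasure P] (hm : RadialModel k γ h P r)
    (x : EuclideanSpace ℝ (Fin k)) {ι : Type*} {l : Filter ι} {e : ι → ℝ}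
    (he : Tendsto e l (𝓝 0)) (he0 : ∀ᶠ i in l, 0 ≤ e i) {φ : ι → EuclideanSpace ℝ (Fin k) → ℝ}
    (hφ : ∀ᶠ i in l, IsMinimizer γ (contaminate P x (e i)) (φ i)) :
    Tendsto (fun i => trimmedMean (contaminate P x (e i)) (φ i)) l (𝓝 0) ∧
      Tendsto (fun i => trimmedCov (contaminate P x (e i)) (φ i)) l
        (𝓝 (alpha k γ r h ^ 2 • (1 : Matrix (Fin k) (Fin k) ℝ))) := by
  have hk : (0 : ℝ) < k := by exact_mod_cast Nat.pos_of_ne_zero (NeZero.ne k)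
  have hγ := hm.γ_pos
  have hr := hm.r_pos
  suffices H : Tendsto (fun i => (trimmedMean (contaminate P x (e i)) (φ i),
      trimmedCov (contaminate P x (e i)) (φ i))) l
        (𝓝 (0, alpha k γ r h ^ 2 • (1 : Matrix (Fin k) (Fin k) ℝ))) from
    ⟨H.fst_nhds, H.snd_nhds⟩
  -- along an ultrafilter, the normalized maps converge as soon as they stay bounded
  rw [tendsto_iff_ultrafilter]
  intro U hU
  obtain ⟨V, hV, hψ⟩ := hm.exists_upper_bound x
  have hev : ∀ᶠ i in l, 0 ≤ e i ∧ e i < γ ∧ e i < 1 ∧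
      IsMinimizer γ (contaminate P x (e i)) (φ i) ∧
      ∃ ψ, IsTrimming γ (contaminate P x (e i)) ψ ∧
        trimmedAvg (contaminate P x (e i)) ψ (fun y => ‖y‖ ^ 2) ≤ V (e i) := by
    filter_upwards [he0, hφ, he.eventually (eventually_lt_nhds hγ),
      he.eventually (eventually_lt_nhds (show (0 : ℝ) < 1 by norm_num)), he.eventually hψ]
      with i h1 h2 h3 h4 h5 using ⟨h1, h3, h4, h2, h5 h1⟩
  have hex : ∀ i, ∃ (B : EuclideanSpace ℝ (Fin k) →L[ℝ] EuclideanSpace ℝ (Fin k)) (d : ℝ),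
      (0 ≤ e i ∧ e i < γ ∧ e i < 1 ∧
      IsMinimizer γ (contaminate P x (e i)) (φ i) ∧
      ∃ ψ, IsTrimming γ (contaminate P x (e i)) ψ ∧
        trimmedAvg (contaminate P x (e i)) ψ (fun y => ‖y‖ ^ 2) ≤ V (e i)) →
      0 < d ∧ B.det ^ 2 = 1 ∧
      gram B = d • (trimmedCov (contaminate P x (e i)) (φ i))⁻¹ ∧
      (trimmedCov (contaminate P x (e i)) (φ i)).PosDef ∧ k * d ≤ V (e i) ∧
      γ * (r ^ 2 - k * d) - e i * r ^ 2
        ≤ gain P r (B (trimmedMean (contaminate P x (e i)) (φ i)), B) := by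
    intro i
    by_cases hi : 0 ≤ e i ∧ e i < γ ∧ e i < 1 ∧
      IsMinimizer γ (contaminate P x (e i)) (φ i) ∧
      ∃ ψ, IsTrimming γ (contaminate P x (e i)) ψ ∧
        trimmedAvg (contaminate P x (e i)) ψ (fun y => ‖y‖ ^ 2) ≤ V (e i)
    swap
    · exact ⟨0, 0, fun h => absurd h hi⟩
    obtain ⟨h0, heγ, h1, hmin, ψ, hψ, hψV⟩ := hi
    have := isProbabilityMeasure_contaminate (P := P) (x := x) h0 h1.le
    have hC := hmin.1.trimmedCov_posDef hγ
      (measureReal_contaminate_lt hm.absolutelyContinuous h0 h1.le heγ)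
    obtain ⟨B, d, hd, hdk, hB, hgram⟩ := exists_normalizing_map hC
    refine ⟨B, d, fun _ => ⟨hd, hB, hgram, hC, ?_, ?_⟩⟩
    · have h2 := (hmin.2 ψ hψ).trans (hψ.det_trimmedCov_le hγ
        (B := ContinuousLinearMap.id ℝ _) (by
          rw [ContinuousLinearMap.det, ContinuousLinearMap.coe_id, LinearMap.det_id, one_pow]) 0)
      simp only [ContinuousLinearMap.id_apply, sub_zero] at h2
      have h3 : 0 ≤ trimmedAvg (contaminate P x (e i)) ψ (fun y => ‖y‖ ^ 2) :=
        mul_nonneg (inv_nonneg.2 (hψ.mass_pos hγ).le)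
          (integral_nonneg fun x => mul_nonneg (hψ.nonneg x) (sq_nonneg _))
      rw [← hdk] at h2
      have h4 := le_of_pow_le_pow_left₀ (NeZero.ne k) (by positivity) h2
      rw [le_div_iff₀ hk] at h4
      linarith
    · set T := trimmedMean (contaminate P x (e i)) (φ i)
      have h2 := (dual_le_trimmedAvg hγ hmin.1 (q := fun y => ‖B y - B T‖ ^ 2) (by fun_prop)
        (fun y => sq_nonneg _) (hmin.1.integrable_mul_norm_sq B (B T)) (r ^ 2)).2
      rw [hmin.1.trimmedAvg_norm_sq_of_gram hC hgram, integral_contaminate h0 h1.le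
        (integrable_posPart P (by fun_prop) (fun y => sq_nonneg _) _)] at h2
      have h3 : max (r ^ 2 - ‖B x - B T‖ ^ 2) 0 ≤ r ^ 2 :=
        max_le (by linarith [sq_nonneg ‖B x - B T‖]) (sq_nonneg _)
      have h4 : 0 ≤ gain P r (B T, B) := integral_nonneg fun y => le_max_right _ _
      have h5 : (1 - e i) * gain P r (B T, B) + e i * max (r ^ 2 - ‖B x - B T‖ ^ 2) 0
          ≤ gain P r (B T, B) + e i * r ^ 2 := by nlinarith
      have h6 : γ * (r ^ 2 - k * d)
          ≤ (1 - e i) * gain P r (B T, B) + e i * max (r ^ 2 - ‖B x - B T‖ ^ 2) 0 := by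
        have h7 : r ^ 2 - k * d ≤ γ⁻¹ * ((1 - e i) * gain P r (B T, B)
          + e i * max (r ^ 2 - ‖B x - B T‖ ^ 2) 0) := by
          simp only [gain]; linarith
        calc γ * (r ^ 2 - k * d) ≤ γ * (γ⁻¹ * ((1 - e i) * gain P r (B T, B)
          + e i * max (r ^ 2 - ‖B x - B T‖ ^ 2) 0)) := by gcongr
          _ = _ := mul_inv_cancel_left₀ hγ.ne' _
      linarith
  choose B d hBd using hex
  set T := fun i => trimmedMean (contaminate P x (e i)) (φ i) with hT
  set C := fun i => trimmedCov (contaminate P x (e i)) (φ i) with hCdef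
  have hev' := (hev.mono fun i hi => hBd i hi).filter_mono hU
  have heU : Tendsto e U (𝓝 0) := he.mono_left hU
  -- the lower bound for the gains tends to the gain of the identity
  have hlow : Tendsto (fun i => γ * (r ^ 2 - V (e i)) - e i * r ^ 2) U
      (𝓝 (gain P r (0, ContinuousLinearMap.id ℝ _))) := by
    have := (((hV.comp heU).const_sub (r ^ 2)).const_mul γ).sub (heU.mul_const (r ^ 2))
    rw [hm.gain_id]
    simpa using this
  have hgain : ∀ᶠ i in (U : Filter ι), γ * (r ^ 2 - V (e i)) - e i * r ^ 2
      ≤ gain P r (B i (T i), B i) := by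
    filter_upwards [hev'] with i hi
    have : γ * (r ^ 2 - V (e i)) ≤ γ * (r ^ 2 - k * d i) := by
      have := hi.2.2.2.2.1
      gcongr
    linarith [hi.2.2.2.2.2]
  have hpos := hm.gain_id_pos
  set G := gain P r (0, ContinuousLinearMap.id ℝ (EuclideanSpace ℝ (Fin k))) with hG
  obtain ⟨R, hR⟩ := exists_measure_lt_of_norm_gt P hm.absolutelyContinuous (r ^ 2)
    (η := G / (2 * r ^ 2)) (by positivity)
  -- a gain above `G / 2` excludes parameters far out
  have hbdd : ∀ᶠ i in (U : Filter ι), (B i (T i), B i) ∈ Metric.closedBall (0 : AffineParam k) R := by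
    filter_upwards [hgain, hlow.eventually_const_lt (show G / 2 < G by linarith)] with i h1 h2
    rw [mem_closedBall_zero_iff]
    by_contra! hlt
    have h3 := hR _ hlt
    have hmeas : MeasurableSet {y | ‖B i y - B i (T i)‖ ^ 2 < r ^ 2} :=
      measurableSet_lt (by fun_prop) measurable_const
    have h4 : gain P r (B i (T i), B i) ≤ r ^ 2 * P.real {y | ‖B i y - B i (T i)‖ ^ 2 < r ^ 2} := by
      rw [← integral_indicator_one hmeas, ← integral_const_mul]
      refine integral_mono (integrable_posPart P (by fun_prop) (fun x => sq_nonneg _) _)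
        (((integrable_const (1 : ℝ)).indicator hmeas).const_mul _) fun y => ?_
      by_cases hy : ‖B i y - B i (T i)‖ ^ 2 < r ^ 2
      · simp only [Set.indicator_of_mem
          (show y ∈ {y | ‖B i y - B i (T i)‖ ^ 2 < r ^ 2} from hy), Pi.one_apply, mul_one]
        exact max_le (by linarith [sq_nonneg ‖B i y - B i (T i)‖]) (sq_nonneg _)
      · simp only [Set.indicator_of_notMem
          (show y ∉ {y | ‖B i y - B i (T i)‖ ^ 2 < r ^ 2} from hy), mul_zero]
        exact max_le (by linarith) le_rfl
    have h5 : r ^ 2 * P.real {y | ‖B i y - B i (T i)‖ ^ 2 < r ^ 2} < r ^ 2 * (G / (2 * r ^ 2)) :=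
      mul_lt_mul_of_pos_left h3 (by positivity)
    have h6 : r ^ 2 * (G / (2 * r ^ 2)) = G / 2 := by field_simp
    linarith
  have : ProperSpace (AffineParam k) := FiniteDimensional.proper ℝ _
  obtain ⟨θ, -, hθ⟩ := (isCompact_closedBall (0 : AffineParam k) R).ultrafilter_le_nhds'
    (U.map fun i => (B i (T i), B i)) hbdd
  have hlim : Tendsto (fun i => (B i (T i), B i)) U (𝓝 θ) := hθ
  have hlim2 : Tendsto B U (𝓝 θ.2) := (continuous_snd.tendsto θ).comp hlim
  have hdet : θ.2.det ^ 2 = 1 := by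
    have h1 : Tendsto (fun i => (B i).det ^ 2) U (𝓝 (θ.2.det ^ 2)) :=
      ((ContinuousLinearMap.continuous_det.tendsto θ.2).comp hlim2).pow 2
    refine tendsto_nhds_unique h1 (tendsto_const_nhds.congr' ?_)
    filter_upwards [hev'] with i hi using hi.2.1.symm
  have hgainlim : Tendsto (fun i => gain P r (B i (T i), B i)) U (𝓝 (gain P r θ)) :=
    (continuous_gain.tendsto θ).comp hlim
  have hge : G ≤ gain P r θ := le_of_tendsto_of_tendsto hlow hgainlim hgain
  obtain ⟨hle, heq⟩ := hm.gain_le_and_eq θ hdet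
  obtain ⟨hθ1, hθ2⟩ := heq hge
  have hd : Tendsto d U (𝓝 (alpha k γ r h ^ 2)) := by
    have hlo : Tendsto (fun i => (r ^ 2 - γ⁻¹ * (gain P r (B i (T i), B i) + e i * r ^ 2)) / k) U
        (𝓝 (alpha k γ r h ^ 2)) := by
      have := (((hgainlim.add (heU.mul_const (r ^ 2))).const_mul γ⁻¹).const_sub (r ^ 2)).div_const
        (k : ℝ)
      rw [le_antisymm hle hge, hm.gain_id] at this
      refine this.trans_eq ?_
      congr 1
      field_simp
      ring
    have hhi : Tendsto (fun i => V (e i) / k) U (𝓝 (alpha k γ r h ^ 2)) := by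
      have := (hV.comp heU).div_const (k : ℝ)
      rwa [mul_div_cancel_left₀ _ hk.ne'] at this
    refine tendsto_of_tendsto_of_tendsto_of_le_of_le' hlo hhi ?_ ?_
    · filter_upwards [hev'] with i hi
      rw [div_le_iff₀ hk, sub_le_iff_le_add', ← sub_le_iff_le_add, inv_mul_eq_div, le_div_iff₀ hγ]
      linarith [hi.2.2.2.2.2]
    · filter_upwards [hev'] with i hi
      rw [le_div_iff₀ hk]
      linarith [hi.2.2.2.2.1]
  have hgramlim : Tendsto (fun i => gram (B i)) U (𝓝 1) := by
    rw [← hθ2]; exact (continuous_gram.tendsto θ.2).comp hlim2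
  refine Tendsto.prodMk_nhds ?_ ?_
  · -- recover the trimmed mean from `B T` by Cramer's rule
    let F : AffineParam k → EuclideanSpace ℝ (Fin k) := fun θ => θ.2.det • WithLp.toLp 2
      (((Matrix.toEuclideanCLM (𝕜 := ℝ) (n := Fin k)).symm θ.2).adjugate.mulVec θ.1.ofLp)
    have hF : Continuous F := by
      refine (ContinuousLinearMap.continuous_det.comp continuous_snd).smul ?_
      refine (PiLp.continuous_toLp 2 _).comp ?_
      exact ((continuous_toEuclideanCLM_symm.comp continuous_snd).matrix_adjugate).matrix_mulVec
        ((PiLp.continuous_ofLp 2 _).comp continuous_fst)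
    have h1 : Tendsto (fun i => F (B i (T i), B i)) U (𝓝 (F θ)) := (hF.tendsto θ).comp hlim
    have h2 : F θ = 0 := by simp [F, hθ1]
    rw [h2] at h1
    refine h1.congr' ?_
    filter_upwards [hev'] with i hi
    have h3 : (B i (T i)).ofLp
        = ((Matrix.toEuclideanCLM (𝕜 := ℝ) (n := Fin k)).symm (B i)).mulVec (T i).ofLp := by
      rw [← Matrix.ofLp_toEuclideanCLM]; simp
    simp only [F]
    rw [h3, Matrix.mulVec_mulVec, Matrix.adjugate_mul, det_toEuclideanCLM_symm, Matrix.smul_mulVec,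
      Matrix.one_mulVec, WithLp.toLp_smul, smul_smul, ← sq, hi.2.1, one_smul]
  · -- `C = d (BᵀB)⁻¹`, and the inverse is the adjugate since `det (BᵀB) = 1`
    have h1 : Tendsto (fun i => d i • (gram (B i)).adjugate) U
        (𝓝 (alpha k γ r h ^ 2 • (1 : Matrix (Fin k) (Fin k) ℝ).adjugate)) :=
      hd.smul (((continuous_id.matrix_adjugate).tendsto (1 : Matrix (Fin k) (Fin k) ℝ)).comp hgramlim)
    rw [Matrix.adjugate_one] at h1
    refine h1.congr' ?_
    filter_upwards [hev'] with i hi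
    obtain ⟨hdi, hBi, hgi, hCi, -⟩ := hi
    have h2 : (gram (B i)).adjugate = (gram (B i))⁻¹ := by
      rw [Matrix.inv_def, det_gram, hBi]; simp
    have h3 : (gram (B i))⁻¹ = (d i)⁻¹ • C i := by
      refine Matrix.inv_eq_left_inv ?_
      rw [hgi, Matrix.smul_mul, Matrix.mul_smul, smul_smul, inv_mul_cancel₀ hdi.ne', one_smul,
        Matrix.mul_nonsing_inv _ (isUnit_iff_ne_zero.2 hCi.det_pos.ne')]
    rw [h2, h3, smul_smul, mul_inv_cancel₀ hdi.ne', one_smul]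

end RadialModel

/-! ### Geometry of nearly spherical ellipsoids -/

/-- The entrywise `ℓ¹` size of a matrix. -/
def entrySum (D : Matrix (Fin k) (Fin k) ℝ) : ℝ := ∑ i, ∑ j, |D i j|

lemma entrySum_nonneg (D : Matrix (Fin k) (Fin k) ℝ) : 0 ≤ entrySum D :=
  Finset.sum_nonneg fun _ _ => Finset.sum_nonneg fun _ _ => abs_nonneg _

lemma abs_apply_le_entrySum (D : Matrix (Fin k) (Fin k) ℝ) (i j : Fin k) :
    |D i j| ≤ entrySum D :=
  (Finset.single_le_sum (f := fun j => |D i j|) (fun _ _ => abs_nonneg _) (Finset.mem_univ j)).trans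
    (Finset.single_le_sum (f := fun i => ∑ j, |D i j|)
      (fun _ _ => Finset.sum_nonneg fun _ _ => abs_nonneg _) (Finset.mem_univ i))

lemma abs_dotProduct_mulVec_le (D : Matrix (Fin k) (Fin k) ℝ) (u v : EuclideanSpace ℝ (Fin k)) :
    |u.ofLp ⬝ᵥ D.mulVec v.ofLp| ≤ entrySum D * (‖u‖ * ‖v‖) := by
  simp only [dotProduct, Matrix.mulVec, Finset.mul_sum, entrySum, Finset.sum_mul]
  refine (Finset.abs_sum_le_sum_abs _ _).trans (Finset.sum_le_sum fun i _ => ?_)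
  refine (Finset.abs_sum_le_sum_abs _ _).trans (Finset.sum_le_sum fun j _ => ?_)
  rw [abs_mul, abs_mul]
  have h1 : |u i| ≤ ‖u‖ := PiLp.norm_apply_le u i
  have h2 : |v j| ≤ ‖v‖ := PiLp.norm_apply_le v j
  calc |u i| * (|D i j| * |v j|) = |D i j| * (|u i| * |v j|) := by ring
    _ ≤ _ := by gcongr

lemma dotProduct_self_eq_norm_sq (v : EuclideanSpace ℝ (Fin k)) : v.ofLp ⬝ᵥ v.ofLp = ‖v‖ ^ 2 := by
  rw [EuclideanSpace.real_norm_sq_eq]; simp [dotProduct, sq]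

/-- The Mahalanobis distance is close to `‖x - m‖² / α²` if the matrix is close to `α² I`. -/
lemma abs_mahalanobisSq_sub_le {C : Matrix (Fin k) (Fin k) ℝ} (hC : IsUnit C.det) {α : ℝ}
    (hα : 0 < α) (hD : entrySum (C - α ^ 2 • (1 : Matrix (Fin k) (Fin k) ℝ)) ≤ α ^ 2 / 2)
    (m x : EuclideanSpace ℝ (Fin k)) :
    |mahalanobisSq m C x - ‖x - m‖ ^ 2 / α ^ 2|
      ≤ 2 * entrySum (C - α ^ 2 • (1 : Matrix (Fin k) (Fin k) ℝ)) / α ^ 4 * ‖x - m‖ ^ 2 := by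
  set D := C - α ^ 2 • (1 : Matrix (Fin k) (Fin k) ℝ) with hDdef
  set v := x - m with hv
  set w : EuclideanSpace ℝ (Fin k) := WithLp.toLp 2 (C⁻¹.mulVec v.ofLp) with hw
  have hCw : C.mulVec w.ofLp = v.ofLp := by
    rw [hw, Matrix.mulVec_mulVec, Matrix.mul_nonsing_inv _ hC, Matrix.one_mulVec]
  have hv2 : v.ofLp = α ^ 2 • w.ofLp + D.mulVec w.ofLp := by
    rw [← hCw, hDdef, Matrix.sub_mulVec, Matrix.smul_mulVec, Matrix.one_mulVec]; abel
  have hvw : ‖v‖ ^ 2 = α ^ 2 * (v.ofLp ⬝ᵥ w.ofLp) + v.ofLp ⬝ᵥ D.mulVec w.ofLp := by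
    rw [← dotProduct_self_eq_norm_sq]
    nth_rw 2 [hv2]
    rw [dotProduct_add, dotProduct_smul, smul_eq_mul]
  have hww : w.ofLp ⬝ᵥ v.ofLp = α ^ 2 * ‖w‖ ^ 2 + w.ofLp ⬝ᵥ D.mulVec w.ofLp := by
    rw [← dotProduct_self_eq_norm_sq]
    nth_rw 1 [hv2]
    rw [dotProduct_add, dotProduct_smul, smul_eq_mul]
  have h1 := abs_dotProduct_mulVec_le D v w
  have h2 := abs_dotProduct_mulVec_le D w w
  have h3 : w.ofLp ⬝ᵥ v.ofLp ≤ ‖w‖ * ‖v‖ := by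
    have := real_inner_le_norm v w
    rw [EuclideanSpace.inner_eq_star_dotProduct] at this
    simpa [mul_comm] using this
  have hwv : α ^ 2 * ‖w‖ ≤ 2 * ‖v‖ := by
    by_contra! hlt
    have hw0 : 0 < ‖w‖ := by
      by_contra! h0
      have : ‖w‖ = 0 := le_antisymm h0 (norm_nonneg _)
      rw [this] at hlt
      linarith [norm_nonneg v]
    have h4 := abs_le.1 h2
    nlinarith [mul_lt_mul_of_pos_right hlt hw0, mul_le_mul_of_nonneg_right hD (sq_nonneg ‖w‖)]
  have hmah : mahalanobisSq m C x = v.ofLp ⬝ᵥ w.ofLp := rfl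
  have h5 : mahalanobisSq m C x - ‖v‖ ^ 2 / α ^ 2 = -(v.ofLp ⬝ᵥ D.mulVec w.ofLp) / α ^ 2 := by
    rw [hmah, hvw]; field_simp; ring
  rw [h5, abs_div, abs_neg, abs_of_pos (by positivity : 0 < α ^ 2), div_le_iff₀ (by positivity)]
  refine h1.trans ?_
  have h6 : ‖w‖ ≤ 2 * ‖v‖ / α ^ 2 := by rw [le_div_iff₀ (by positivity)]; linarith
  have h7 := entrySum_nonneg D
  calc entrySum D * (‖v‖ * ‖w‖) ≤ entrySum D * (‖v‖ * (2 * ‖v‖ / α ^ 2)) := by gcongr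
    _ = _ := by field_simp

/-- An ellipsoid with parameters within `O(δ)` of those of the centred ball of radius `r`
lies between the balls of radii `r ∓ O(δ)`. -/
lemma ellipsoid_sandwich {r α : ℝ} (hr : 0 < r) (hα : 0 < α) :
    ∃ K δ₀ : ℝ, 0 < K ∧ 0 < δ₀ ∧ ∀ (m : EuclideanSpace ℝ (Fin k)) (C : Matrix (Fin k) (Fin k) ℝ)
      (s δ : ℝ), IsUnit C.det → δ ≤ δ₀ → ‖m‖ ≤ δ →
      entrySum (C - α ^ 2 • (1 : Matrix (Fin k) (Fin k) ℝ)) ≤ δ → |s - r / α| ≤ δ →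
      Metric.closedBall 0 (r - K * δ) ⊆ ellipsoid m C s ∧
        ellipsoid m C s ⊆ Metric.closedBall 0 (r + K * δ) := by
  refine ⟨1 + 2 * α + 4 * r / α ^ 2, min (min (α ^ 2 / 4) (r / (2 * α)))
    1, by positivity, by positivity, fun m C s δ hC hδ₀ hm hD hs => ?_⟩
  have hδ1 : δ ≤ α ^ 2 / 4 := hδ₀.trans ((min_le_left _ _).trans (min_le_left _ _))
  have hδ2 : δ ≤ r / (2 * α) := hδ₀.trans ((min_le_left _ _).trans (min_le_right _ _))
  have hδ0 : 0 ≤ δ := (norm_nonneg m).trans hm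
  set K := 1 + 2 * α + 4 * r / α ^ 2 with hK
  have hα2 : 0 < α ^ 2 := by positivity
  set y := 2 * δ / α ^ 2 with hy
  have hy0 : 0 ≤ y := by positivity
  have hy1 : y ≤ 1 / 2 := by rw [hy, div_le_iff₀ hα2]; linarith
  have hmah := fun x => abs_le.1 (abs_mahalanobisSq_sub_le (x := x) hC hα (by linarith) m)
  have hη : 2 * entrySum (C - α ^ 2 • (1 : Matrix (Fin k) (Fin k) ℝ)) / α ^ 4 ≤ y / α ^ 2 := by
    rw [hy, div_div, ← pow_add]
    gcongr
  have hα1 : δ * α ≤ r / 2 := by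
    rw [le_div_iff₀ (by positivity)] at hδ2; linarith
  have hs' := abs_le.1 hs
  have hsα : s * α ≤ r + δ * α := by
    have : s ≤ r / α + δ := by linarith
    calc s * α ≤ (r / α + δ) * α := by gcongr
      _ = _ := by field_simp
  have hsα' : r - δ * α ≤ s * α := by
    have : r / α - δ ≤ s := by linarith
    calc r - δ * α = (r / α - δ) * α := by field_simp
      _ ≤ _ := by gcongr
  have hs0 : 0 ≤ s := by nlinarith
  have hry : 2 * r * y = 4 * r / α ^ 2 * δ := by rw [hy]; ring
  constructor
  · intro x hx
    have hx' : ‖x‖ ≤ r - K * δ := by simpa using hx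
    have h1 : ‖x - m‖ ≤ r - (K - 1) * δ := by linarith [norm_sub_le x m]
    rw [ellipsoid_eq]
    show mahalanobisSq m C x ≤ s ^ 2
    have h2 : mahalanobisSq m C x ≤ (1 + y) * ‖x - m‖ ^ 2 / α ^ 2 := by
      have := (hmah x).2
      have h3 := mul_le_mul_of_nonneg_right hη (sq_nonneg ‖x - m‖)
      have h4 : (1 + y) * ‖x - m‖ ^ 2 / α ^ 2 = ‖x - m‖ ^ 2 / α ^ 2 + y / α ^ 2 * ‖x - m‖ ^ 2 := by
        ring
      linarith
    refine h2.trans ?_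
    rw [div_le_iff₀ hα2, ← mul_pow]
    have h3 : (1 + y) * ‖x - m‖ ≤ s * α := by
      have h5 : 0 ≤ (K - 1) * δ := by rw [hK]; have : 0 ≤ 2 * α + 4 * r / α ^ 2 := by positivity
                                      nlinarith
      calc (1 + y) * ‖x - m‖ ≤ (1 + y) * (r - (K - 1) * δ) := by gcongr
        _ ≤ r + r * y - (K - 1) * δ := by nlinarith
        _ = r + r * y - (2 * α * δ + 2 * r * y) := by rw [hry, hK]; ring
        _ ≤ r - δ * α := by nlinarith
        _ ≤ _ := hsα'
    calc (1 + y) * ‖x - m‖ ^ 2 ≤ ((1 + y) * ‖x - m‖) ^ 2 := by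
          rw [mul_pow]
          exact mul_le_mul_of_nonneg_right (by nlinarith) (sq_nonneg _)
      _ ≤ _ := by gcongr
  · intro x hx
    have hx' : mahalanobisSq m C x ≤ s ^ 2 := hx
    have h2 : (1 - y) * ‖x - m‖ ^ 2 / α ^ 2 ≤ mahalanobisSq m C x := by
      have := (hmah x).1
      have h3 := mul_le_mul_of_nonneg_right hη (sq_nonneg ‖x - m‖)
      have h4 : (1 - y) * ‖x - m‖ ^ 2 / α ^ 2 = ‖x - m‖ ^ 2 / α ^ 2 - y / α ^ 2 * ‖x - m‖ ^ 2 := by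
        ring
      linarith
    have h3 := h2.trans hx'
    rw [div_le_iff₀ hα2, ← mul_pow] at h3
    have h4 : ‖x - m‖ ≤ (1 + y) * (s * α) := by
      refine le_of_sq_le_sq ?_ (by positivity)
      have h5 : 1 ≤ (1 + y) ^ 2 * (1 - y) := by
        have h6 : (1 + y) ^ 2 * (1 - y) = 1 + y * (1 - y - y ^ 2) := by ring
        have h7 : 0 ≤ 1 - y - y ^ 2 := by nlinarith
        have h8 := mul_nonneg hy0 h7
        linarith
      calc ‖x - m‖ ^ 2 ≤ (1 + y) ^ 2 * (1 - y) * ‖x - m‖ ^ 2 :=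
            le_mul_of_one_le_left (sq_nonneg _) h5
        _ = (1 + y) ^ 2 * ((1 - y) * ‖x - m‖ ^ 2) := by ring
        _ ≤ (1 + y) ^ 2 * (s * α) ^ 2 := by gcongr
        _ = _ := by ring
    have h5 : (1 + y) * (s * α) ≤ r + 2 * r * y + 2 * α * δ := by
      calc (1 + y) * (s * α) ≤ (1 + y) * (r + δ * α) := by gcongr
        _ ≤ _ := by nlinarith
    have h6 : ‖x‖ ≤ ‖x - m‖ + ‖m‖ := by simpa using norm_add_le (x - m) m
    rw [mem_closedBall_zero_iff]
    have h7 : K * δ = δ + 2 * α * δ + 2 * r * y := by rw [hry, hK]; ring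
    linarith

/-! ### Moments of ellipsoids -/

section EllipsoidMoments

variable {B : EuclideanSpace ℝ (Fin k) →L[ℝ] EuclideanSpace ℝ (Fin k)}

lemma setIntegral_ellipsoid_comp (hB : B.det ^ 2 = 1) (m : EuclideanSpace ℝ (Fin k)) (ρ : ℝ)
    (G : EuclideanSpace ℝ (Fin k) → ℝ) :
    ∫ y in {y | ‖B y - B m‖ ≤ ρ}, G (B y - B m) = ∫ z in Metric.closedBall 0 ρ, G z := by
  have hB0 : B.det ≠ 0 := fun h => by simp [h] at hB
  have habs : |B.det| = 1 := by
    have := sq_eq_sq_iff_abs_eq_abs B.det 1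
    simpa using this.1 (by simpa using hB)
  have hmeas : MeasurableSet {y | ‖B y - B m‖ ≤ ρ} := measurableSet_le (by fun_prop) measurable_const
  rw [← integral_indicator hmeas, ← integral_indicator Metric.isClosed_closedBall.measurableSet]
  have := integral_comp_affine hB0 (B m) ((Metric.closedBall 0 ρ).indicator G)
  rw [habs, inv_one, one_mul] at this
  rw [← this]
  congr 1; ext y
  by_cases hy : ‖B y - B m‖ ≤ ρ <;> simp [hy]

lemma volume_real_ellipsoid [NeZero k] (hB : B.det ^ 2 = 1) (m : EuclideanSpace ℝ (Fin k)) {ρ : ℝ}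
    (hρ : 0 ≤ ρ) : (volume : Measure (EuclideanSpace ℝ (Fin k))).real {y | ‖B y - B m‖ ≤ ρ}
      = sphereArea k * ρ ^ k / k := by
  have := setIntegral_ellipsoid_comp hB m ρ (fun _ => 1)
  rw [← volume_real_closedBall hρ]
  simpa using this

lemma setIntegral_ellipsoid_coord (hB : B.det ^ 2 = 1) (m : EuclideanSpace ℝ (Fin k)) (ρ : ℝ)
    (p : Fin k) : ∫ y in {y | ‖B y - B m‖ ≤ ρ}, (y p - m p) = 0 := by
  have hB0 : B.det ≠ 0 := fun h => by simp [h] at hB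
  let e := B.toContinuousLinearEquivOfDetNeZero hB0
  have he : ∀ y, e.symm (B y) = y := fun z => e.symm_apply_apply z
  have h1 := setIntegral_ellipsoid_comp hB m ρ (fun z => (e.symm z) p)
  have h2 : ∀ y, (e.symm (B y - B m)) p = y p - m p := fun y => by rw [map_sub, he, he]; rfl
  simp only [h2] at h1
  rw [h1]
  have := (LinearIsometryEquiv.neg ℝ (E := EuclideanSpace ℝ (Fin k))).measurePreserving.setIntegral_preimage_emb
    (LinearIsometryEquiv.neg ℝ (E := EuclideanSpace ℝ (Fin k))).toHomeomorph.measurableEmbedding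
    (fun z => (e.symm z) p) (Metric.closedBall 0 ρ)
  have hb : (LinearIsometryEquiv.neg ℝ (E := EuclideanSpace ℝ (Fin k))) ⁻¹' Metric.closedBall 0 ρ
      = Metric.closedBall 0 ρ := by ext x; simp
  rw [hb] at this
  simp only [LinearIsometryEquiv.coe_neg, map_neg, PiLp.neg_apply, integral_neg] at this
  linarith

lemma setIntegral_ellipsoid_coord_mul [NeZero k] (hB : B.det ^ 2 = 1) (m : EuclideanSpace ℝ (Fin k)) {ρ : ℝ}
    (hρ : 0 ≤ ρ) (p q : Fin k) :
    ∫ y in {y | ‖B y - B m‖ ≤ ρ}, (y p - m p) * (y q - m q)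
      = (gram B)⁻¹ p q * (sphereArea k * ρ ^ (k + 2) / (k * (k + 2))) := by
  set M := (Matrix.toEuclideanCLM (𝕜 := ℝ) (n := Fin k)).symm B with hM
  have hMdet : IsUnit M.det := by
    rw [hM, det_toEuclideanCLM_symm, isUnit_iff_ne_zero]
    exact fun h => by simp [h] at hB
  have hcoord : ∀ (y : EuclideanSpace ℝ (Fin k)) (p : Fin k),
      y p - m p = ∑ a, M⁻¹ p a * (B y - B m) a := fun y p => by
    have h1 : (B (y - m)).ofLp = M.mulVec (y - m).ofLp := by
      rw [← Matrix.ofLp_toEuclideanCLM]; simp [hM]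
    have h2 : M⁻¹.mulVec (B (y - m)).ofLp = (y - m).ofLp := by
      rw [h1, Matrix.mulVec_mulVec, Matrix.nonsing_inv_mul _ hMdet, Matrix.one_mulVec]
    have h3 := congrFun h2 p
    rw [map_sub] at h3
    exact h3.symm
  have h1 := setIntegral_ellipsoid_comp hB m ρ
    (fun z => (∑ a, M⁻¹ p a * z a) * ∑ b, M⁻¹ q b * z b)
  simp only [← hcoord] at h1
  rw [h1]
  have h2 : ∀ z : EuclideanSpace ℝ (Fin k), (∑ a, M⁻¹ p a * z a) * ∑ b, M⁻¹ q b * z b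
      = ∑ a, ∑ b, (M⁻¹ p a * M⁻¹ q b) * (z a * z b) := fun z => by
    rw [Finset.sum_mul_sum]
    refine Finset.sum_congr rfl fun a _ => Finset.sum_congr rfl fun b _ => by ring
  have hint : ∀ a b, IntegrableOn (fun z : EuclideanSpace ℝ (Fin k) =>
      (M⁻¹ p a * M⁻¹ q b) * (z a * z b)) (Metric.closedBall 0 ρ) := fun a b =>
    (by fun_prop : Continuous fun z : EuclideanSpace ℝ (Fin k) =>
      (M⁻¹ p a * M⁻¹ q b) * (z a * z b)).continuousOn.integrableOn_compact (isCompact_closedBall _ _)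
  simp_rw [h2]
  rw [integral_finsetSum Finset.univ fun a _ => integrable_finsetSum Finset.univ fun b _ => hint a b]
  have h3 : ∀ a, ∫ z in Metric.closedBall (0 : EuclideanSpace ℝ (Fin k)) ρ,
      ∑ b, (M⁻¹ p a * M⁻¹ q b) * (z a * z b)
      = M⁻¹ p a * M⁻¹ q a * (sphereArea k * ρ ^ (k + 2) / (k * (k + 2))) := fun a => by
    rw [integral_finsetSum Finset.univ fun b _ => hint a b]
    simp_rw [integral_const_mul, setIntegral_closedBall_coord_mul_one hρ]
    simp
  simp_rw [h3]
  rw [← Finset.sum_mul]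
  congr 1
  rw [gram, ← hM, Matrix.mul_inv_rev, Matrix.mul_apply, ← Matrix.transpose_nonsing_inv]
  simp

end EllipsoidMoments

/-! ### Consistency of the radius and integrals over thin shells -/

lemma continuous_entrySum : Continuous (entrySum (k := k)) := by
  unfold entrySum; fun_prop

lemma setIntegral_sub_setIntegral {X : Type*} [MeasurableSpace X] {μ : Measure X} {S T U : Set X}
    {F : X → ℝ} (hS : MeasurableSet S) (hT : MeasurableSet T) (hSU : S ⊆ U) (hTU : T ⊆ U)
    (hF : IntegrableOn F U μ) :
    ∫ y in S, F y ∂μ - ∫ y in T, F y ∂μ = ∫ y in S \ T, F y ∂μ - ∫ y in T \ S, F y ∂μ := by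
  have h1 := integral_inter_add_sdiff hT (hF.mono_set hSU)
  have h2 := integral_inter_add_sdiff hS (hF.mono_set hTU)
  rw [Set.inter_comm] at h2
  linarith

namespace RadialModel

variable [NeZero k] {γ r : ℝ} {h : ℝ → ℝ} {P : Measure (EuclideanSpace ℝ (Fin k))}

/-- The structure of minimizers at a contaminated measure. -/
lemma minimizer_spec [IsProbabilityMeasure P] (hm : RadialModel k γ h P r) {x : EuclideanSpace ℝ (Fin k)} {ε : ℝ}
    (h0 : 0 ≤ ε) (hε : ε < γ) {φ : EuclideanSpace ℝ (Fin k) → ℝ}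
    (hφ : IsMinimizer γ (contaminate P x ε) φ) :
    (trimmedCov (contaminate P x ε) φ).PosDef ∧ 0 ≤ trimmedRadius γ (contaminate P x ε) φ ∧
      ∫ y, φ y ∂(contaminate P x ε) = γ ∧
      γ ≤ (contaminate P x ε).real {y | mahalanobisSq (trimmedMean (contaminate P x ε) φ)
        (trimmedCov (contaminate P x ε) φ) y ≤ trimmedRadius γ (contaminate P x ε) φ ^ 2} ∧
      (contaminate P x ε).real {y | mahalanobisSq (trimmedMean (contaminate P x ε) φ)
        (trimmedCov (contaminate P x ε) φ) y < trimmedRadius γ (contaminate P x ε) φ ^ 2} ≤ γ ∧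
      (∀ᵐ y ∂(contaminate P x ε), mahalanobisSq (trimmedMean (contaminate P x ε) φ)
        (trimmedCov (contaminate P x ε) φ) y < trimmedRadius γ (contaminate P x ε) φ ^ 2 →
          φ y = 1) ∧
      (∀ᵐ y ∂(contaminate P x ε), trimmedRadius γ (contaminate P x ε) φ ^ 2 <
        mahalanobisSq (trimmedMean (contaminate P x ε) φ)
        (trimmedCov (contaminate P x ε) φ) y → φ y = 0) := by
  have h1 : ε ≤ 1 := (hε.trans hm.γ_lt_one).le
  have := isProbabilityMeasure_contaminate (P := P) (x := x) h0 h1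
  exact hφ.spec hm.γ_pos hm.γ_lt_one
    (measureReal_contaminate_lt hm.absolutelyContinuous h0 h1 hε)

lemma tendsto_radius [IsProbabilityMeasure P] (hm : RadialModel k γ h P r)
    (x : EuclideanSpace ℝ (Fin k)) {ι : Type*} {l : Filter ι} {e : ι → ℝ}
    (he : Tendsto e l (𝓝 0)) (he0 : ∀ᶠ i in l, 0 ≤ e i) {φ : ι → EuclideanSpace ℝ (Fin k) → ℝ}
    (hφ : ∀ᶠ i in l, IsMinimizer γ (contaminate P x (e i)) (φ i)) :
    Tendsto (fun i => trimmedRadius γ (contaminate P x (e i)) (φ i)) l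
      (𝓝 (r / alpha k γ r h)) := by
  obtain ⟨hT, hC⟩ := hm.tendsto_mean_cov x he he0 hφ
  set α := alpha k γ r h with hα
  have hα0 : 0 < α := hm.alpha_pos
  have hr := hm.r_pos
  have hγ := hm.γ_pos
  set T := fun i => trimmedMean (contaminate P x (e i)) (φ i) with hTdef
  set C := fun i => trimmedCov (contaminate P x (e i)) (φ i) with hCdef
  set s := fun i => trimmedRadius γ (contaminate P x (e i)) (φ i) with hs
  set δ : ι → ℝ := fun i => ‖T i‖ + entrySum (C i - α ^ 2 • (1 : Matrix (Fin k) (Fin k) ℝ)) with hδ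
  have hδ0 : Tendsto δ l (𝓝 0) := by
    have h1 : Tendsto (fun i => entrySum (C i - α ^ 2 • (1 : Matrix (Fin k) (Fin k) ℝ))) l
        (𝓝 (entrySum (α ^ 2 • (1 : Matrix (Fin k) (Fin k) ℝ) - α ^ 2 • 1))) :=
      (continuous_entrySum.tendsto _).comp (hC.sub_const _)
    have h2 := hT.norm.add h1
    simp only [sub_self, norm_zero, zero_add] at h2
    have h3 : entrySum (0 : Matrix (Fin k) (Fin k) ℝ) = 0 := by simp [entrySum]
    rwa [h3] at h2
  have hbound : ∀ i, 0 ≤ δ i ∧ ‖T i‖ ≤ δ i ∧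
      entrySum (C i - α ^ 2 • (1 : Matrix (Fin k) (Fin k) ℝ)) ≤ δ i := fun i => by
    have h1 := entrySum_nonneg (C i - α ^ 2 • (1 : Matrix (Fin k) (Fin k) ℝ))
    have h2 := norm_nonneg (T i)
    refine ⟨add_nonneg h2 h1, ?_, ?_⟩ <;> simp only [hδ] <;> linarith
  have heγ : ∀ᶠ i in l, e i < γ := he.eventually_lt_const hγ
  have hmeas : ∀ ρ, MeasurableSet (Metric.closedBall (0 : EuclideanSpace ℝ (Fin k)) ρ) :=
    fun ρ => Metric.isClosed_closedBall.measurableSet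
  rw [tendsto_order]
  constructor
  · intro a₀ ha₀
    -- it suffices to treat a positive lower bound
    set a := max a₀ (r / α / 2) with ha
    have ha1 : a < r / α := max_lt ha₀ (half_lt_self (by positivity))
    have ha0 : 0 < a := lt_max_of_lt_right (by positivity)
    obtain ⟨r', hr'1, hr'2⟩ := exists_between ((lt_div_iff₀ hα0).1 ha1)
    have hr'0 : 0 < r' := (by positivity : 0 < a * α).trans hr'1
    obtain ⟨K, δ₀, hK, hδ₀, hsand⟩ := ellipsoid_sandwich (k := k) (mul_pos ha0 hα0) hα0
    have h1 : ∀ᶠ i in l, a * α + K * δ i < r' := by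
      have : Tendsto (fun i => a * α + K * δ i) l (𝓝 (a * α + K * 0)) :=
        (hδ0.const_mul K).const_add _
      rw [mul_zero, add_zero] at this
      exact this.eventually_lt_const hr'1
    have h2 : ∀ᶠ i in l, P.real (Metric.closedBall 0 r') + e i < γ := by
      have : Tendsto (fun i => P.real (Metric.closedBall 0 r') + e i) l
        (𝓝 (P.real (Metric.closedBall 0 r') + 0)) := he.const_add _
      rw [add_zero] at this
      exact this.eventually_lt_const (hm.measureReal_closedBall_lt hr'0.le hr'2)
    filter_upwards [h1, h2, hφ, he0, heγ, hδ0.eventually_le_const hδ₀] with i h1 h2 hφ he0 heγ hδi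
    have ha₀a : a₀ ≤ a := le_max_left _ _
    refine ha₀a.trans_lt ?_
    by_contra! hle
    have hle' : s i ≤ a := hle
    obtain ⟨hpd, hs0, -, hge, -⟩ := hm.minimizer_spec he0 heγ hφ
    have hi1 : e i ≤ 1 := (heγ.trans hm.γ_lt_one).le
    have := isProbabilityMeasure_contaminate (P := P) (x := x) he0 hi1
    have h3 := (hsand (T i) (C i) a (δ i) (isUnit_iff_ne_zero.2 hpd.det_pos.ne') hδi
      (hbound i).2.1 (hbound i).2.2 (by
        rw [mul_div_cancel_right₀ _ hα0.ne', sub_self, abs_zero]; exact (hbound i).1)).2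
    have h4 : {y | mahalanobisSq (T i) (C i) y ≤ s i ^ 2} ⊆ Metric.closedBall 0 r' := by
      intro y hy
      refine Metric.closedBall_subset_closedBall h1.le (h3 ?_)
      have hy' : mahalanobisSq (T i) (C i) y ≤ s i ^ 2 := hy
      have hs0' : 0 ≤ s i := hs0
      exact hy'.trans (by gcongr)
    have h5 := measureReal_mono (μ := contaminate P x (e i)) h4
    have h6 := measureReal_contaminate_le (P := P) (x := x) he0 hi1 (hmeas r')
    linarith
  · intro a₀ ha₀
    obtain ⟨a, ha1, ha2⟩ := exists_between ha₀
    have ha0 : 0 < a := (by positivity : 0 < r / α).trans ha1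
    obtain ⟨r', hr'1, hr'2⟩ := exists_between ((div_lt_iff₀ hα0).1 ha1)
    obtain ⟨K, δ₀, hK, hδ₀, hsand⟩ := ellipsoid_sandwich (k := k) (mul_pos ha0 hα0) hα0
    have h1 : ∀ᶠ i in l, r' < a * α - K * δ i := by
      have : Tendsto (fun i => a * α - K * δ i) l (𝓝 (a * α - K * 0)) :=
        (hδ0.const_mul K).const_sub _
      rw [mul_zero, sub_zero] at this
      exact this.eventually_const_lt hr'2
    have h2 : ∀ᶠ i in l, γ < (1 - e i) * P.real (Metric.closedBall 0 r') := by
      have : Tendsto (fun i => (1 - e i) * P.real (Metric.closedBall 0 r')) l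
        (𝓝 ((1 - 0) * P.real (Metric.closedBall 0 r'))) := (he.const_sub _).mul_const _
      rw [sub_zero, one_mul] at this
      exact this.eventually_const_lt (hm.lt_measureReal_closedBall hr'1)
    filter_upwards [h1, h2, hφ, he0, heγ, hδ0.eventually_le_const hδ₀] with i h1 h2 hφ he0 heγ hδi
    by_contra! hle
    have hle' : a₀ ≤ s i := hle
    obtain ⟨hpd, hs0, -, -, hle2, -⟩ := hm.minimizer_spec he0 heγ hφ
    have hi1 : e i ≤ 1 := (heγ.trans hm.γ_lt_one).le
    have := isProbabilityMeasure_contaminate (P := P) (x := x) he0 hi1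
    have h3 := (hsand (T i) (C i) a (δ i) (isUnit_iff_ne_zero.2 hpd.det_pos.ne') hδi
      (hbound i).2.1 (hbound i).2.2 (by
        rw [mul_div_cancel_right₀ _ hα0.ne', sub_self, abs_zero]; exact (hbound i).1)).1
    have h4 : Metric.closedBall 0 r' ⊆ {y | mahalanobisSq (T i) (C i) y < s i ^ 2} := fun y hy => by
      have hy' : mahalanobisSq (T i) (C i) y ≤ a ^ 2 :=
        h3 (Metric.closedBall_subset_closedBall h1.le hy)
      have hs0' : 0 ≤ s i := hs0
      exact hy'.trans_lt (pow_lt_pow_left₀ (ha2.trans_le hle') ha0.le two_ne_zero)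
    have h5 := measureReal_mono (μ := contaminate P x (e i)) h4
    have h6 := measureReal_contaminate (P := P) (x := x) he0 hi1 (hmeas r')
    have h7 : 0 ≤ e i * (Metric.closedBall (0 : EuclideanSpace ℝ (Fin k)) r').indicator
        (1 : EuclideanSpace ℝ (Fin k) → ℝ) x :=
      mul_nonneg he0 (Set.indicator_nonneg (fun _ _ => zero_le_one) _)
    linarith

/-- Replacing the ball of radius `r` by a set that differs from it only in a thin shell changes
`P`-integrals as if the density were constant, equal to its value at the boundary. -/
lemma abs_setIntegral_sub_le (hm : RadialModel k γ h P r) {K η : ℝ} (hK : 0 ≤ K) (hη : 0 < η) :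
    ∃ τ₀ > 0, ∀ τ, 0 ≤ τ → τ ≤ τ₀ → ∀ S : Set (EuclideanSpace ℝ (Fin k)), MeasurableSet S →
      Metric.closedBall 0 (r - τ) ⊆ S → S ⊆ Metric.closedBall 0 (r + τ) →
      ∀ g : EuclideanSpace ℝ (Fin k) → ℝ, Continuous g → (∀ y, ‖y‖ ≤ r + τ → |g y| ≤ K) →
      |∫ y in S, g y ∂P - ∫ y in Metric.closedBall 0 r, g y ∂P
        - h (r ^ 2) * ((∫ y in S, g y) - ∫ y in Metric.closedBall 0 r, g y)| ≤ η * τ := by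
  have hr := hm.r_pos
  have hA := sphereArea_pos (k := k)
  have hk : (0 : ℝ) < k := by exact_mod_cast Nat.pos_of_ne_zero (NeZero.ne k)
  set L := sphereArea k / k * (2 * k * (2 * r) ^ (k - 1)) with hL
  have hL0 : 0 < L := by positivity
  set η' := η / (2 * (K + 1) * L) with hη'
  have hη'0 : 0 < η' := by positivity
  obtain ⟨d, hd, hcont⟩ := Metric.continuousAt_iff.1 hm.h_cont η' hη'0
  refine ⟨min r (d / (6 * r)), by positivity, fun τ hτ0 hτ S hS hS1 hS2 g hg hgK => ?_⟩
  have hτr : τ ≤ r := hτ.trans (min_le_left _ _)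
  have hτd : 3 * r * τ < d := by
    have := hτ.trans (min_le_right _ _)
    rw [le_div_iff₀ (by positivity)] at this
    linarith
  have hB : MeasurableSet (Metric.closedBall (0 : EuclideanSpace ℝ (Fin k)) r) :=
    Metric.isClosed_closedBall.measurableSet
  set U := Metric.closedBall (0 : EuclideanSpace ℝ (Fin k)) (r + τ) with hU
  have hBU : Metric.closedBall (0 : EuclideanSpace ℝ (Fin k)) r ⊆ U :=
    Metric.closedBall_subset_closedBall (by linarith)
  have hgU : IntegrableOn g U := hg.continuousOn.integrableOn_compact (isCompact_closedBall _ _)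
  have hhgU : IntegrableOn (fun y => h (‖y‖ ^ 2) * g y) U := by
    refine Measure.integrableOn_of_bounded (M := h 0 * K) measure_closedBall_lt_top.ne
      (hm.measurable_density.mul hg.measurable).aestronglyMeasurable ?_
    refine (ae_restrict_iff' Metric.isClosed_closedBall.measurableSet).2 (ae_of_all _ fun y hy => ?_)
    have hy' : ‖y‖ ≤ r + τ := by simpa [hU] using hy
    rw [Real.norm_eq_abs, abs_mul, abs_of_nonneg (hm.density_nonneg y)]
    exact mul_le_mul (hm.density_le y) (hgK y hy') (abs_nonneg _)
      (hm.h_nonneg 0 le_rfl)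
  set F := fun y : EuclideanSpace ℝ (Fin k) => (h (‖y‖ ^ 2) - h (r ^ 2)) * g y with hF
  have hFU : IntegrableOn F U := by
    have : F = fun y => h (‖y‖ ^ 2) * g y - h (r ^ 2) * g y := by ext y; simp only [hF]; ring
    rw [this]; exact hhgU.sub (hgU.const_mul _)
  have hkey : ∀ S' ⊆ U, MeasurableSet S' →
      ∫ y in S', F y = ∫ y in S', g y ∂P - h (r ^ 2) * ∫ y in S', g y := fun S' hS' hS'm => by
    rw [hm.setIntegral_eq hS'm, ← integral_const_mul]
    have e1 : ∫ y in S', (h (‖y‖ ^ 2) * g y - h (r ^ 2) * g y) = _ :=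
      integral_sub (hhgU.mono_set hS') ((hgU.mono_set hS').const_mul _)
    rw [← e1]
    congr 1; ext y; simp only [hF]; ring
  have h1 : ∫ y in S, g y ∂P - ∫ y in Metric.closedBall 0 r, g y ∂P
        - h (r ^ 2) * ((∫ y in S, g y) - ∫ y in Metric.closedBall 0 r, g y)
      = (∫ y in S \ Metric.closedBall 0 r, F y) - ∫ y in Metric.closedBall 0 r \ S, F y := by
    rw [← setIntegral_sub_setIntegral hS hB hS2 hBU hFU, hkey S hS2 hS, hkey _ hBU hB]; ring
  set V := U \ Metric.closedBall (0 : EuclideanSpace ℝ (Fin k)) (r - τ) with hV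
  have hvol : (volume : Measure (EuclideanSpace ℝ (Fin k))).real V ≤ L * τ := by
    have e1 := measureReal_sdiff (μ := (volume : Measure (EuclideanSpace ℝ (Fin k))))
      (Metric.closedBall_subset_closedBall (by linarith) :
        Metric.closedBall (0 : EuclideanSpace ℝ (Fin k)) (r - τ) ⊆ U)
      Metric.isClosed_closedBall.measurableSet measure_closedBall_lt_top.ne
    rw [hV, e1, volume_real_closedBall (by linarith), volume_real_closedBall (by linarith)]
    have e2 := abs_pow_sub_pow_le (r + τ) (r - τ) k
    have e3 : |r + τ - (r - τ)| = 2 * τ := by rw [abs_of_nonneg] <;> linarith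
    have e4 : max |r + τ| |r - τ| ≤ 2 * r := by
      refine max_le ?_ ?_ <;> rw [abs_of_nonneg] <;> linarith
    calc _ = sphereArea k / k * ((r + τ) ^ k - (r - τ) ^ k) := by ring
      _ ≤ sphereArea k / k * (2 * τ * k * (2 * r) ^ (k - 1)) := by
          gcongr
          refine (le_abs_self _).trans (e2.trans ?_)
          rw [e3]
          gcongr
      _ = _ := by rw [hL]; ring
  have hVfin : (volume : Measure (EuclideanSpace ℝ (Fin k))) V ≠ ⊤ :=
    ((measure_mono Set.sdiff_subset).trans_lt measure_closedBall_lt_top).ne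
  have hFV : ∀ y ∈ V, ‖F y‖ ≤ η' * K := fun y hy => by
    have hy1 : ‖y‖ ≤ r + τ := by simpa [hU] using hy.1
    have hy2 : r - τ < ‖y‖ := by simpa using hy.2
    have hdist : dist (‖y‖ ^ 2) (r ^ 2) < d := by
      rw [Real.dist_eq, abs_lt]
      constructor <;> nlinarith [norm_nonneg y]
    have := (hcont hdist).le
    rw [Real.dist_eq] at this
    rw [hF, Real.norm_eq_abs, abs_mul]
    exact mul_le_mul this (hgK y hy1) (abs_nonneg _) hη'0.le
  have hpart : ∀ W ⊆ V, ‖∫ y in W, F y‖ ≤ η' * K * (L * τ) := fun W hW => by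
    refine (norm_setIntegral_le_of_norm_le_const (C := η' * K) (hVfin.lt_top.trans_le' (measure_mono hW))
      fun y hy => hFV y (hW hy)).trans ?_
    gcongr
    exact (measureReal_mono hW hVfin).trans hvol
  rw [h1, ← Real.norm_eq_abs]
  refine (norm_sub_le _ _).trans ?_
  have p1 := hpart (S \ Metric.closedBall 0 r) fun y hy =>
    ⟨hS2 hy.1, fun hy' => hy.2 (Metric.closedBall_subset_closedBall (by linarith) hy')⟩
  have p2 := hpart (Metric.closedBall 0 r \ S) fun y hy => ⟨hBU hy.1, fun hy' => hy.2 (hS1 hy')⟩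
  have p3 : 2 * (η' * K * (L * τ)) ≤ η * τ := by
    have : η' * (2 * (K + 1) * L) = η := by rw [hη']; field_simp
    have h5 : 0 ≤ η' * L * τ := by positivity
    calc 2 * (η' * K * (L * τ)) ≤ η' * (2 * (K + 1) * L) * τ := by nlinarith
      _ = _ := by rw [this]
  linarith

end RadialModel

/-! ### First-order expansion of the determinant -/

/-- The determinant has derivative `tr` at the identity, in asymptotic form. -/
lemma isLittleO_det_one_add {ι : Type*} {l : Filter ι} {H : ι → Matrix (Fin k) (Fin k) ℝ}
    {N : ι → ℝ} (hN : Tendsto N l (𝓝 0)) (hH : ∀ p q, (fun i => H i p q) =O[l] N) :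
    (fun i => (1 + H i).det - 1 - (H i).trace) =o[l] N := by
  let f : (Fin k → Fin k → ℝ) → ℝ := fun H => (1 + Matrix.of H).det
  have hf : DifferentiableAt ℝ f 0 := by
    simp only [f, Matrix.det_apply', Matrix.add_apply, Matrix.of_apply]
    fun_prop
  have hL : ∀ G, fderiv ℝ f 0 G = (Matrix.of G).trace := fun G => by
    have h1 : HasDerivAt (fun t : ℝ => t • G) G 0 := by
      simpa using (hasDerivAt_id (0 : ℝ)).smul_const G
    have h2 : HasDerivAt (fun t : ℝ => f (t • G)) (fderiv ℝ f 0 G) 0 := by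
      have hf' : HasFDerivAt f (fderiv ℝ f 0) ((0 : ℝ) • G) := by
        rw [zero_smul]; exact hf.hasFDerivAt
      exact hf'.comp_hasDerivAt 0 h1
    set q : Polynomial ℝ := (1 + (Polynomial.X : Polynomial ℝ) • (Matrix.of G).map ⇑Polynomial.C).det.divX.divX
    have h3 : (fun t : ℝ => f (t • G))
        = fun t => 1 + (Matrix.of G).trace * t + Polynomial.eval t q * t ^ 2 := by
      ext t; exact Matrix.det_one_add_smul t (Matrix.of G)
    have h4 : HasDerivAt (fun t : ℝ => 1 + (Matrix.of G).trace * t + Polynomial.eval t q * t ^ 2)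
        ((Matrix.of G).trace * 1 + (Polynomial.eval 0 q.derivative * 0 ^ 2
          + Polynomial.eval 0 q * (↑2 * 0 ^ (2 - 1)))) 0 :=
      (((hasDerivAt_id (0 : ℝ)).const_mul _).const_add 1).add
        ((q.hasDerivAt 0).mul (hasDerivAt_pow 2 0))
    rw [h3] at h2
    simpa using h2.unique h4
  set H' : ι → Fin k → Fin k → ℝ := fun i p q => H i p q with hH'def
  have hH' : H' =O[l] N := Asymptotics.isBigO_pi.2 fun p => Asymptotics.isBigO_pi.2 fun q => hH p q
  have hH0 : Tendsto H' l (𝓝 0) := hH'.trans_tendsto hN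
  have h1 : (fun i => f (H' i) - f 0 - fderiv ℝ f 0 (H' i - 0)) =o[l] fun i => H' i - 0 :=
    hf.hasFDerivAt.isLittleO.comp_tendsto hH0
  have h3 : f 0 = 1 := by
    have : Matrix.of (0 : Fin k → Fin k → ℝ) = 0 := rfl
    simp only [f, this, add_zero, Matrix.det_one]
  simp only [sub_zero, hL, h3] at h1
  exact h1.trans_isBigO hH'

/-! ### Mass, barycentre and second moments of a minimizing ellipsoid -/

/-- Lebesgue moments of an ellipsoid, relative to those of a ball of radius `r`. -/
lemma ellipsoid_moments [NeZero k] {C : Matrix (Fin k) (Fin k) ℝ} (hC : C.PosDef) {r s : ℝ}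
    (hr : 0 < r) (hs : 0 ≤ s) (m : EuclideanSpace ℝ (Fin k)) :
    ∃ w : ℝ, 0 ≤ w ∧ w ^ 2 = ((s ^ 2 / r ^ 2) • C).det ∧
      volume.real (ellipsoid m C s) = w * (sphereArea k * r ^ k / k) ∧
      (∀ p, ∫ y in ellipsoid m C s, (y p - m p) = 0) ∧
      ∀ p q, ∫ y in ellipsoid m C s, (y p - m p) * (y q - m q)
        = w * (sphereArea k * r ^ k / k) * (s ^ 2 / (k + 2)) * C p q := by
  obtain ⟨B, d, hd, hdet, hB, hg⟩ := exists_normalizing_map hC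
  have hk : (0 : ℝ) < k := by exact_mod_cast Nat.pos_of_ne_zero (NeZero.ne k)
  set ρ := Real.sqrt d * s with hρ
  have hρ0 : 0 ≤ ρ := by positivity
  have hρ2 : ρ ^ 2 = d * s ^ 2 := by rw [hρ, mul_pow, Real.sq_sqrt hd.le]
  have hE : ellipsoid m C s = {y | ‖B y - B m‖ ≤ ρ} := by
    ext y
    rw [ellipsoid_eq]
    show mahalanobisSq m C y ≤ s ^ 2 ↔ ‖B y - B m‖ ≤ ρ
    rw [← sq_le_sq₀ (norm_nonneg _) hρ0, norm_sq_eq_mahalanobisSq hg, hρ2,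
      mul_le_mul_iff_right₀ hd]
  have hρk : (ρ / r) ^ k * r ^ k = ρ ^ k := by rw [← mul_pow]; congr 1; field_simp
  refine ⟨(ρ / r) ^ k, by positivity, ?_, ?_, ?_, ?_⟩
  · rw [Matrix.det_smul, Fintype.card_fin, ← hdet, ← mul_pow, ← pow_mul, mul_comm k 2, pow_mul,
      div_pow, hρ2]
    congr 1; ring
  · rw [hE, volume_real_ellipsoid hB m hρ0, ← hρk]; ring
  · intro p
    rw [hE]; exact setIntegral_ellipsoid_coord hB m ρ p
  · intro p q
    have hCi : IsUnit C.det := isUnit_iff_ne_zero.2 hC.det_pos.ne'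
    have hinv : (gram B)⁻¹ = d⁻¹ • C := by
      refine Matrix.inv_eq_left_inv ?_
      rw [hg, Matrix.smul_mul, Matrix.mul_smul, smul_smul, inv_mul_cancel₀ hd.ne', one_smul,
        Matrix.mul_nonsing_inv _ hCi]
    rw [hE, setIntegral_ellipsoid_coord_mul hB m hρ0, hinv, Matrix.smul_apply, smul_eq_mul, pow_add,
      hρ2, ← hρk]
    field_simp

lemma volume_mahalanobisSq_eq [NeZero k] {C : Matrix (Fin k) (Fin k) ℝ} (hC : C.PosDef)
    (m : EuclideanSpace ℝ (Fin k)) (t : ℝ) : volume {y | mahalanobisSq m C y = t} = 0 := by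
  obtain ⟨B, d, hd, -, hB, hg⟩ := exists_normalizing_map hC
  have h1 := volume_setOf_norm_sq_eq (B := B) (fun h => by simp [h] at hB) (B m) (d * t)
  convert h1 using 2
  ext y
  show mahalanobisSq m C y = t ↔ ‖B y - B m‖ ^ 2 = d * t
  rw [norm_sq_eq_mahalanobisSq hg]
  exact ⟨fun h => by rw [h], fun h => mul_left_cancel₀ hd.ne' h⟩

lemma measurableSet_ellipsoid (m : EuclideanSpace ℝ (Fin k)) (C : Matrix (Fin k) (Fin k) ℝ)
    (s : ℝ) : MeasurableSet (ellipsoid m C s) :=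
  measurableSet_le (continuous_mahalanobisSq m C).measurable measurable_const

namespace RadialModel

variable [NeZero k] {γ r : ℝ} {h : ℝ → ℝ} {P : Measure (EuclideanSpace ℝ (Fin k))}
  [IsProbabilityMeasure P]

/-- A minimizer is `P`-almost surely the indicator of its ellipsoid, so that only its value at the
contaminating point remains undetermined. -/
lemma integral_mul_minimizer (hm : RadialModel k γ h P r) {x : EuclideanSpace ℝ (Fin k)} {ε : ℝ}
    (h0 : 0 ≤ ε) (hε : ε < γ) {φ : EuclideanSpace ℝ (Fin k) → ℝ}
    (hφ : IsMinimizer γ (contaminate P x ε) φ) {R : ℝ}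
    (hR : ellipsoid (trimmedMean (contaminate P x ε) φ) (trimmedCov (contaminate P x ε) φ)
      (trimmedRadius γ (contaminate P x ε) φ) ⊆ Metric.closedBall 0 R)
    {g : EuclideanSpace ℝ (Fin k) → ℝ} (hg : Continuous g) :
    ∫ y, g y * φ y ∂(contaminate P x ε)
      = (1 - ε) * ∫ y in ellipsoid (trimmedMean (contaminate P x ε) φ)
          (trimmedCov (contaminate P x ε) φ) (trimmedRadius γ (contaminate P x ε) φ), g y ∂P
        + ε * (g x * φ x) := by
  have h1 : ε < 1 := hε.trans hm.γ_lt_one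
  obtain ⟨hpd, -, -, -, -, hone, hzero⟩ := hm.minimizer_spec h0 hε hφ
  set m := trimmedMean (contaminate P x ε) φ
  set C := trimmedCov (contaminate P x ε) φ
  set s := trimmedRadius γ (contaminate P x ε) φ
  have hEm := measurableSet_ellipsoid m C s
  have hnull : ∀ᵐ y ∂P, mahalanobisSq m C y ≠ s ^ 2 := by
    rw [ae_iff]
    have := hm.absolutelyContinuous (volume_mahalanobisSq_eq hpd m (s ^ 2))
    simpa using this
  have hae : (fun y => g y * φ y) =ᵐ[P] (ellipsoid m C s).indicator g := by
    filter_upwards [hnull, (ae_of_ae_contaminate h1 hone).1, (ae_of_ae_contaminate h1 hzero).1]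
      with y hne hone hzero
    rcases lt_or_gt_of_ne hne with hlt | hgt
    · rw [Set.indicator_of_mem (show y ∈ ellipsoid m C s from hlt.le), hone hlt, mul_one]
    · rw [Set.indicator_of_notMem (show y ∉ ellipsoid m C s from not_le.2 hgt), hzero hgt, mul_zero]
  have hgE : IntegrableOn g (ellipsoid m C s) P :=
    (hg.continuousOn.integrableOn_compact (isCompact_closedBall 0 R)).mono_set hR
  have hint : Integrable (fun y => g y * φ y) P := by
    rw [integrable_congr hae]; exact hgE.integrable_indicator hEm
  rw [integral_contaminate h0 h1.le hint, integral_congr_ae hae, integral_indicator hEm]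

/-- The estimating equations satisfied by a minimizer: mass, mean and covariance. -/
lemma estimating_equations (hm : RadialModel k γ h P r) {x : EuclideanSpace ℝ (Fin k)} {ε : ℝ}
    (h0 : 0 ≤ ε) (hε : ε < γ) {φ : EuclideanSpace ℝ (Fin k) → ℝ}
    (hφ : IsMinimizer γ (contaminate P x ε) φ) {R : ℝ}
    {m : EuclideanSpace ℝ (Fin k)} {C : Matrix (Fin k) (Fin k) ℝ} {s : ℝ}
    (hmdef : m = trimmedMean (contaminate P x ε) φ) (hCdef : C = trimmedCov (contaminate P x ε) φ)
    (hsdef : s = trimmedRadius γ (contaminate P x ε) φ)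
    (hR : ellipsoid m C s ⊆ Metric.closedBall 0 R) :
    γ = (1 - ε) * P.real (ellipsoid m C s) + ε * φ x ∧
    (∀ p, 0 = (1 - ε) * ∫ y in ellipsoid m C s, (y p - m p) ∂P + ε * (φ x * (x p - m p))) ∧
    ∀ p q, γ * C p q = (1 - ε) * ∫ y in ellipsoid m C s, (y p - m p) * (y q - m q) ∂P
      + ε * (φ x * ((x p - m p) * (x q - m q))) := by
  have hI := fun g => hm.integral_mul_minimizer h0 hε hφ (R := R) (by rwa [← hmdef, ← hCdef, ← hsdef])
    (g := g)
  rw [← hmdef, ← hCdef, ← hsdef] at hI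
  have hmass := (hm.minimizer_spec h0 hε hφ).2.2.1
  have := isProbabilityMeasure_contaminate (P := P) (x := x) h0 (hε.trans hm.γ_lt_one).le
  have hγ := hm.γ_pos
  refine ⟨?_, fun p => ?_, fun p q => ?_⟩
  · have := hI (fun _ => 1) continuous_const
    simpa [hmass] using this
  · have h1 := hφ.1.integral_smul_sub hγ
    rw [← hmdef] at h1
    have h2 : ∫ y, (y p - m p) * φ y ∂(contaminate P x ε) = 0 := by
      have h3 : Integrable (fun y => φ y • (y - m)) (contaminate P x ε) := by
        simp_rw [smul_sub]
        exact hφ.1.integrable_smul.sub (hφ.1.integrable.smul_const _)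
      have h4 := (EuclideanSpace.proj (𝕜 := ℝ) p).integral_comp_comm h3
      rw [h1, map_zero] at h4
      rw [← h4]
      congr 1; ext y; simp [mul_comm]
    rw [hI (fun y => y p - m p) (by fun_prop)] at h2
    rw [← h2]; ring
  · have h1 : γ * C p q = ∫ y, (y p - m p) * (y q - m q) * φ y ∂(contaminate P x ε) := by
      rw [hCdef, trimmedCov, Matrix.of_apply, hmass, ← hmdef, ← mul_assoc, mul_inv_cancel₀ hγ.ne',
        one_mul]
    rw [h1, hI (fun y => (y p - m p) * (y q - m q)) (by fun_prop)]; ring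

end RadialModel

/-! ### First-order expansion of the estimating equations -/

lemma isLittleO_mul_of_tendsto {ι : Type*} {l : Filter ι} {f g N : ι → ℝ} (hf : f =O[l] N)
    (hg : Tendsto g l (𝓝 0)) : (fun i => f i * g i) =o[l] N := by
  simpa using hf.mul_isLittleO ((Asymptotics.isLittleO_one_iff ℝ).2 hg)

lemma setIntegral_closedBall_sub {μ : Measure (EuclideanSpace ℝ (Fin k))}
    [IsFiniteMeasureOnCompacts μ] {r : ℝ}
    (h0 : ∀ p, ∫ y in Metric.closedBall (0 : EuclideanSpace ℝ (Fin k)) r, y p ∂μ = 0)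
    (m : EuclideanSpace ℝ (Fin k)) (p q : Fin k) :
    ∫ y in Metric.closedBall (0 : EuclideanSpace ℝ (Fin k)) r, (y p - m p) ∂μ
      = -(μ.real (Metric.closedBall 0 r) * m p) ∧
    ∫ y in Metric.closedBall (0 : EuclideanSpace ℝ (Fin k)) r, (y p - m p) * (y q - m q) ∂μ
      = (∫ y in Metric.closedBall (0 : EuclideanSpace ℝ (Fin k)) r, y p * y q ∂μ)
        + μ.real (Metric.closedBall 0 r) * (m p * m q) := by
  have hint : ∀ g : EuclideanSpace ℝ (Fin k) → ℝ, Continuous g →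
      IntegrableOn g (Metric.closedBall 0 r) μ := fun g hg =>
    hg.continuousOn.integrableOn_compact (isCompact_closedBall 0 r)
  constructor
  · rw [integral_sub (hint _ (by fun_prop)) (hint _ (by fun_prop)), h0, setIntegral_const,
      smul_eq_mul]
    ring
  · have h1 : ∀ y : EuclideanSpace ℝ (Fin k), (y p - m p) * (y q - m q)
        = (y p * y q + m p * m q) - (m q * y p + m p * y q) := fun y => by ring
    simp_rw [h1]
    rw [integral_sub (hint _ (by fun_prop)) (hint _ (by fun_prop)),
      integral_add (hint _ (by fun_prop)) (hint _ (by fun_prop)),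
      integral_add (hint _ (by fun_prop)) (hint _ (by fun_prop)), 
      integral_const_mul (m q) (fun y : EuclideanSpace ℝ (Fin k) => y p),
      integral_const_mul (m p) (fun y : EuclideanSpace ℝ (Fin k) => y q), h0, h0, setIntegral_const, smul_eq_mul]
    ring

/-- Distance of the parameters of the trimming function `φ ε` at `(1 - ε) P + ε δ_x` from those of
the centred ball, plus `ε`. All expansions below hold up to terms of smaller order. -/
noncomputable def deviation (γ r : ℝ) (h : ℝ → ℝ) (P : Measure (EuclideanSpace ℝ (Fin k)))
    (x : EuclideanSpace ℝ (Fin k)) (φ : ℝ → EuclideanSpace ℝ (Fin k) → ℝ) (ε : ℝ) : ℝ :=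
  ‖trimmedMean (contaminate P x ε) (φ ε)‖
    + entrySum (trimmedCov (contaminate P x ε) (φ ε)
        - alpha k γ r h ^ 2 • (1 : Matrix (Fin k) (Fin k) ℝ))
    + |trimmedRadius γ (contaminate P x ε) (φ ε) - r / alpha k γ r h| + ε

namespace RadialModel

variable [NeZero k] {γ r : ℝ} {h : ℝ → ℝ} {P : Measure (EuclideanSpace ℝ (Fin k))}

lemma isLittleO_setIntegral (hm : RadialModel k γ h P r) {ι : Type*} {l : Filter ι} {N : ι → ℝ}
    (hN : Tendsto N l (𝓝 0)) (hN0 : ∀ᶠ i in l, 0 ≤ N i) {K : ℝ} (hK : 0 < K)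
    {E : ι → Set (EuclideanSpace ℝ (Fin k))}
    (hE : ∀ᶠ i in l, MeasurableSet (E i) ∧ Metric.closedBall 0 (r - K * N i) ⊆ E i ∧
      E i ⊆ Metric.closedBall 0 (r + K * N i))
    {g : ι → EuclideanSpace ℝ (Fin k) → ℝ} (hg : ∀ i, Continuous (g i)) {M : ℝ}
    (hgM : ∀ᶠ i in l, ∀ y, ‖y‖ ≤ 2 * r → |g i y| ≤ M) :
    (fun i => ∫ y in E i, g i y ∂P - ∫ y in Metric.closedBall 0 r, g i y ∂P
      - h (r ^ 2) * ((∫ y in E i, g i y) - ∫ y in Metric.closedBall 0 r, g i y)) =o[l] N := by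
  refine Asymptotics.IsLittleO.of_bound fun c hc => ?_
  obtain ⟨τ₀, hτ₀, H⟩ := hm.abs_setIntegral_sub_le (abs_nonneg M) (div_pos hc hK)
  have hKN : Tendsto (fun i => K * N i) l (𝓝 0) := by simpa using hN.const_mul K
  filter_upwards [hN0, hE, hgM, hKN.eventually_le_const hτ₀, hKN.eventually_le_const hm.r_pos]
    with i hN0 hE hgM hτ hτr
  have := H (K * N i) (by positivity) hτ (E i) hE.1 hE.2.1 hE.2.2 (g i) (hg i)
    fun y hy => (hgM y (by linarith)).trans (le_abs_self M)
  rw [Real.norm_eq_abs, Real.norm_eq_abs, abs_of_nonneg hN0]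
  refine this.trans_eq ?_
  field_simp

variable [IsProbabilityMeasure P] {x : EuclideanSpace ℝ (Fin k)}
  {φ : ℝ → EuclideanSpace ℝ (Fin k) → ℝ}

lemma tendsto_deviation (hm : RadialModel k γ h P r)
    (hφ : ∀ᶠ ε in 𝓝[>] (0 : ℝ), IsMinimizer γ (contaminate P x ε) (φ ε)) :
    Tendsto (deviation γ r h P x φ) (𝓝[>] 0) (𝓝 0) := by
  have he : Tendsto (fun ε : ℝ => ε) (𝓝[>] 0) (𝓝 0) := tendsto_id.mono_left nhdsWithin_le_nhds
  have he0 : ∀ᶠ ε in 𝓝[>] (0 : ℝ), 0 ≤ ε := by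
    filter_upwards [self_mem_nhdsWithin] with ε hε using le_of_lt hε
  obtain ⟨hT, hC⟩ := hm.tendsto_mean_cov x he he0 hφ
  have hs := hm.tendsto_radius x he he0 hφ
  have h1 := (continuous_entrySum.tendsto _).comp
    (hC.sub_const (alpha k γ r h ^ 2 • (1 : Matrix (Fin k) (Fin k) ℝ)))
  have h2 := ((hT.norm.add h1).add (hs.sub_const (r / alpha k γ r h)).abs).add he
  have h3 : entrySum (0 : Matrix (Fin k) (Fin k) ℝ) = 0 := by simp [entrySum]
  simp only [sub_self, norm_zero, abs_zero, add_zero, h3] at h2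
  exact h2

lemma eventually_sandwich (hm : RadialModel k γ h P r) (hx : ‖x‖ ≠ r)
    (hφ : ∀ᶠ ε in 𝓝[>] (0 : ℝ), IsMinimizer γ (contaminate P x ε) (φ ε)) :
    ∃ K > 0, ∀ᶠ ε in 𝓝[>] (0 : ℝ), φ ε x = inBall r x ∧
      Metric.closedBall 0 (r - K * deviation γ r h P x φ ε)
        ⊆ ellipsoid (trimmedMean (contaminate P x ε) (φ ε)) (trimmedCov (contaminate P x ε) (φ ε))
          (trimmedRadius γ (contaminate P x ε) (φ ε)) ∧
      ellipsoid (trimmedMean (contaminate P x ε) (φ ε)) (trimmedCov (contaminate P x ε) (φ ε))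
          (trimmedRadius γ (contaminate P x ε) (φ ε))
        ⊆ Metric.closedBall 0 (r + K * deviation γ r h P x φ ε) := by
  have hN := hm.tendsto_deviation hφ
  obtain ⟨K, δ₀, hK, hδ₀, hsand⟩ := ellipsoid_sandwich (k := k) hm.r_pos hm.alpha_pos
  refine ⟨K, hK, ?_⟩
  have hKN : Tendsto (fun ε => K * deviation γ r h P x φ ε) (𝓝[>] 0) (𝓝 0) := by
    simpa using hN.const_mul K
  have he : Tendsto (fun ε : ℝ => ε) (𝓝[>] 0) (𝓝 0) := tendsto_id.mono_left nhdsWithin_le_nhds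
  have hs := hm.tendsto_radius x he
    (by filter_upwards [self_mem_nhdsWithin] with ε hε using le_of_lt hε) hφ
  have hρ0 : 0 < r / alpha k γ r h := div_pos hm.r_pos hm.alpha_pos
  have hsε : ∀ᶠ ε in 𝓝[>] (0 : ℝ), 0 < trimmedRadius γ (contaminate P x ε) (φ ε) - ε := by
    have := hs.sub he
    rw [sub_zero] at this
    exact this.eventually_const_lt hρ0
  have hgap : ∀ᶠ ε in 𝓝[>] (0 : ℝ), K * deviation γ r h P x φ ε < |‖x‖ - r| :=
    hKN.eventually_lt_const (abs_pos.2 (sub_ne_zero.2 hx))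
  filter_upwards [hφ, self_mem_nhdsWithin, he.eventually_lt_const hm.γ_pos,
    hN.eventually_le_const hδ₀, hsε, hgap] with ε hφ hε hεγ hδ hsε hgap
  have hε0 : 0 < ε := hε
  obtain ⟨hpd, hs0, -, -, -, hone, hzero⟩ := hm.minimizer_spec hε0.le hεγ hφ
  have hε1 : ε < 1 := hεγ.trans hm.γ_lt_one
  have hone' := (ae_of_ae_contaminate hε1 hone).2 hε0
  have hzero' := (ae_of_ae_contaminate hε1 hzero).2 hε0
  unfold deviation at hδ hgap ⊢
  set m := trimmedMean (contaminate P x ε) (φ ε)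
  set C := trimmedCov (contaminate P x ε) (φ ε)
  set s := trimmedRadius γ (contaminate P x ε) (φ ε)
  set α := alpha k γ r h
  have b1 := norm_nonneg m
  have b2 := entrySum_nonneg (C - α ^ 2 • (1 : Matrix (Fin k) (Fin k) ℝ))
  have b3 := abs_nonneg (s - r / α)
  set δ := ‖m‖ + entrySum (C - α ^ 2 • (1 : Matrix (Fin k) (Fin k) ℝ)) + |s - r / α| + ε with hδdef
  have hCu : IsUnit C.det := isUnit_iff_ne_zero.2 hpd.det_pos.ne'
  have S1 := hsand m C s δ hCu hδ (by linarith) (by linarith) (by linarith)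
  -- the slightly smaller ellipsoid controls the value at points strictly inside the ball
  have S2 := hsand m C (s - ε) δ hCu hδ (by linarith) (by linarith) (by
    have h1 : s - ε - r / α = (s - r / α) - ε := by ring
    rw [h1]
    refine (abs_sub _ _).trans ?_
    rw [abs_of_pos hε0]; linarith)
  refine ⟨?_, S1⟩
  rcases lt_or_gt_of_ne hx with hlt | hgt
  · rw [inBall, if_pos hlt.le]
    refine hone' ?_
    rw [abs_of_neg (by linarith)] at hgap
    have h1 : x ∈ ellipsoid m C (s - ε) := S2.1 (by rw [mem_closedBall_zero_iff]; linarith)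
    have h2 : mahalanobisSq m C x ≤ (s - ε) ^ 2 := h1
    exact h2.trans_lt (pow_lt_pow_left₀ (by linarith) hsε.le two_ne_zero)
  · rw [inBall, if_neg (not_le.2 hgt)]
    refine hzero' ?_
    rw [abs_of_pos (by linarith)] at hgap
    by_contra! hle
    have h1 : x ∈ ellipsoid m C s := hle
    have h2 := S1.2 h1
    rw [mem_closedBall_zero_iff] at h2
    linarith

end RadialModel

/-- Linearization of the estimating equations. Here `w` is the relative Lebesgue measure of the
ellipsoid, and `b`, `c` are the boundary density times the mass and the second moment of the ball
under Lebesgue measure. -/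
lemma linearize {ι : Type*} {l : Filter ι} {e N w s : ι → ℝ} {T : ι → Fin k → ℝ}
    {C : ι → Matrix (Fin k) (Fin k) ℝ} {α r γ a b c : ℝ} {x : Fin k → ℝ} (hα : 0 < α) (hr : 0 < r)
    (hc : c = b * r ^ 2 / (k + 2)) (hN : Tendsto N l (𝓝 0)) (he : e =O[l] N)
    (hT : ∀ p, (fun i => T i p) =O[l] N)
    (hD : ∀ p q, (fun i => C i p q - α ^ 2 * (1 : Matrix (Fin k) (Fin k) ℝ) p q) =O[l] N)
    (hs : (fun i => s i - r / α) =O[l] N)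
    (hw0 : ∀ᶠ i in l, 0 ≤ w i) (hw : ∀ᶠ i in l, w i ^ 2 = ((s i ^ 2 / r ^ 2) • C i).det)
    {R₀ : ι → ℝ} {R₁ : Fin k → ι → ℝ} {R₂ : Fin k → Fin k → ι → ℝ} (hR₀ : R₀ =o[l] N)
    (hR₁ : ∀ p, R₁ p =o[l] N) (hR₂ : ∀ p q, R₂ p q =o[l] N)
    (hmass : ∀ᶠ i in l, γ = (1 - e i) * (γ + b * (w i - 1) + R₀ i) + e i * a)
    (hmean : ∀ p, ∀ᶠ i in l, 0 = (1 - e i) * (-(γ - b) * T i p + R₁ p i)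
      + e i * (a * (x p - T i p)))
    (hcov : ∀ p q, ∀ᶠ i in l, γ * C i p q = (1 - e i) *
      (γ * α ^ 2 * (1 : Matrix (Fin k) (Fin k) ℝ) p q + (γ - b) * (T i p * T i q)
        + b * w i * (s i ^ 2 / (k + 2)) * C i p q - c * (1 : Matrix (Fin k) (Fin k) ℝ) p q
        + R₂ p q i) + e i * (a * ((x p - T i p) * (x q - T i q)))) :
    (fun i => b * (w i - 1) - e i * (γ - a)) =o[l] N ∧
    (∀ p, (fun i => (γ - b) * T i p - e i * (a * x p)) =o[l] N) ∧
    (∀ p q, (fun i => γ * (C i p q - α ^ 2 * (1 : Matrix (Fin k) (Fin k) ℝ) p q)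
      - (e i * (a * (x p * x q) - γ * α ^ 2 * (1 : Matrix (Fin k) (Fin k) ℝ) p q)
        + c * ((w i - 1) * (1 : Matrix (Fin k) (Fin k) ℝ) p q
          + (C i p q - α ^ 2 * (1 : Matrix (Fin k) (Fin k) ℝ) p q) / α ^ 2
          + 2 * α / r * (s i - r / α) * (1 : Matrix (Fin k) (Fin k) ℝ) p q))) =o[l] N) ∧
    (fun i => 2 * (w i - 1)
      - ∑ p, ((C i p p - α ^ 2 * (1 : Matrix (Fin k) (Fin k) ℝ) p p) / α ^ 2
        + 2 * α / r * (s i - r / α))) =o[l] N := by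
  have he0 : Tendsto e l (𝓝 0) := he.trans_tendsto hN
  have hT0 : ∀ p, Tendsto (fun i => T i p) l (𝓝 0) := fun p => (hT p).trans_tendsto hN
  have hs0 : Tendsto (fun i => s i - r / α) l (𝓝 0) := hs.trans_tendsto hN
  -- relative change of the quadratic form of the ellipsoid
  set H : ι → Matrix (Fin k) (Fin k) ℝ := fun i => (s i ^ 2 / r ^ 2) • C i - 1 with hH
  have hHlin : ∀ p q, (fun i => H i p q
      - (C i p q - α ^ 2 * (1 : Matrix (Fin k) (Fin k) ℝ) p q) / α ^ 2
      - 2 * α / r * (s i - r / α) * (1 : Matrix (Fin k) (Fin k) ℝ) p q) =o[l] N := fun p q => by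
    have g1 : Tendsto (fun i => (s i - r / α) * (α ^ 2 / r ^ 2 * (1 : Matrix (Fin k) (Fin k) ℝ) p q))
        l (𝓝 0) := by simpa using hs0.mul_const (α ^ 2 / r ^ 2 * (1 : Matrix (Fin k) (Fin k) ℝ) p q)
    have g2 : Tendsto (fun i => 2 / (α * r) * (s i - r / α) + (s i - r / α) ^ 2 / r ^ 2) l
        (𝓝 0) := by simpa using (hs0.const_mul (2 / (α * r))).add ((hs0.pow 2).div_const (r ^ 2))
    refine ((isLittleO_mul_of_tendsto hs g1).add (isLittleO_mul_of_tendsto (hD p q) g2)).congr_left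
      fun i => ?_
    simp only [hH, Matrix.sub_apply, Matrix.smul_apply, smul_eq_mul]
    field_simp
    ring
  have hHO : ∀ p q, (fun i => H i p q) =O[l] N := fun p q => by
    have h1 := (hD p q).const_mul_left (1 / α ^ 2)
    have h2 := hs.const_mul_left (2 * α / r * (1 : Matrix (Fin k) (Fin k) ℝ) p q)
    refine ((hHlin p q).isBigO.add (h1.add h2)).congr_left fun i => ?_
    ring
  have hH0 : ∀ p q, Tendsto (fun i => H i p q) l (𝓝 0) := fun p q => (hHO p q).trans_tendsto hN
  have hdet := isLittleO_det_one_add hN hHO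
  have hdet' : (fun i => w i ^ 2 - 1 - (H i).trace) =o[l] N := by
    refine hdet.congr' (hw.mono fun i hi => ?_) EventuallyEq.rfl
    simp only [hH, add_sub_cancel, hi]
  have htr : (fun i => (H i).trace) =O[l] N := by
    simp only [Matrix.trace, Matrix.diag_apply]
    exact Asymptotics.IsBigO.fun_sum fun p _ => hHO p p
  have hwO : (fun i => w i - 1) =O[l] N := by
    have h1 : (fun i => w i ^ 2 - 1) =O[l] N :=
      (hdet'.isBigO.add htr).congr_left fun i => by ring
    refine (Asymptotics.IsBigO.of_bound 1 (hw0.mono fun i hi => ?_)).trans h1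
    have h2 : w i ^ 2 - 1 = (w i - 1) * (w i + 1) := by ring
    rw [one_mul, h2, norm_mul, Real.norm_eq_abs (w i + 1), abs_of_nonneg (by linarith)]
    exact le_mul_of_one_le_right (norm_nonneg _) (by linarith)
  have hw1 : Tendsto (fun i => w i - 1) l (𝓝 0) := hwO.trans_tendsto hN
  have hmul : ∀ {f : ι → ℝ}, Tendsto f l (𝓝 0) → (fun i => e i * f i) =o[l] N := fun hf =>
    isLittleO_mul_of_tendsto he hf
  refine ⟨?_, fun p => ?_, fun p q => ?_, ?_⟩
  · have h1 : Tendsto (fun i => b * (w i - 1) + R₀ i) l (𝓝 0) := by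
      simpa using (hw1.const_mul b).add (hR₀.isBigO.trans_tendsto hN)
    refine ((hmul h1).sub hR₀).congr' (hmass.mono fun i hi => ?_) EventuallyEq.rfl
    linear_combination hi
  · have h1 : Tendsto (fun i => (γ - b - a) * T i p - R₁ p i) l (𝓝 0) := by
      simpa using ((hT0 p).const_mul (γ - b - a)).sub ((hR₁ p).isBigO.trans_tendsto hN)
    refine ((hmul h1).add (hR₁ p)).congr' ((hmean p).mono fun i hi => ?_) EventuallyEq.rfl
    linear_combination -hi
  · set d := (1 : Matrix (Fin k) (Fin k) ℝ) p q
    set Y := fun i => (γ - b) * (T i p * T i q) + c * ((w i - 1) * d + H i p q + (w i - 1) * H i p q)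
      + R₂ p q i with hY
    have hY0 : Tendsto Y l (𝓝 0) := by
      have := ((((hT0 p).mul (hT0 q)).const_mul (γ - b)).add
        ((((hw1.mul_const d).add (hH0 p q)).add (hw1.mul (hH0 p q))).const_mul c)).add
        ((hR₂ p q).isBigO.trans_tendsto hN)
      simpa using this
    have hT2 : Tendsto (fun i => a * (T i p * T i q - x p * T i q - T i p * x q)) l (𝓝 0) := by
      have := ((((hT0 p).mul (hT0 q)).sub ((hT0 q).const_mul (x p))).sub
        ((hT0 p).mul_const (x q))).const_mul a
      simpa using this
    refine ((((((isLittleO_mul_of_tendsto (hT p) (hT0 q)).const_mul_left (γ - b)).add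
      ((isLittleO_mul_of_tendsto hwO (hH0 p q)).const_mul_left c)).add (hR₂ p q)).sub
      (hmul hY0)).add (hmul hT2) |>.add ((hHlin p q).const_mul_left c)).congr'
      ((hcov p q).mono fun i hi => ?_) EventuallyEq.rfl
    have h3 : b * w i * (s i ^ 2 / (k + 2)) * C i p q = c * (w i * (H i p q + d)) := by
      simp only [hH, Matrix.sub_apply, Matrix.smul_apply, smul_eq_mul, sub_add_cancel, hc, d]
      field_simp
    rw [h3] at hi
    simp only [hY]
    linear_combination -hi
  · have h1 : (fun i => ∑ p, (H i p p
      - (C i p p - α ^ 2 * (1 : Matrix (Fin k) (Fin k) ℝ) p p) / α ^ 2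
      - 2 * α / r * (s i - r / α) * (1 : Matrix (Fin k) (Fin k) ℝ) p p)) =o[l] N :=
      Asymptotics.IsLittleO.fun_sum fun p _ => hHlin p p
    refine ((hdet'.add h1).sub (isLittleO_mul_of_tendsto hwO hw1)).congr_left fun i => ?_
    have h2 : (H i).trace = ∑ p, H i p p := rfl
    rw [h2]
    simp only [Finset.sum_sub_distrib, Finset.sum_add_distrib, Matrix.one_apply_eq, mul_one]
    ring

lemma isBigO_deviation {γ r : ℝ} {h : ℝ → ℝ} {P : Measure (EuclideanSpace ℝ (Fin k))}
    {x : EuclideanSpace ℝ (Fin k)} {φ : ℝ → EuclideanSpace ℝ (Fin k) → ℝ} {f : ℝ → ℝ} {l : Filter ℝ}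
    (hf : ∀ᶠ ε in l, |f ε| ≤ deviation γ r h P x φ ε) : f =O[l] deviation γ r h P x φ :=
  Asymptotics.IsBigO.of_bound 1 (hf.mono fun ε hε => by
    rw [one_mul, Real.norm_eq_abs, Real.norm_eq_abs]; exact hε.trans (le_abs_self _))

namespace RadialModel

variable [NeZero k] {γ r : ℝ} {h : ℝ → ℝ} {P : Measure (EuclideanSpace ℝ (Fin k))}
  [IsProbabilityMeasure P] {x : EuclideanSpace ℝ (Fin k)}
  {φ : ℝ → EuclideanSpace ℝ (Fin k) → ℝ}

/-- The linearized estimating equations for minimizers at the contaminated measures. -/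
lemma first_order (hm : RadialModel k γ h P r) (hx : ‖x‖ ≠ r)
    (hφ : ∀ᶠ ε in 𝓝[>] (0 : ℝ), IsMinimizer γ (contaminate P x ε) (φ ε))
    {T : ℝ → EuclideanSpace ℝ (Fin k)} {C : ℝ → Matrix (Fin k) (Fin k) ℝ} {s : ℝ → ℝ} {α b c : ℝ}
    (hTdef : ∀ ε, T ε = trimmedMean (contaminate P x ε) (φ ε))
    (hCdef : ∀ ε, C ε = trimmedCov (contaminate P x ε) (φ ε))
    (hsdef : ∀ ε, s ε = trimmedRadius γ (contaminate P x ε) (φ ε))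
    (hα : α = alpha k γ r h) (hb : b = h (r ^ 2) * (sphereArea k * r ^ k / k))
    (hc : c = b * r ^ 2 / (k + 2)) :
    ∃ w : ℝ → ℝ, (fun ε => b * (w ε - 1) - ε * (γ - inBall r x)) =o[𝓝[>] 0] deviation γ r h P x φ ∧
    (∀ p, (fun ε => (γ - b) * T ε p - ε * (inBall r x * x p)) =o[𝓝[>] 0] deviation γ r h P x φ) ∧
    (∀ p q, (fun ε => γ * (C ε p q - α ^ 2 * (1 : Matrix (Fin k) (Fin k) ℝ) p q)
      - (ε * (inBall r x * (x p * x q) - γ * α ^ 2 * (1 : Matrix (Fin k) (Fin k) ℝ) p q)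
        + c * ((w ε - 1) * (1 : Matrix (Fin k) (Fin k) ℝ) p q
          + (C ε p q - α ^ 2 * (1 : Matrix (Fin k) (Fin k) ℝ) p q) / α ^ 2
          + 2 * α / r * (s ε - r / α) * (1 : Matrix (Fin k) (Fin k) ℝ) p q)))
      =o[𝓝[>] 0] deviation γ r h P x φ) ∧
    (fun ε => 2 * (w ε - 1)
      - ∑ p, ((C ε p p - α ^ 2 * (1 : Matrix (Fin k) (Fin k) ℝ) p p) / α ^ 2
        + 2 * α / r * (s ε - r / α))) =o[𝓝[>] 0] deviation γ r h P x φ := by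
  have hr := hm.r_pos
  have hk : (0 : ℝ) < k := by exact_mod_cast Nat.pos_of_ne_zero (NeZero.ne k)
  have hN := hm.tendsto_deviation hφ
  obtain ⟨K, hK, hsand⟩ := hm.eventually_sandwich hx hφ
  set N := deviation γ r h P x φ with hNdef
  set B := Metric.closedBall (0 : EuclideanSpace ℝ (Fin k)) r with hB
  set E := fun ε => ellipsoid (T ε) (C ε) (s ε) with hE
  set v := sphereArea k * r ^ k / k with hv
  have hv0 : 0 < v := by have := sphereArea_pos (k := k); positivity
  simp only [← hTdef, ← hCdef, ← hsdef] at hsand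
  have hNval : ∀ ε, N ε = ‖T ε‖ + entrySum (C ε - α ^ 2 • (1 : Matrix (Fin k) (Fin k) ℝ))
      + |s ε - r / α| + ε := fun ε => by rw [hTdef, hCdef, hsdef, hα]; rfl
  have hpos : ∀ᶠ ε in 𝓝[>] (0 : ℝ), 0 < ε := self_mem_nhdsWithin
  have hlt : ∀ᶠ ε in 𝓝[>] (0 : ℝ), ε < γ :=
    (tendsto_id.mono_left nhdsWithin_le_nhds : Tendsto (fun ε : ℝ => ε) (𝓝[>] 0) (𝓝 0)).eventually_lt_const
      hm.γ_pos
  have hdom : ∀ᶠ ε in 𝓝[>] (0 : ℝ), ε ≤ N ε ∧ ‖T ε‖ ≤ N ε ∧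
      entrySum (C ε - α ^ 2 • (1 : Matrix (Fin k) (Fin k) ℝ)) ≤ N ε ∧ |s ε - r / α| ≤ N ε :=
    hpos.mono fun ε hε => by
      have b1 := norm_nonneg (T ε)
      have b2 := entrySum_nonneg (C ε - α ^ 2 • (1 : Matrix (Fin k) (Fin k) ℝ))
      have b3 := abs_nonneg (s ε - r / α)
      rw [hNval]
      refine ⟨?_, ?_, ?_, ?_⟩ <;> linarith
  have hN0 : ∀ᶠ ε in 𝓝[>] (0 : ℝ), 0 ≤ N ε := (hdom.and hpos).mono fun ε hε => hε.2.le.trans hε.1.1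
  have hEsand : ∀ᶠ ε in 𝓝[>] (0 : ℝ), MeasurableSet (E ε) ∧
      Metric.closedBall 0 (r - K * N ε) ⊆ E ε ∧ E ε ⊆ Metric.closedBall 0 (r + K * N ε) :=
    hsand.mono fun ε hε => ⟨measurableSet_ellipsoid _ _ _, hε.2⟩
  have hT1 : ∀ᶠ ε in 𝓝[>] (0 : ℝ), ‖T ε‖ ≤ 1 :=
    ((hdom.and (hN.eventually_le_const one_pos))).mono fun ε hε => hε.1.2.1.trans hε.2
  have hcoord : ∀ ε p (y : EuclideanSpace ℝ (Fin k)), ‖T ε‖ ≤ 1 → ‖y‖ ≤ 2 * r →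
      |y p - T ε p| ≤ 2 * r + 1 := fun ε p y hT hy => by
    have h1 : |(y - T ε) p| ≤ ‖y - T ε‖ := PiLp.norm_apply_le (y - T ε) p
    exact h1.trans ((norm_sub_le _ _).trans (add_le_add hy hT))
  -- remainders of the three kinds of integrals
  have hR₀ := hm.isLittleO_setIntegral hN hN0 hK hEsand (g := fun _ _ => 1)
    (fun _ => continuous_const) (M := 1) (Eventually.of_forall fun _ _ _ => by simp)
  have hR₁ := fun p => hm.isLittleO_setIntegral hN hN0 hK hEsand (g := fun ε y => y p - T ε p)
    (fun _ => by fun_prop) (M := 2 * r + 1) (hT1.mono fun ε hT y hy => hcoord ε p y hT hy)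
  have hR₂ := fun p q => hm.isLittleO_setIntegral hN hN0 hK hEsand
    (g := fun ε y => (y p - T ε p) * (y q - T ε q)) (fun _ => by fun_prop)
    (M := (2 * r + 1) * (2 * r + 1)) (hT1.mono fun ε hT y hy => by
      rw [abs_mul]
      exact mul_le_mul (hcoord ε p y hT hy) (hcoord ε q y hT hy) (abs_nonneg _) (by positivity))
  set R₀ : ℝ → ℝ := fun ε => ∫ y in E ε, (1 : ℝ) ∂P - ∫ y in B, (1 : ℝ) ∂P
    - h (r ^ 2) * ((∫ y in E ε, (1 : ℝ)) - ∫ y in B, (1 : ℝ))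
  set R₁ : Fin k → ℝ → ℝ := fun p ε => ∫ y in E ε, (y p - T ε p) ∂P - ∫ y in B, (y p - T ε p) ∂P
    - h (r ^ 2) * ((∫ y in E ε, (y p - T ε p)) - ∫ y in B, (y p - T ε p))
  set R₂ : Fin k → Fin k → ℝ → ℝ := fun p q ε => ∫ y in E ε, (y p - T ε p) * (y q - T ε q) ∂P
    - ∫ y in B, (y p - T ε p) * (y q - T ε q) ∂P
    - h (r ^ 2) * ((∫ y in E ε, (y p - T ε p) * (y q - T ε q))
      - ∫ y in B, (y p - T ε p) * (y q - T ε q))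
  have hvB : (volume : Measure (EuclideanSpace ℝ (Fin k))).real B = v := volume_real_closedBall hr.le
  have hPB : P.real B = γ := hm.measureReal_closedBall_r
  have hvol0 : ∀ p, ∫ y in B, y p = 0 := fun p => by
    have := setIntegral_ellipsoid_coord (B := ContinuousLinearMap.id ℝ (EuclideanSpace ℝ (Fin k)))
      (by simp [ContinuousLinearMap.det]) 0 r p
    have hBe : {y : EuclideanSpace ℝ (Fin k) | ‖ContinuousLinearMap.id ℝ _ y
        - ContinuousLinearMap.id ℝ _ 0‖ ≤ r} = B := by ext y; simp [hB]
    rw [hBe] at this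
    simpa using this
  -- Lebesgue moments of the ellipsoids
  set w : ℝ → ℝ := fun ε => volume.real (E ε) / v with hw
  have hmom : ∀ᶠ ε in 𝓝[>] (0 : ℝ), 0 ≤ w ε ∧ w ε ^ 2 = ((s ε ^ 2 / r ^ 2) • C ε).det ∧
      volume.real (E ε) = w ε * v ∧ (∀ p, ∫ y in E ε, (y p - T ε p) = 0) ∧
      ∀ p q, ∫ y in E ε, (y p - T ε p) * (y q - T ε q)
        = w ε * v * (s ε ^ 2 / (k + 2)) * C ε p q := by
    filter_upwards [hφ, hpos, hlt] with ε hφ hε0 hεγ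
    obtain ⟨hpd, hs0, -⟩ := hm.minimizer_spec hε0.le hεγ hφ
    rw [← hCdef] at hpd
    rw [← hsdef] at hs0
    obtain ⟨w', hw1, hw2, hw3, hw4, hw5⟩ := ellipsoid_moments hpd hr hs0 (T ε)
    have hww : w ε = w' := by
      simp only [hw, hE]
      rw [hw3]; exact mul_div_cancel_right₀ _ hv0.ne'
    rw [hww]
    exact ⟨hw1, hw2, hw3, hw4, hw5⟩
  have hEE := fun ε (hφ : IsMinimizer γ (contaminate P x ε) (φ ε)) (hε0 : 0 < ε) (hεγ : ε < γ)
    (hR : E ε ⊆ Metric.closedBall 0 (r + K * N ε)) =>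
    hm.estimating_equations hε0.le hεγ hφ (hTdef ε) (hCdef ε) (hsdef ε) hR
  have hall := hφ.and (hpos.and (hlt.and (hEsand.and (hsand.and hmom))))
  refine ⟨w, linearize (l := 𝓝[>] 0) (e := fun ε => ε) (T := fun ε => T ε) (C := C) (s := s)
    (a := inBall r x) (x := x)
    (by rw [hα]; exact hm.alpha_pos) hr hc hN
    (isBigO_deviation ((hdom.and hpos).mono fun ε hε => by rw [abs_of_pos hε.2]; exact hε.1.1))
    (fun p => isBigO_deviation (hdom.mono fun ε hε =>
      (PiLp.norm_apply_le (T ε) p : |T ε p| ≤ ‖T ε‖).trans hε.2.1))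
    (fun p q => isBigO_deviation (hdom.mono fun ε hε =>
      (abs_apply_le_entrySum (C ε - α ^ 2 • (1 : Matrix (Fin k) (Fin k) ℝ)) p q).trans hε.2.2.1))
    (isBigO_deviation (hdom.mono fun ε hε => hε.2.2.2))
    (hmom.mono fun ε hε => hε.1) (hmom.mono fun ε hε => hε.2.1) hR₀ hR₁ hR₂ ?_ (fun p => ?_)
    (fun p q => ?_)⟩
  · filter_upwards [hall] with ε hε
    obtain ⟨hφ, hε0, hεγ, hE1, hs1, hw0, hw2, hvolE, -, -⟩ := hε
    have h1 := (hEE ε hφ hε0 hεγ hE1.2.2).1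
    rw [hs1.1] at h1
    have h2 : P.real (E ε) = γ + b * (w ε - 1) + R₀ ε := by
      simp only [R₀, setIntegral_const, smul_eq_mul, mul_one, hvolE, hvB, hPB, hb]
      ring
    rw [← h2]; exact h1
  · filter_upwards [hall] with ε hε
    obtain ⟨hφ, hε0, hεγ, hE1, hs1, -, -, -, hmean, -⟩ := hε
    have h1 := (hEE ε hφ hε0 hεγ hE1.2.2).2.1 p
    rw [hs1.1] at h1
    have h2 : ∫ y in E ε, (y p - T ε p) ∂P = -(γ - b) * T ε p + R₁ p ε := by
      simp only [R₁, hmean]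
      rw [(setIntegral_closedBall_sub hm.setIntegral_coord (T ε) p p).1,
        (setIntegral_closedBall_sub hvol0 (T ε) p p).1, hPB, hvB, hb]
      ring
    rw [← h2]; exact h1
  · filter_upwards [hall] with ε hε
    obtain ⟨hφ, hε0, hεγ, hE1, hs1, -, -, -, -, hcov⟩ := hε
    have h1 := (hEE ε hφ hε0 hεγ hE1.2.2).2.2 p q
    rw [hs1.1] at h1
    have h2 : ∫ y in E ε, (y p - T ε p) * (y q - T ε q) ∂P
        = γ * α ^ 2 * (1 : Matrix (Fin k) (Fin k) ℝ) p q + (γ - b) * (T ε p * T ε q)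
        + b * w ε * (s ε ^ 2 / (k + 2)) * C ε p q - c * (1 : Matrix (Fin k) (Fin k) ℝ) p q
        + R₂ p q ε := by
      simp only [R₂, hcov]
      rw [(setIntegral_closedBall_sub hm.setIntegral_coord (T ε) p q).2,
        (setIntegral_closedBall_sub hvol0 (T ε) p q).2, hPB, hvB, hm.setIntegral_coord_mul,
        setIntegral_closedBall_coord_mul_one hr.le, hc, hb, Matrix.one_apply, hα, hv]
      field_simp
      ring
    rw [← h2]; exact h1

end RadialModel

/-! ### Solving the linearized equations -/

lemma norm_le_sum_abs (v : EuclideanSpace ℝ (Fin k)) : ‖v‖ ≤ ∑ p, |v p| := by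
  refine le_of_sq_le_sq ?_ (Finset.sum_nonneg fun _ _ => abs_nonneg _)
  rw [EuclideanSpace.real_norm_sq_eq]
  calc ∑ p, v p ^ 2 = ∑ p, |v p| ^ 2 := by simp
    _ ≤ _ := Finset.sum_sq_le_sq_sum_of_nonneg fun _ _ => abs_nonneg _

lemma tendsto_inv_mul_of_isLittleO {f : ℝ → ℝ} {a : ℝ}
    (hf : (fun ε => f ε - ε * a) =o[𝓝[>] 0] fun ε : ℝ => ε) :
    Tendsto (fun ε => ε⁻¹ * f ε) (𝓝[>] 0) (𝓝 a) := by
  have h1 := hf.tendsto_div_nhds_zero.add_const a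
  rw [zero_add] at h1
  refine h1.congr' ?_
  filter_upwards [self_mem_nhdsWithin] with ε hε
  have : ε ≠ 0 := ne_of_gt hε
  field_simp
  ring

/-- If finitely many quantities are linear in `ε` up to `o(N)`, where `N` is bounded by the sum of
their absolute values and `ε`, then the error is in fact `o(ε)`. -/
lemma isLittleO_of_le_sum {ι : Type*} [Fintype ι] {N : ℝ → ℝ} {f : ι → ℝ → ℝ} {a : ι → ℝ}
    (hN : ∀ᶠ ε in 𝓝[>] (0 : ℝ), N ε ≤ ∑ i, |f i ε| + ε) (hN0 : ∀ᶠ ε in 𝓝[>] (0 : ℝ), 0 ≤ N ε)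
    (hf : ∀ i, (fun ε => f i ε - ε * a i) =o[𝓝[>] 0] N) (i : ι) :
    (fun ε => f i ε - ε * a i) =o[𝓝[>] 0] fun ε : ℝ => ε := by
  have h1 : (fun ε => ∑ i, |f i ε - ε * a i|) =o[𝓝[>] 0] N :=
    Asymptotics.IsLittleO.fun_sum fun i _ => (hf i).abs_left
  refine (hf i).trans_isBigO (Asymptotics.IsBigO.of_bound (2 * (∑ i, |a i| + 1)) ?_)
  filter_upwards [hN, hN0, self_mem_nhdsWithin, h1.bound (half_pos one_pos)] with ε hN hN0 hε hb
  have hε0 : 0 < ε := hε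
  rw [Real.norm_eq_abs, Real.norm_eq_abs, abs_of_nonneg hN0, abs_of_nonneg
    (Finset.sum_nonneg fun _ _ => abs_nonneg _)] at hb
  rw [Real.norm_eq_abs, Real.norm_eq_abs, abs_of_nonneg hN0, abs_of_pos hε0]
  have h2 : ∑ i, |f i ε| ≤ ∑ i, |f i ε - ε * a i| + ε * ∑ i, |a i| := by
    rw [Finset.mul_sum, ← Finset.sum_add_distrib]
    refine Finset.sum_le_sum fun i _ => ?_
    have := abs_add_le (f i ε - ε * a i) (ε * a i)
    rwa [sub_add_cancel, abs_mul ε, abs_of_pos hε0] at this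
  linarith

namespace RadialModel

variable [NeZero k] {γ r : ℝ} {h : ℝ → ℝ} {P : Measure (EuclideanSpace ℝ (Fin k))}
  [IsProbabilityMeasure P] {x : EuclideanSpace ℝ (Fin k)}
  {φ : ℝ → EuclideanSpace ℝ (Fin k) → ℝ}

/-- First-order behaviour of the MCD functionals under contamination, with `b` the mass and `c` a
second moment of the uniform measure on the ball whose density is that of `P` at the boundary. -/
lemma tendsto_difference_quotients (hm : RadialModel k γ h P r) (hx : ‖x‖ ≠ r)
    (hφ : ∀ᶠ ε in 𝓝[>] (0 : ℝ), IsMinimizer γ (contaminate P x ε) (φ ε))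
    {T : ℝ → EuclideanSpace ℝ (Fin k)} {C : ℝ → Matrix (Fin k) (Fin k) ℝ} {s : ℝ → ℝ}
    {α b c g a : ℝ}
    (hTdef : ∀ ε, T ε = trimmedMean (contaminate P x ε) (φ ε))
    (hCdef : ∀ ε, C ε = trimmedCov (contaminate P x ε) (φ ε))
    (hsdef : ∀ ε, s ε = trimmedRadius γ (contaminate P x ε) (φ ε))
    (hα : α = alpha k γ r h) (hb : b = h (r ^ 2) * (sphereArea k * r ^ k / k))
    (hc : c = b * r ^ 2 / (k + 2)) (hg : g = γ - c / α ^ 2) (ha : a = inBall r x)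
    (hb0 : 0 < b) (hbγ : b < γ) (hg0 : 0 < g) :
    (∀ p, Tendsto (fun ε => ε⁻¹ * T ε p) (𝓝[>] 0) (𝓝 (1 / (γ - b) * a * x p))) ∧
    (∀ p q, Tendsto (fun ε => ε⁻¹ * (C ε p q - α ^ 2 * (1 : Matrix (Fin k) (Fin k) ℝ) p q))
      (𝓝[>] 0) (𝓝 (a * ((-(r ^ 2 / (k * γ)) + (1 / (k * γ) - 1 / (k * g)) * ‖x‖ ^ 2)
        * (1 : Matrix (Fin k) (Fin k) ℝ) p q + 1 / g * (x p * x q))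
        + (r ^ 2 - k * α ^ 2) / k * (1 : Matrix (Fin k) (Fin k) ℝ) p q))) ∧
    Tendsto (fun ε => ε⁻¹ * (s ε - r / α)) (𝓝[>] 0)
      (𝓝 (r / (2 * α * k) * (2 * (γ - a) / b
        - (a * ‖x‖ ^ 2 - γ * α ^ 2 * k + r ^ 2 * (γ - a)) / (γ * α ^ 2)))) := by
  have hr := hm.r_pos
  have hγ := hm.γ_pos
  have hα0 : 0 < α := by rw [hα]; exact hm.alpha_pos
  have hk : (0 : ℝ) < k := by exact_mod_cast Nat.pos_of_ne_zero (NeZero.ne k)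
  obtain ⟨w, E1, E2, E3, E4⟩ := hm.first_order hx hφ hTdef hCdef hsdef hα hb hc
  rw [← ha] at E1
  simp only [← ha] at E2 E3
  set N := deviation γ r h P x φ
  set D : ℝ → Fin k → Fin k → ℝ := fun ε p q =>
    C ε p q - α ^ 2 * (1 : Matrix (Fin k) (Fin k) ℝ) p q with hD
  set u : ℝ → ℝ := fun ε => 2 * α / r * (s ε - r / α) with hu
  have hn : ∑ p, x p * x p = ‖x‖ ^ 2 := by rw [EuclideanSpace.real_norm_sq_eq]; simp [sq]
  set τ := (a * ‖x‖ ^ 2 - γ * α ^ 2 * k + r ^ 2 * (γ - a)) / γ with hτ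
  -- Taking traces in the covariance equation eliminates the change of radius.
  have Etr : (fun ε => ∑ p, D ε p p - ε * τ) =o[𝓝[>] 0] N := by
    have h1 := Asymptotics.IsLittleO.fun_sum (s := Finset.univ) fun p (_ : p ∈ Finset.univ) => E3 p p
    refine (((h1.sub (E4.const_mul_left c)).add (E1.const_mul_left (c * (k + 2) / b))).const_mul_left
      (1 / γ)).congr_left fun ε => ?_
    simp only [Finset.sum_sub_distrib, Finset.sum_add_distrib, Matrix.one_apply_eq, mul_one,
      ← Finset.mul_sum, ← Finset.sum_div, hn, Finset.sum_const, Finset.card_univ, Fintype.card_fin,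
      nsmul_eq_mul, hτ, hD, hc]
    field_simp
    ring
  have Eu : (fun ε => u ε - ε * ((2 * (γ - a) / b - τ / α ^ 2) / k)) =o[𝓝[>] 0] N := by
    refine ((((E1.const_mul_left (2 / b)).sub E4).sub (Etr.const_mul_left (1 / α ^ 2))).const_mul_left
      (1 / k)).congr_left fun ε => ?_
    simp only [Finset.sum_sub_distrib, Finset.sum_add_distrib, ← Finset.sum_div, Finset.sum_const,
      Finset.card_univ, Fintype.card_fin, nsmul_eq_mul, hD, hu]
    field_simp
    ring
  have Es : (fun ε => (s ε - r / α) - ε * (r / (2 * α * k) * (2 * (γ - a) / b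
      - (a * ‖x‖ ^ 2 - γ * α ^ 2 * k + r ^ 2 * (γ - a)) / (γ * α ^ 2)))) =o[𝓝[>] 0] N := by
    refine (Eu.const_mul_left (r / (2 * α))).congr_left fun ε => ?_
    simp only [hu, hτ]
    field_simp
  have ET : ∀ p, (fun ε => T ε p - ε * (1 / (γ - b) * a * x p)) =o[𝓝[>] 0] N := fun p => by
    have : γ - b ≠ 0 := by linarith
    refine ((E2 p).const_mul_left (1 / (γ - b))).congr_left fun ε => ?_
    field_simp
  have ED : ∀ p q, (fun ε => D ε p q - ε * (a * ((-(r ^ 2 / (k * γ))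
      + (1 / (k * γ) - 1 / (k * g)) * ‖x‖ ^ 2)
        * (1 : Matrix (Fin k) (Fin k) ℝ) p q + 1 / g * (x p * x q))
        + (r ^ 2 - k * α ^ 2) / k * (1 : Matrix (Fin k) (Fin k) ℝ) p q)) =o[𝓝[>] 0] N :=
    fun p q => by
    refine (((E3 p q).add (((E1.const_mul_left (1 / b)).add Eu).const_mul_left
      (c * (1 : Matrix (Fin k) (Fin k) ℝ) p q))).const_mul_left (1 / g)).congr_left fun ε => ?_
    simp only [hD, hu, hτ]
    have hcb : b * r ^ 2 = c * (k + 2) := by rw [hc]; field_simp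
    have hcα : c = (γ - g) * α ^ 2 := by rw [hg]; field_simp; ring
    have hbc : b = (γ - g) * α ^ 2 * (k + 2) / r ^ 2 := by
      rw [← hcα, ← hcb]; field_simp
    have hγg : γ - g ≠ 0 := fun h0 => by rw [h0] at hbc; simp at hbc; linarith
    rw [hcα, hbc]
    field_simp
    ring
  -- Mean, covariance and radius together control the deviation, so all errors are `o(ε)`.
  have hN : ∀ᶠ ε in 𝓝[>] (0 : ℝ), N ε
      ≤ (∑ i : Fin k ⊕ (Fin k × Fin k) ⊕ Unit, |Sum.elim (fun p ε => T ε p)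
        (Sum.elim (fun pq ε => D ε pq.1 pq.2) fun _ ε => s ε - r / α) i ε|) + ε := by
    refine Eventually.of_forall fun ε => ?_
    have h1 : N ε = ‖T ε‖ + entrySum (C ε - α ^ 2 • (1 : Matrix (Fin k) (Fin k) ℝ))
      + |s ε - r / α| + ε := by rw [hTdef, hCdef, hsdef, hα]; rfl
    rw [h1, Fintype.sum_sum_type, Fintype.sum_sum_type, Fintype.sum_prod_type]
    have h2 := norm_le_sum_abs (T ε)
    have h3 : entrySum (C ε - α ^ 2 • (1 : Matrix (Fin k) (Fin k) ℝ)) = ∑ p, ∑ q, |D ε p q| := rfl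
    rw [h3]
    simp only [Sum.elim_inl, Sum.elim_inr, Finset.univ_unique, Finset.sum_singleton]
    linarith
  have hN0 : ∀ᶠ ε in 𝓝[>] (0 : ℝ), 0 ≤ N ε := by
    filter_upwards [self_mem_nhdsWithin] with ε hε
    have hε0 : 0 < ε := hε
    exact add_nonneg (add_nonneg (add_nonneg (norm_nonneg _) (entrySum_nonneg _)) (abs_nonneg _))
      hε0.le
  have key := isLittleO_of_le_sum hN hN0 (a := Sum.elim (fun p => 1 / (γ - b) * a * x p)
    (Sum.elim (fun pq => a * ((-(r ^ 2 / (k * γ)) + (1 / (k * γ) - 1 / (k * g)) * ‖x‖ ^ 2)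
        * (1 : Matrix (Fin k) (Fin k) ℝ) pq.1 pq.2 + 1 / g * (x pq.1 * x pq.2))
        + (r ^ 2 - k * α ^ 2) / k * (1 : Matrix (Fin k) (Fin k) ℝ) pq.1 pq.2)
      fun _ => r / (2 * α * k) * (2 * (γ - a) / b
      - (a * ‖x‖ ^ 2 - γ * α ^ 2 * k + r ^ 2 * (γ - a)) / (γ * α ^ 2))))
    (by rintro (p | pq | _); exacts [ET p, ED pq.1 pq.2, Es])
  exact ⟨fun p => tendsto_inv_mul_of_isLittleO (key (Sum.inl p)),
    fun p q => tendsto_inv_mul_of_isLittleO (key (Sum.inr (Sum.inl (p, q)))),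
    tendsto_inv_mul_of_isLittleO (key (Sum.inr (Sum.inr ())))⟩

end RadialModel

/-! ### The influence functions -/

lemma HasInfluence.unique {X V : Type*} [MeasurableSpace X] [AddCommGroup V] [Module ℝ V]
    [TopologicalSpace V] [T2Space V] {Θ : Measure X → Set V} {P : Measure X} {x : X} {L L' : V}
    (h : HasInfluence Θ P x L) (h' : HasInfluence Θ P x L') : L = L' := by
  obtain ⟨θ₀, hθ₀⟩ := h.1
  obtain ⟨θ, hθ⟩ := h.2.1.choice
  exact tendsto_nhds_unique (h.2.2 θ₀ hθ₀ θ hθ) (h'.2.2 θ₀ hθ₀ θ hθ)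

namespace RadialModel

variable [NeZero k] {γ r : ℝ} {h : ℝ → ℝ} {P : Measure (EuclideanSpace ℝ (Fin k))}
  [IsProbabilityMeasure P] {x : EuclideanSpace ℝ (Fin k)}

/-- At `P` itself the functionals are single-valued. -/
lemma values_of_isMinimizer (hm : RadialModel k γ h P r) {φ : EuclideanSpace ℝ (Fin k) → ℝ}
    (hφ : IsMinimizer γ P φ) :
    trimmedMean P φ = 0 ∧ trimmedCov P φ = alpha k γ r h ^ 2 • (1 : Matrix (Fin k) (Fin k) ℝ) ∧
      trimmedRadius γ P φ = r / alpha k γ r h := by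
  -- consistency along the constant sequence without contamination
  have hφ' : ∀ᶠ _ in (atTop : Filter ℕ), IsMinimizer γ (contaminate P 0 0) φ :=
    Eventually.of_forall fun _ => by rwa [contaminate_zero]
  have he0 : ∀ᶠ _ in (atTop : Filter ℕ), (0 : ℝ) ≤ 0 := Eventually.of_forall fun _ => le_rfl
  obtain ⟨h1, h2⟩ := hm.tendsto_mean_cov 0 tendsto_const_nhds he0 hφ'
  have h3 := hm.tendsto_radius 0 tendsto_const_nhds he0 hφ'
  rw [contaminate_zero] at h1 h2 h3
  exact ⟨tendsto_nhds_unique tendsto_const_nhds h1, tendsto_nhds_unique tendsto_const_nhds h2,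
    tendsto_nhds_unique tendsto_const_nhds h3⟩

lemma exists_isMinimizer (hm : RadialModel k γ h P r) : ∃ φ, IsMinimizer γ P φ :=
  MCD.exists_isMinimizer hm.γ_pos hm.γ_lt_one hm.absolutelyContinuous hm.γ_pos
    fun S _ => by rw [add_zero]

lemma eventually_exists_isMinimizer (hm : RadialModel k γ h P r) (x : EuclideanSpace ℝ (Fin k)) :
    ∀ᶠ ε in 𝓝[>] (0 : ℝ), ∃ φ, IsMinimizer γ (contaminate P x ε) φ := by
  filter_upwards [Ioo_mem_nhdsGT hm.γ_pos] with ε hε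
  have h1 : ε ≤ 1 := (hε.2.trans hm.γ_lt_one).le
  have := isProbabilityMeasure_contaminate (P := P) (x := x) hε.1.le h1
  exact MCD.exists_isMinimizer hm.γ_pos hm.γ_lt_one hm.absolutelyContinuous hε.2
    fun S hS => measureReal_contaminate_le hε.1.le h1 hS

/-- A functional `F` of the trimming function has influence function `L` once its difference
quotients converge along every choice of minimizers. -/
lemma hasInfluence_of_tendsto {V : Type*} [AddCommGroup V] [Module ℝ V] [TopologicalSpace V]
    (hm : RadialModel k γ h P r)
    (F : Measure (EuclideanSpace ℝ (Fin k)) → (EuclideanSpace ℝ (Fin k) → ℝ) → V) {v₀ L : V}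
    (hF : ∀ φ, IsMinimizer γ P φ → F P φ = v₀)
    (hL : ∀ φ : ℝ → EuclideanSpace ℝ (Fin k) → ℝ,
      (∀ᶠ ε in 𝓝[>] (0 : ℝ), IsMinimizer γ (contaminate P x ε) (φ ε)) →
      Tendsto (fun ε : ℝ => ε⁻¹ • (F (contaminate P x ε) (φ ε) - v₀)) (𝓝[>] 0) (𝓝 L)) :
    HasInfluence (fun Q => {v | ∃ φ, IsMinimizer γ Q φ ∧ v = F Q φ}) P x L := by
  refine ⟨?_, ?_, ?_⟩
  · obtain ⟨φ, hφ⟩ := hm.exists_isMinimizer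
    exact ⟨_, φ, hφ, rfl⟩
  · exact (hm.eventually_exists_isMinimizer x).mono fun ε ⟨φ, hφ⟩ => ⟨_, φ, hφ, rfl⟩
  · rintro θ₀ ⟨φ₀, hφ₀, rfl⟩ θ hθ
    have hθ' : ∀ᶠ ε in 𝓝[>] (0 : ℝ), ∃ φ, IsMinimizer γ (contaminate P x ε) φ ∧
      θ ε = F (contaminate P x ε) φ := hθ
    obtain ⟨φ, hφ⟩ := hθ'.choice
    rw [hF φ₀ hφ₀]
    refine (hL φ (hφ.mono fun ε hε => hε.1)).congr' (hφ.mono fun ε hε => ?_)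
    simp only [hε.2]

/-- The constants of the influence functions in terms of `b`, the boundary density times the
volume of the ball, and of the coefficients `γ - b` and `g` of the linearized equations. -/
lemma constants (hm : RadialModel k γ h P r) :
    ∃ b c g : ℝ, b = h (r ^ 2) * (sphereArea k * r ^ k / k) ∧ c = b * r ^ 2 / (k + 2) ∧
      g = γ - c / alpha k γ r h ^ 2 ∧ 0 < b ∧ b < γ ∧ 0 < g ∧
      piConst k γ r h = 1 / (γ - b) ∧ kappa2 k γ r h = 1 / (k * γ) - 1 / (k * g) ∧
      kappa3 k γ r h = 1 / g ∧ nu0 k γ r h = b * k * alpha k γ r h / r := by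
  have hr := hm.r_pos
  have hγ := hm.γ_pos
  have hα := hm.alpha_pos
  have hA := sphereArea_pos (k := k)
  have hh := hm.h_r_pos
  have hk : (0 : ℝ) < k := by exact_mod_cast Nat.pos_of_ne_zero (NeZero.ne k)
  set α := alpha k γ r h with hαdef
  set b := h (r ^ 2) * (sphereArea k * r ^ k / k) with hb
  set c := b * r ^ 2 / (k + 2) with hc
  set g := γ - c / α ^ 2 with hg
  have hb0 : 0 < b := by positivity
  have hbγ : b < γ := hm.lt_mass
  have hg0 : 0 < g := by
    have h1 := hm.lt_alpha_sq
    have h2 : h (r ^ 2) * (sphereArea k * r ^ (k + 2) / (k * (k + 2))) = c := by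
      rw [hc, hb, pow_add]; field_simp
    rw [h2] at h1
    rw [hg, sub_pos, div_lt_iff₀ (by positivity)]
    exact h1
  have hν : nu0 k γ r h = b * k * α / r := by
    have h1 : r ^ k = r ^ (k - 1) * r := by
      rw [← pow_succ, Nat.sub_add_cancel (Nat.one_le_iff_ne_zero.2 (NeZero.ne k))]
    rw [nu0, hb, h1, ← hαdef]; field_simp
  have hβ1 : α * beta1 k γ r h = b - γ := by
    rw [beta1, hν, rho0, ← hαdef]; field_simp
  have hβ2 : α * beta2 k γ r h = -2 * g := by
    rw [beta2, hν, rho0, ← hαdef, hg, hc]; field_simp; ring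
  have hγb : γ - b ≠ 0 := by linarith
  refine ⟨b, c, g, rfl, rfl, rfl, hb0, hbγ, hg0, ?_, ?_, ?_, hν⟩
  · rw [piConst, ← hαdef, hβ1, one_div, ← inv_neg, neg_sub]
  · have h1 : k * γ * α * beta2 k γ r h = k * γ * (α * beta2 k γ r h) := by ring
    rw [kappa2, ← hαdef, h1, hβ2]
    field_simp
    ring
  · rw [kappa3, ← hαdef, hβ2]
    field_simp

lemma hasInfluence_location (hm : RadialModel k γ h P r) (hx : ‖x‖ ≠ r) :
    HasInfluence (locationValues γ) P x ((piConst k γ r h * inBall r x) • x) := by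
  obtain ⟨b, c, g, hb, hc, hg, hb0, hbγ, hg0, hpi, -⟩ := hm.constants
  refine hm.hasInfluence_of_tendsto trimmedMean (fun φ hφ => (hm.values_of_isMinimizer hφ).1)
    fun φ hφ => ?_
  have H := (hm.tendsto_difference_quotients hx hφ (fun _ => rfl) (fun _ => rfl) (fun _ => rfl) rfl
    hb hc hg rfl hb0 hbγ hg0).1
  have h1 : Tendsto (fun ε : ℝ => (ε⁻¹ • (trimmedMean (contaminate P x ε) (φ ε) - 0)).ofLp) (𝓝[>] 0)
      (𝓝 ((piConst k γ r h * inBall r x) • x).ofLp) := by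
    refine tendsto_pi_nhds.2 fun p => ?_
    simpa [hpi] using H p
  exact ((PiLp.continuous_toLp 2 _).tendsto _).comp h1

lemma hasInfluence_cov (hm : RadialModel k γ h P r) (hx : ‖x‖ ≠ r) :
    HasInfluence (covValues γ) P x
        (inBall r x •
            (kappa1 k γ r • (1 : Matrix (Fin k) (Fin k) ℝ)
              + (kappa2 k γ r h * ‖x‖ ^ 2) • (1 : Matrix (Fin k) (Fin k) ℝ)
              + kappa3 k γ r h • Matrix.vecMulVec x.ofLp x.ofLp)
          + kappa4 k γ r h • (1 : Matrix (Fin k) (Fin k) ℝ)) := by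
  obtain ⟨b, c, g, hb, hc, hg, hb0, hbγ, hg0, -, hκ2, hκ3, -⟩ := hm.constants
  refine hm.hasInfluence_of_tendsto trimmedCov (fun φ hφ => (hm.values_of_isMinimizer hφ).2.1)
    fun φ hφ => ?_
  have H := (hm.tendsto_difference_quotients hx hφ (fun _ => rfl) (fun _ => rfl) (fun _ => rfl) rfl
    hb hc hg rfl hb0 hbγ hg0).2.1
  refine tendsto_pi_nhds.2 fun p => tendsto_pi_nhds.2 fun q => ?_
  have h1 := H p q
  simp only [Matrix.add_apply, Matrix.smul_apply, Matrix.sub_apply, smul_eq_mul,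
    Matrix.vecMulVec_apply, kappa1, hκ2, hκ3, kappa4]
  convert h1 using 2
  ring

lemma hasInfluence_radius (hm : RadialModel k γ h P r) (hx : ‖x‖ ≠ r) :
    HasInfluence (radiusValues γ) P x
        (lambda1 k γ r h * inBall r x * ‖x‖ ^ 2
          + lambda2 k γ r h * inBall r x + lambda3 k γ r h) := by
  have hr := hm.r_pos
  have hγ := hm.γ_pos
  have hα := hm.alpha_pos
  have hk : (0 : ℝ) < k := by exact_mod_cast Nat.pos_of_ne_zero (NeZero.ne k)
  obtain ⟨b, c, g, hb, hc, hg, hb0, hbγ, hg0, -, -, -, hν⟩ := hm.constants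
  refine hm.hasInfluence_of_tendsto (trimmedRadius γ)
    (fun φ hφ => (hm.values_of_isMinimizer hφ).2.2) fun φ hφ => ?_
  have H := (hm.tendsto_difference_quotients hx hφ (fun _ => rfl) (fun _ => rfl) (fun _ => rfl) rfl
    hb hc hg rfl hb0 hbγ hg0).2.2
  simp only [smul_eq_mul]
  convert H using 2
  rw [lambda1, lambda2, lambda3, beta6, hν]
  field_simp
  ring

end RadialModel


lemma abs_inBall_mul_pow_le {r : ℝ} (hr : 0 ≤ r) (x : EuclideanSpace ℝ (Fin k)) (n : ℕ) :
    |inBall r x * ‖x‖ ^ n| ≤ r ^ n := by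
  rw [inBall]
  split_ifs with hx
  · rw [one_mul, abs_of_nonneg (by positivity)]; gcongr
  · rw [zero_mul, abs_zero]; positivity

end MCD

theorem corollary4p6 (k : ℕ) (hk : 1 ≤ k) (γ : ℝ) (hγ0 : 0 < γ) (hγ1 : γ < 1)
    (h : ℝ → ℝ) (h_nonneg : ∀ t, 0 ≤ t → 0 ≤ h t) (h_anti : AntitoneOn h (Set.Ici 0))
    (P : Measure (EuclideanSpace ℝ (Fin k))) [IsProbabilityMeasure P]
    (hP : P = (volume : Measure (EuclideanSpace ℝ (Fin k))).withDensity
      (fun x => ENNReal.ofReal (h (‖x‖ ^ 2))))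
    (r : ℝ) (hr0 : 0 < r) (hr : MCD.radialMass k h r = γ)
    (h_cont : ContinuousAt h (r ^ 2))
    (h_nonconst : ∃ s ∈ Set.Ioo 0 (r ^ 2), ∃ t ∈ Set.Ioo 0 (r ^ 2), h s ≠ h t) :
    (∀ x : EuclideanSpace ℝ (Fin k), ‖x‖ ≠ r →
      MCD.HasInfluence (MCD.locationValues γ) P x
        ((MCD.piConst k γ r h * MCD.inBall r x) • x) ∧
      MCD.HasInfluence (MCD.covValues γ) P x
        (MCD.inBall r x •
            (MCD.kappa1 k γ r • (1 : Matrix (Fin k) (Fin k) ℝ)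
              + (MCD.kappa2 k γ r h * ‖x‖ ^ 2) • (1 : Matrix (Fin k) (Fin k) ℝ)
              + MCD.kappa3 k γ r h • Matrix.vecMulVec x.ofLp x.ofLp)
          + MCD.kappa4 k γ r h • (1 : Matrix (Fin k) (Fin k) ℝ)) ∧
      MCD.HasInfluence (MCD.radiusValues γ) P x
        (MCD.lambda1 k γ r h * MCD.inBall r x * ‖x‖ ^ 2
          + MCD.lambda2 k γ r h * MCD.inBall r x + MCD.lambda3 k γ r h)) ∧
    (∃ M : ℝ, ∀ x : EuclideanSpace ℝ (Fin k), ‖x‖ ≠ r →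
      (∀ a, MCD.HasInfluence (MCD.locationValues γ) P x a → ‖a‖ ≤ M) ∧
      (∀ B, MCD.HasInfluence (MCD.covValues γ) P x B → ∀ i j, |B i j| ≤ M) ∧
      (∀ c, MCD.HasInfluence (MCD.radiusValues γ) P x c → |c| ≤ M)) := by
  have : NeZero k := ⟨by omega⟩
  have hm : MCD.RadialModel k γ h P r :=
    ⟨hγ0, hγ1, h_nonneg, h_anti, hP, hr0, hr, h_cont, h_nonconst⟩
  refine ⟨fun x hx => ⟨hm.hasInfluence_location hx, hm.hasInfluence_cov hx,
    hm.hasInfluence_radius hx⟩, ?_⟩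
  set M₁ := |MCD.piConst k γ r h| * r
  set M₂ := |MCD.kappa1 k γ r| + |MCD.kappa2 k γ r h| * r ^ 2 + |MCD.kappa3 k γ r h| * r ^ 2
    + |MCD.kappa4 k γ r h|
  set M₃ := |MCD.lambda1 k γ r h| * r ^ 2 + |MCD.lambda2 k γ r h| + |MCD.lambda3 k γ r h|
  refine ⟨max M₁ (max M₂ M₃), fun x hx => ⟨fun a ha => ?_, fun B hB i j => ?_, fun c hc => ?_⟩⟩
  · rw [ha.unique (hm.hasInfluence_location hx), norm_smul, Real.norm_eq_abs, abs_mul, mul_assoc]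
    refine le_trans ?_ (le_max_left _ _)
    have h1 := MCD.abs_inBall_mul_pow_le hr0.le x 1
    rw [pow_one, pow_one, abs_mul, abs_norm] at h1
    exact mul_le_mul_of_nonneg_left h1 (abs_nonneg _)
  · rw [hB.unique (hm.hasInfluence_cov hx)]
    refine le_trans ?_ ((le_max_left _ _).trans (le_max_right _ _))
    set ι := MCD.inBall r x
    set δ := (1 : Matrix (Fin k) (Fin k) ℝ) i j
    have hδ : |δ| ≤ 1 := by
      simp only [δ, Matrix.one_apply]; split_ifs <;> simp
    have h0 : |ι| ≤ 1 := by simpa using MCD.abs_inBall_mul_pow_le hr0.le x 0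
    have h2 := MCD.abs_inBall_mul_pow_le hr0.le x 2
    have h3 : |ι * (x i * x j)| ≤ r ^ 2 := by
      refine le_trans ?_ h2
      rw [abs_mul, abs_mul, abs_mul, abs_of_nonneg (sq_nonneg ‖x‖), sq]
      gcongr
      · exact PiLp.norm_apply_le x i
      · exact PiLp.norm_apply_le x j
    have e : (ι • (MCD.kappa1 k γ r • (1 : Matrix (Fin k) (Fin k) ℝ)
              + (MCD.kappa2 k γ r h * ‖x‖ ^ 2) • (1 : Matrix (Fin k) (Fin k) ℝ)
              + MCD.kappa3 k γ r h • Matrix.vecMulVec x.ofLp x.ofLp)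
          + MCD.kappa4 k γ r h • (1 : Matrix (Fin k) (Fin k) ℝ)) i j
        = MCD.kappa1 k γ r * (ι * δ) + MCD.kappa2 k γ r h * ((ι * ‖x‖ ^ 2) * δ)
          + MCD.kappa3 k γ r h * (ι * (x i * x j)) + MCD.kappa4 k γ r h * δ := by
      simp only [Matrix.add_apply, Matrix.smul_apply, smul_eq_mul, Matrix.vecMulVec_apply, δ]
      ring
    rw [e]
    refine (abs_add_le _ _).trans (add_le_add ((abs_add_le _ _).trans (add_le_add
      ((abs_add_le _ _).trans (add_le_add ?_ ?_)) ?_)) ?_)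
    · rw [abs_mul, abs_mul]
      exact mul_le_of_le_one_right (abs_nonneg _) (mul_le_one₀ h0 (abs_nonneg _) hδ)
    · rw [abs_mul, abs_mul (ι * ‖x‖ ^ 2)]
      gcongr
      exact (mul_le_of_le_one_right (abs_nonneg _) hδ).trans h2
    · rw [abs_mul]; gcongr
    · rw [abs_mul]; exact mul_le_of_le_one_right (abs_nonneg _) hδ
  · rw [hc.unique (hm.hasInfluence_radius hx)]
    refine le_trans ?_ ((le_max_right _ _).trans (le_max_right _ _))
    have h0 : |MCD.inBall r x| ≤ 1 := by simpa using MCD.abs_inBall_mul_pow_le hr0.le x 0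
    have h2 := MCD.abs_inBall_mul_pow_le hr0.le x 2
    refine (abs_add_le _ _).trans (add_le_add ((abs_add_le _ _).trans (add_le_add ?_ ?_)) le_rfl)
    · rw [mul_assoc, abs_mul]; gcongr
    · rw [abs_mul]; exact mul_le_of_le_one_right (abs_nonneg _) h0
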